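/- **Conventions.** A $(2,1)$-category is a (strict) $2$-category all of whose $2$-cells are invertible. An arrowy $2$-subcategory $\mathcal A$ of $\mathcal C$ contains all objects of $\mathcal C$ and all $2$-cells between its morphisms (so it is given by a class of morphisms containing identities and closed under composition). For a pseudofunctor $F$ (resp. pseudonatural transformation $\alpha$, modification $\Xi$), $|F|$ (resp. $|\alpha|$, $|\Xi|$) denotes its map on objects (resp. its components). $\mathrm{PsFun}(\mathcal A,\mathcal D)$ is the $2$-category of pseudofunctors, pseudonatural transformations and modifications. Constraint isomorphisms of pseudofunctors are suppressed in displayed equations. Let $\mathcal C$ be a $(2,1)$-category, $\mathcal A,\mathcal B$ arrowy $2$-subcategories. An $(\mathcal A,\mathcal B)$-square $D$ consists of $j:X\to Y$, $i:Z\to W$ in $\mathcal A$, $q:X\to Z$, $p:Y\to W$ in $\mathcal B$ and a $2$-cell $\alpha: iq\Rightarrow pj$. It is $2$-Cartesian if it exhibits $X$ as the $2$-fiber product of $i$ and $p$ in $\mathcal C$. Its transpose is the $(\mathcal B,\mathcal A)$-square with $2$-cell $\alpha^{-1}$. $(\mathcal A,\mathcal B)$ is *squaring* if every $(\mathcal A,\mathcal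 B)$-square as above is the pasting of a $2$-Cartesian $(\mathcal A,\mathcal B)$-square $(k:X'\to Y,\ r:X'\to Z,\ i,\ p)$ with $2$-cells $\gamma:q\Rightarrow rf$, $\delta:kf\Rightarrow j$ for some $f:X\to X'$ in $\mathcal A\cap\mathcal B$. For $\mathcal A_i,\mathcal A_j,\mathcal A_k$ consider $2$-commutative cubes with bottom face $K$ an $(\mathcal A_i,\mathcal A_j)$-square with $b:X\to Y$, $a:Z\to W$ in $\mathcal A_i$ and $q:X\to Z$, $p:Y\to W$ in $\mathcal A_j$, top face $K'$ a similar square with $b',q',a',p'$ on $X',Y',Z',W'$, and vertical morphisms $x:X'\to X$, $y:Y'\to Y$, $z:Z'\to Z$, $w:W'\to W$ in $\mathcal A_k$; the front and back faces $J: az\Rightarrow wa'$, $J': bx\Rightarrow yb'$ are $(\mathcal A_i,\mathcal A_k)$-squares and the right and left faces $I: py\Rightarrow wp'$, $I': qx\Rightarrow zq'$ are $(\mathcal A_j,\mathcal A_k)$-squares. $(\mathcal A_i,\mathcal A_j)$ is *$\mathcal A_k$-squaring* if every such cube decomposes as follows: there are objects $V,V'$, morphisms $c:V\to Y$, $c':V'\to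 Y'$ of $\mathcal A_i$, $r:V\to Z$, $r':V'\to Z'$ of $\mathcal A_j$, $v:V'\to V$ of $\mathcal A_k$, $f:X\to V$, $f':X'\to V'$ of $\mathcal A_i\cap\mathcal A_j$, $2$-Cartesian squares $L=(c,r,a,p)$ and $L'=(c',r',a',p')$, squares $rv\Rightarrow zr'$, $cv\Rightarrow yc'$ and $fx\Rightarrow vf'$, and $2$-cells $\gamma:q\Rightarrow rf$, $\delta:cf\Rightarrow b$, $\gamma':q'\Rightarrow r'f'$, $\delta':c'f'\Rightarrow b'$, such that the inner cube on $V,Y,Z,W,V',Y',Z',W'$ (with front face $J$ and right face $I$) is $2$-commutative, $K$ (resp. $K'$) is the pasting of $L,\gamma,\delta$ (resp. $L',\gamma',\delta'$), and $I'$ (resp. $J'$) is the pasting of $\gamma$, the squares $fx\Rightarrow vf'$ and $rv\Rightarrow zr'$, and $\gamma'^{-1}$ (resp. of $\delta^{-1}$, the squares $fx\Rightarrow vf'$ and $cv\Rightarrow yc'$, and $\delta'$). Let $\mathcal D$ be a $2$-category and $\mathcal A_1,\dots,\mathcal A_n$ arrowy $2$-subcategories of $\mathcal C$. **The $2$-category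 $\mathrm{GD}=\mathrm{GD}_{\mathcal A_1,\dots,\mathcal A_n}(\mathcal C,\mathcal D)$.** An object is $((F_i)_{1\le i\le n},(G_{ij})_{i<j})$: pseudofunctors $F_i:\mathcal A_i\to\mathcal D$ with $|F_1|=\dots=|F_n|$, and for $i<j$ and every $(\mathcal A_i,\mathcal A_j)$-square $D=(b,q,a,p;\alpha: aq\Rightarrow pb)$ an invertible $2$-cell $G_{ijD}:F_i(a)F_j(q)\Rightarrow F_j(p)F_i(b)$, such that: (a), (a') if the vertical (resp. horizontal) morphisms of $D$ are identities, $G_{ijD}$ is identified with $F_i(\alpha)$ (resp. $F_j(\alpha)$); (b), (b') $G_{ij}$ of a vertical (resp. horizontal) composite of squares is the composite of the $G_{ij}$'s; (D) for $i<j<k$ and every $2$-commutative cube as above the two composites $F_i(a)F_j(q)F_k(x)\Rightarrow F_k(w)F_j(p')F_i(b')$ formed from $G_{jkI'},G_{ikJ},G_{ijK'}$ and from $G_{ijK},G_{ikJ'},G_{jkI}$ are equal. A morphism is a family of pseudonatural transformations $\alpha_i:F_i\to F_i'$ with $|\alpha_1|=\dots=|\alpha_n|=:\alpha_0$ such that (m)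 for $i<j$ and every $(\mathcal A_i,\mathcal A_j)$-square $D$, the two composites $\alpha_0(W)F_i(a)F_j(q)\Rightarrow F'_j(p)F'_i(b)\alpha_0(X)$ formed from $G_D,\alpha_j(p),\alpha_i(b)$ and from $\alpha_i(a),\alpha_j(q),G'_D$ are equal. A $2$-cell is a family of modifications $\Xi_i$ with $|\Xi_1|=\dots=|\Xi_n|$. **The $2$-category $\mathrm{GD}^{\mathrm{Cart}}=\mathrm{GD}^{\mathrm{Cart}}_{\mathcal A_1,\dots,\mathcal A_n}(\mathcal C,\mathcal D)$.** An object is $((F_i),(G_{ij})_{i<j},(\rho_{ij})_{i<j})$: $F_i$ as before, invertible $2$-cells $G_{ijD}$ for the *$2$-Cartesian* $(\mathcal A_i,\mathcal A_j)$-squares $D$ only, and invertible pseudonatural transformations $\rho_{ij}:F_j|_{\mathcal A_i\cap\mathcal A_j}\to F_i|_{\mathcal A_i\cap\mathcal A_j}$ with identity components, such that (b), (b') hold for $2$-Cartesian squares; (c) for every $2$-Cartesian $D$ with $p,q\in\mathcal A_i\cap\mathcal A_j$, $\rho_{ij}(p)\circ G_{ijD}=F_i(\alpha)\circ\rho_{ij}(q)$;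 (c') for every $2$-Cartesian $D$ with $a,b\in\mathcal A_i\cap\mathcal A_j$, $\rho_{ij}(b)^{-1}\circ G_{ijD}=F_j(\alpha)\circ\rho_{ij}(a)^{-1}$; (D) holds for $i<j<k$ and cubes all of whose faces are $2$-Cartesian; (E) for $j<k$, $i\ne j,k$ and every $2$-Cartesian $(\mathcal A_i,\mathcal A_j\cap\mathcal A_k)$-square $D$, $G_{ijD}\circ\rho_{jk}(q)=\rho_{jk}(p)\circ G_{ikD}$, where for $i>j$ one puts $G_{ijD}=(G_{ji})^{-1}$ of the transpose of $D$; (F) $\rho_{ij}\circ\rho_{jk}=\rho_{ik}$ on $\mathcal A_i\cap\mathcal A_j\cap\mathcal A_k$ for $i<j<k$. A morphism is a family $(\alpha_i)$ with common components satisfying (m) for $2$-Cartesian squares and (n) $\alpha_i\circ\rho_{ij}=\rho'_{ij}\circ\alpha_j$ on $\mathcal A_i\cap\mathcal A_j$ for $i<j$. $2$-cells are as in $\mathrm{GD}$. Both are $\mathcal D^{\mathrm{Ob}(\mathcal C)}$-categories, i.e. $2$-categories equipped with a $2$-functor to $\mathcal D^{\mathrm{Ob}(\mathcal C)}$, by taking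 $|\cdot|$. There is a $\mathcal D^{\mathrm{Ob}(\mathcal C)}$-functor $\mathrm{GD}\to\mathrm{GD}^{\mathrm{Cart}}$, $((F_i),(G_{ij}))\mapsto((F_i),(G_{ij}),(\rho_{ij}))$, which restricts $G_{ij}$ to $2$-Cartesian squares, does not change $(\alpha_i)$ and $(\Xi_i)$, and where, for $f:X\to Y$ in $\mathcal A_i\cap\mathcal A_j$, $\rho_{ij}(f)$ is the composite $$F_j(f)\cong F_i(1_Y)F_j(f)\xrightarrow{G_{ijD}}F_j(1_Y)F_i(f)\cong F_i(f),$$ $D$ being the square with top and left morphisms $f$, bottom and right morphisms $1_Y$ and identity $2$-cell. **Theorem.** Let $\mathcal C$ be a $(2,1)$-category, $\mathcal A_1,\dots,\mathcal A_n$ arrowy $2$-subcategories of $\mathcal C$, and $\mathcal D$ a $2$-category. Assume that every equivalence of $\mathcal C$ lies in $\mathcal A_1\cap\dots\cap\mathcal A_n$, that for all $i\ne j$ the pairs $(\mathcal A_i,\mathcal A_j)$ and $(\mathcal A_i,\mathcal A_i\cap\mathcal A_j)$ are squaring in $\mathcal C$, and that for pairwise distinct $i,j,k$, $(\mathcal A_i,\mathcal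 A_j)$ is $\mathcal A_k$-squaring and $(\mathcal A_i\cap\mathcal A_j,\mathcal A_k)$ is squaring in $\mathcal C$. Then the above $\mathcal D^{\mathrm{Ob}(\mathcal C)}$-functor $\mathrm{GD}_{\mathcal A_1,\dots,\mathcal A_n}(\mathcal C,\mathcal D)\to\mathrm{GD}^{\mathrm{Cart}}_{\mathcal A_1,\dots,\mathcal A_n}(\mathcal C,\mathcal D)$ is (well defined and) an isomorphism of $\mathcal D^{\mathrm{Ob}(\mathcal C)}$-categories, i.e. a strict $2$-functor over $\mathcal D^{\mathrm{Ob}(\mathcal C)}$ that is bijective on objects, morphisms and $2$-cells. -/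

import Mathlib

open CategoryTheory Bicategory

namespace GluingData

universe w₁ v₁ u₁ w₂ v₂ u₂ w₃ v₃ u₃ u₄

section Pasting

variable {B : Type u₁} [Bicategory.{w₁, v₁} B]

/-- Horizontal pasting of squares filled by invertible 2-cells. Composition is written in
diagrammatic order, so `q ≫ i ≅ j ≫ p` is a 2-cell `i q ⇒ p j` filling the square with top `j`,
left side `q`, bottom `i`, right side `p`. -/
def hpaste {X₁ X₂ X₃ Y₁ Y₂ Y₃ : B} {j : X₁ ⟶ X₂} {j' : X₂ ⟶ X₃} {i : Y₁ ⟶ Y₂} {i' : Y₂ ⟶ Y₃}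
    {p₁ : X₁ ⟶ Y₁} {p₂ : X₂ ⟶ Y₂} {p₃ : X₃ ⟶ Y₃}
    (S : p₁ ≫ i ≅ j ≫ p₂) (S' : p₂ ≫ i' ≅ j' ≫ p₃) :
    p₁ ≫ (i ≫ i') ≅ (j ≫ j') ≫ p₃ :=
  (α_ p₁ i i').symm ≪≫ whiskerRightIso S i' ≪≫ α_ j p₂ i' ≪≫ whiskerLeftIso j S' ≪≫
    (α_ j j' p₃).symm

/-- Vertical pasting of squares filled by invertible 2-cells. -/
def vpaste {X₁ X₂ X₃ Y₁ Y₂ Y₃ : B} {i₁ : X₁ ⟶ Y₁} {i₂ : X₂ ⟶ Y₂} {i₃ : X₃ ⟶ Y₃}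
    {q : X₁ ⟶ X₂} {q' : X₂ ⟶ X₃} {p : Y₁ ⟶ Y₂} {p' : Y₂ ⟶ Y₃}
    (S : q ≫ i₂ ≅ i₁ ≫ p) (S' : q' ≫ i₃ ≅ i₂ ≫ p') :
    (q ≫ q') ≫ i₃ ≅ i₁ ≫ (p ≫ p') :=
  α_ q q' i₃ ≪≫ whiskerLeftIso q S' ≪≫ (α_ q i₂ p').symm ≪≫ whiskerRightIso S p' ≪≫ α_ i₁ p p'

/-- 2-commutativity of a cube with bottom `K` (vertices `X, Y, Z, W`), top `K'`
(vertices `X', Y', Z', W'`), front `J`, back `J'`, right `I` and left `I'`: the two pastings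
`a q x ⇒ w p' b'` of the six faces agree. -/
def CubeComm {X Y Z W X' Y' Z' W' : B}
    {a : Z ⟶ W} {b : X ⟶ Y} {a' : Z' ⟶ W'} {b' : X' ⟶ Y'}
    {p : Y ⟶ W} {q : X ⟶ Z} {p' : Y' ⟶ W'} {q' : X' ⟶ Z'}
    {x : X' ⟶ X} {y : Y' ⟶ Y} {z : Z' ⟶ Z} {w : W' ⟶ W}
    (K : q ≫ a ≅ b ≫ p) (K' : q' ≫ a' ≅ b' ≫ p')
    (J : z ≫ a ≅ a' ≫ w) (J' : x ≫ b ≅ b' ≫ y)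
    (I : y ≫ p ≅ p' ≫ w) (I' : x ≫ q ≅ q' ≫ z) : Prop :=
  (α_ x q a).inv ≫ I'.hom ▷ a ≫ (α_ q' z a).hom ≫ q' ◁ J.hom ≫ (α_ q' a' w).inv ≫
      K'.hom ▷ w ≫ (α_ b' p' w).hom =
    x ◁ K.hom ≫ (α_ x b p).inv ≫ J'.hom ▷ p ≫ (α_ b' y p).hom ≫ b' ◁ I.hom

/-- Pasting two commutative cubes. -/
theorem CubeComm.hpaste {X Y Z W X' Y' Z' W' : B}
    {a : Z ⟶ W} {b : X ⟶ Y} {a' : Z' ⟶ W'} {b' : X' ⟶ Y'}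
    {p : Y ⟶ W} {q : X ⟶ Z} {p' : Y' ⟶ W'} {q' : X' ⟶ Z'}
    {x : X' ⟶ X} {y : Y' ⟶ Y} {z : Z' ⟶ Z} {w : W' ⟶ W}
    {K : q ≫ a ≅ b ≫ p} {K' : q' ≫ a' ≅ b' ≫ p'}
    {J : z ≫ a ≅ a' ≫ w} {J' : x ≫ b ≅ b' ≫ y}
    {I : y ≫ p ≅ p' ≫ w} {I' : x ≫ q ≅ q' ≫ z}
    {Y₂ W₂ Y₂' W₂' : B} {a₂ : W ⟶ W₂} {b₂ : Y ⟶ Y₂} {a₂' : W' ⟶ W₂'} {b₂' : Y' ⟶ Y₂'}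
    {p₂ : Y₂ ⟶ W₂} {p₂' : Y₂' ⟶ W₂'} {y₂ : Y₂' ⟶ Y₂} {w₂ : W₂' ⟶ W₂}
    {K₂ : p ≫ a₂ ≅ b₂ ≫ p₂} {K₂' : p' ≫ a₂' ≅ b₂' ≫ p₂'}
    {J₂ : w ≫ a₂ ≅ a₂' ≫ w₂} {J₂' : y ≫ b₂ ≅ b₂' ≫ y₂}
    {I₂ : y₂ ≫ p₂ ≅ p₂' ≫ w₂}
    (h : CubeComm K K' J J' I I') (h₂ : CubeComm K₂ K₂' J₂ J₂' I₂ I) :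
    CubeComm (hpaste K K₂) (hpaste K' K₂') (hpaste J J₂) (hpaste J' J₂') I₂ I' := by
  simp only [CubeComm, GluingData.hpaste, Iso.trans_hom, Iso.symm_hom, whiskerLeftIso_hom,
    whiskerRightIso_hom] at h h₂ ⊢
  calc
    _ = 𝟙 _ ⊗≫ I'.hom ▷ a ▷ a₂ ⊗≫ q' ◁ J.hom ▷ a₂ ⊗≫
          ((q' ≫ a') ◁ J₂.hom ≫ K'.hom ▷ (a₂' ≫ w₂)) ⊗≫ b' ◁ K₂'.hom ▷ w₂ ⊗≫ 𝟙 _ := by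
      bicategory
    _ = 𝟙 _ ⊗≫ (I'.hom ▷ a ⊗≫ q' ◁ J.hom ⊗≫ K'.hom ▷ w) ▷ a₂ ⊗≫
          b' ◁ (p' ◁ J₂.hom ⊗≫ K₂'.hom ▷ w₂) ⊗≫ 𝟙 _ := by
      rw [whisker_exchange]; bicategory
    _ = 𝟙 _ ⊗≫ ((α_ x q a).inv ≫ I'.hom ▷ a ≫ (α_ q' z a).hom ≫ q' ◁ J.hom ≫
          (α_ q' a' w).inv ≫ K'.hom ▷ w ≫ (α_ b' p' w).hom) ▷ a₂ ⊗≫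
          b' ◁ (p' ◁ J₂.hom ⊗≫ K₂'.hom ▷ w₂) ⊗≫ 𝟙 _ := by
      bicategory
    _ = 𝟙 _ ⊗≫ (x ◁ K.hom ≫ (α_ x b p).inv ≫ J'.hom ▷ p ≫ (α_ b' y p).hom) ▷ a₂ ⊗≫
          b' ◁ ((α_ y p a₂).inv ≫ I.hom ▷ a₂ ≫ (α_ p' w a₂).hom ≫ p' ◁ J₂.hom ≫
          (α_ p' a₂' w₂).inv ≫ K₂'.hom ▷ w₂ ≫ (α_ b₂' p₂' w₂).hom) ⊗≫ 𝟙 _ := by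
      rw [h]; bicategory
    _ = 𝟙 _ ⊗≫ x ◁ K.hom ▷ a₂ ⊗≫ (J'.hom ▷ (p ≫ a₂) ≫ (b' ≫ y) ◁ K₂.hom) ⊗≫
          b' ◁ (J₂'.hom ▷ p₂ ⊗≫ b₂' ◁ I₂.hom) ⊗≫ 𝟙 _ := by
      rw [h₂]; bicategory
    _ = _ := by
      rw [← whisker_exchange]; bicategory

theorem CubeComm.refl {X' X Y' Y : B} {p : X ⟶ Y} {p' : X' ⟶ Y'} {y : X' ⟶ X} {w : Y' ⟶ Y}
    (I : y ≫ p ≅ p' ≫ w) :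
    CubeComm (ρ_ p ≪≫ (λ_ p).symm) (ρ_ p' ≪≫ (λ_ p').symm) (ρ_ w ≪≫ (λ_ w).symm)
      (ρ_ y ≪≫ (λ_ y).symm) I I := by
  simp [CubeComm]

end Pasting

section Arrowy

/-- An arrowy 2-subcategory of `C`: it contains all objects of `C`, and all 2-cells of `C` between
its morphisms, so it is determined by its class of morphisms, which contains the identities and is
closed under composition. -/
structure ArrowySub (C : Type u₁) [Bicategory.{w₁, v₁} C] where
  mem : ∀ {X Y : C}, (X ⟶ Y) → Prop
  id_mem : ∀ X : C, mem (𝟙 X)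
  comp_mem : ∀ {X Y Z : C} {f : X ⟶ Y} {g : Y ⟶ Z}, mem f → mem g → mem (f ≫ g)

namespace ArrowySub

variable {C : Type u₁} [Bicategory.{w₁, v₁} C]

/-- The intersection of two arrowy 2-subcategories. -/
def inter (A A' : ArrowySub C) : ArrowySub C where
  mem f := A.mem f ∧ A'.mem f
  id_mem X := ⟨A.id_mem X, A'.id_mem X⟩
  comp_mem hf hg := ⟨A.comp_mem hf.1 hg.1, A'.comp_mem hf.2 hg.2⟩

/-- Morphisms of `A`. -/
structure Hom (A : ArrowySub C) (X Y : C) where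
  hom : X ⟶ Y
  mem : A.mem hom

variable {A A' : ArrowySub C}

/-- Identity morphisms of `A`. -/
def Hom.id (A : ArrowySub C) (X : C) : A.Hom X X := ⟨𝟙 X, A.id_mem X⟩

/-- Composition (in diagrammatic order) of morphisms of `A`. -/
def Hom.comp {X Y Z : C} (f : A.Hom X Y) (g : A.Hom Y Z) : A.Hom X Z :=
  ⟨f.hom ≫ g.hom, A.comp_mem f.mem g.mem⟩

/-- A morphism of an intersection as a morphism of the first member. -/
def Hom.fst {X Y : C} (f : (A.inter A').Hom X Y) : A.Hom X Y := ⟨f.hom, f.mem.1⟩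

/-- A morphism of an intersection as a morphism of the second member. -/
def Hom.snd {X Y : C} (f : (A.inter A').Hom X Y) : A'.Hom X Y := ⟨f.hom, f.mem.2⟩

/-- 2-cells of `A`, i.e. 2-cells of `C` between morphisms of `A`. -/
@[ext]
structure Hom₂ {X Y : C} (f g : A.Hom X Y) where
  cell : f.hom ⟶ g.hom

@[simps]
instance (X Y : C) : Category (A.Hom X Y) where
  Hom f g := Hom₂ f g
  id f := ⟨𝟙 f.hom⟩
  comp η θ := ⟨η.cell ≫ θ.cell⟩

/-- Invertible 2-cells of `A`. -/
@[simps]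
def isoMk {X Y : C} {f g : A.Hom X Y} (e : f.hom ≅ g.hom) : f ≅ g where
  hom := ⟨e.hom⟩
  inv := ⟨e.inv⟩
  hom_inv_id := Hom₂.ext e.hom_inv_id
  inv_hom_id := Hom₂.ext e.inv_hom_id

/-- The objects of `A` regarded as a bicategory on its own. -/
structure Cat (A : ArrowySub C) where
  of : C

@[simps]
instance : CategoryStruct A.Cat where
  Hom X Y := A.Hom X.of Y.of
  id X := Hom.id A X.of
  comp f g := f.comp g

instance : Bicategory A.Cat where
  homCategory X Y := inferInstanceAs (Category (A.Hom X.of Y.of))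
  whiskerLeft f _ _ η := ⟨f.hom ◁ η.cell⟩
  whiskerRight η h := ⟨η.cell ▷ h.hom⟩
  associator f g h := isoMk (α_ f.hom g.hom h.hom)
  leftUnitor f := isoMk (λ_ f.hom)
  rightUnitor f := isoMk (ρ_ f.hom)
  whiskerLeft_id _ _ := Hom₂.ext (whiskerLeft_id _ _)
  whiskerLeft_comp _ _ _ _ _ _ := Hom₂.ext (whiskerLeft_comp _ _ _)
  id_whiskerLeft _ := Hom₂.ext (id_whiskerLeft _)
  comp_whiskerLeft _ _ _ _ _ := Hom₂.ext (comp_whiskerLeft _ _ _)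
  id_whiskerRight _ _ := Hom₂.ext (id_whiskerRight _ _)
  comp_whiskerRight _ _ _ := Hom₂.ext (comp_whiskerRight _ _ _)
  whiskerRight_id _ := Hom₂.ext (whiskerRight_id _)
  whiskerRight_comp _ _ _ := Hom₂.ext (whiskerRight_comp _ _ _)
  whisker_assoc _ _ _ _ _ := Hom₂.ext (whisker_assoc _ _ _)
  whisker_exchange _ _ := Hom₂.ext (whisker_exchange _ _)
  pentagon _ _ _ _ := Hom₂.ext (pentagon _ _ _ _)
  triangle _ _ := Hom₂.ext (triangle _ _)

end ArrowySub

end Arrowy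

section Ps

variable {C : Type u₁} [Bicategory.{w₁, v₁} C] {D : Type u₂} [Bicategory.{w₂, v₂} D]

/-- A pseudofunctor `A → D` with the given map `F₀` on objects. -/
structure PsOn (A : ArrowySub C) (F₀ : C → D) where
  map {X Y : C} (f : A.Hom X Y) : F₀ X ⟶ F₀ Y
  map₂ {X Y : C} {f g : A.Hom X Y} (η : f.hom ⟶ g.hom) : map f ⟶ map g
  mapId (X : C) : map (.id A X) ≅ 𝟙 (F₀ X)
  mapComp {X Y Z : C} (f : A.Hom X Y) (g : A.Hom Y Z) : map (f.comp g) ≅ map f ≫ map g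
  map₂_id {X Y : C} (f : A.Hom X Y) : map₂ (f := f) (𝟙 f.hom) = 𝟙 (map f)
  map₂_comp {X Y : C} {f g h : A.Hom X Y} (η : f.hom ⟶ g.hom) (θ : g.hom ⟶ h.hom) :
    map₂ (f := f) (g := h) (η ≫ θ) = map₂ (g := g) η ≫ map₂ θ
  map₂_whiskerLeft {X Y Z : C} (f : A.Hom X Y) {g h : A.Hom Y Z} (η : g.hom ⟶ h.hom) :
    map₂ (f := f.comp g) (g := f.comp h) (f.hom ◁ η) =
      (mapComp f g).hom ≫ map f ◁ map₂ η ≫ (mapComp f h).inv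
  map₂_whiskerRight {X Y Z : C} {f g : A.Hom X Y} (η : f.hom ⟶ g.hom) (h : A.Hom Y Z) :
    map₂ (f := f.comp h) (g := g.comp h) (η ▷ h.hom) =
      (mapComp f h).hom ≫ map₂ η ▷ map h ≫ (mapComp g h).inv
  map₂_associator {X Y Z W : C} (f : A.Hom X Y) (g : A.Hom Y Z) (h : A.Hom Z W) :
    map₂ (f := (f.comp g).comp h) (g := f.comp (g.comp h)) (α_ f.hom g.hom h.hom).hom =
      (mapComp (f.comp g) h).hom ≫ (mapComp f g).hom ▷ map h ≫
        (α_ (map f) (map g) (map h)).hom ≫ map f ◁ (mapComp g h).inv ≫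
          (mapComp f (g.comp h)).inv
  map₂_leftUnitor {X Y : C} (f : A.Hom X Y) :
    map₂ (f := (ArrowySub.Hom.id A X).comp f) (g := f) (λ_ f.hom).hom =
      (mapComp (.id A X) f).hom ≫ (mapId X).hom ▷ map f ≫ (λ_ (map f)).hom
  map₂_rightUnitor {X Y : C} (f : A.Hom X Y) :
    map₂ (f := f.comp (.id A Y)) (g := f) (ρ_ f.hom).hom =
      (mapComp f (.id A Y)).hom ≫ map f ◁ (mapId Y).hom ≫ (ρ_ (map f)).hom

variable {A : ArrowySub C} {F₀ G₀ H₀ : C → D}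

/-- The corresponding pseudofunctor in the sense of Mathlib. -/
def PsOn.toPseudofunctor (F : PsOn A F₀) : Pseudofunctor A.Cat D where
  obj X := F₀ X.of
  map f := F.map f
  map₂ η := F.map₂ η.cell
  mapId X := F.mapId X.of
  mapComp f g := F.mapComp f g
  map₂_id f := F.map₂_id f
  map₂_comp η θ := F.map₂_comp η.cell θ.cell
  map₂_whisker_left f _ _ η := F.map₂_whiskerLeft f η.cell
  map₂_whisker_right η h := F.map₂_whiskerRight η.cell h
  map₂_associator f g h := F.map₂_associator f g h
  map₂_left_unitor f := F.map₂_leftUnitor f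
  map₂_right_unitor f := F.map₂_rightUnitor f

/-- A pseudonatural transformation `F → G` of pseudofunctors on `A`, with the given components
`α₀` on objects. -/
@[ext]
structure StrongOn (F : PsOn A F₀) (G : PsOn A G₀) (α₀ : ∀ X, F₀ X ⟶ G₀ X) where
  nat {X Y : C} (f : A.Hom X Y) : F.map f ≫ α₀ Y ≅ α₀ X ≫ G.map f
  nat_map₂ {X Y : C} {f g : A.Hom X Y} (η : f.hom ⟶ g.hom) :
    F.map₂ η ▷ α₀ Y ≫ (nat g).hom = (nat f).hom ≫ α₀ X ◁ G.map₂ η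
  nat_id (X : C) :
    (nat (.id A X)).hom ≫ α₀ X ◁ (G.mapId X).hom =
      (F.mapId X).hom ▷ α₀ X ≫ (λ_ (α₀ X)).hom ≫ (ρ_ (α₀ X)).inv
  nat_comp {X Y Z : C} (f : A.Hom X Y) (g : A.Hom Y Z) :
    (nat (f.comp g)).hom ≫ α₀ X ◁ (G.mapComp f g).hom =
      (F.mapComp f g).hom ▷ α₀ Z ≫ (vpaste (nat f) (nat g)).hom

/-- The corresponding strong transformation in the sense of Mathlib. -/
def StrongOn.toStrongTrans {F : PsOn A F₀} {G : PsOn A G₀} {α₀ : ∀ X, F₀ X ⟶ G₀ X}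
    (α : StrongOn F G α₀) : Pseudofunctor.StrongTrans F.toPseudofunctor G.toPseudofunctor where
  app X := α₀ X.of
  naturality f := α.nat f
  naturality_naturality η := α.nat_map₂ η.cell
  naturality_id X := α.nat_id X.of
  naturality_comp f g := by
    simpa [vpaste] using! α.nat_comp f g

/-- The identity transformation. -/
def StrongOn.id (F : PsOn A F₀) : StrongOn F F (fun X => 𝟙 (F₀ X)) where
  nat f := ρ_ (F.map f) ≪≫ (λ_ (F.map f)).symm
  nat_map₂ η := by simp
  nat_id X := by simp
  nat_comp f g := by simp [vpaste]

/-- Composition of transformations. -/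
def StrongOn.comp {F : PsOn A F₀} {G : PsOn A G₀} {H : PsOn A H₀}
    {α₀ : ∀ X, F₀ X ⟶ G₀ X} {β₀ : ∀ X, G₀ X ⟶ H₀ X}
    (α : StrongOn F G α₀) (β : StrongOn G H β₀) : StrongOn F H (fun X => α₀ X ≫ β₀ X) where
  nat f := hpaste (α.nat f) (β.nat f)
  nat_map₂ {X Y f g} η :=
    (α.toStrongTrans.vcomp β.toStrongTrans).naturality_naturality
      (a := .mk X) (b := .mk Y) (f := f) (g := g) ⟨η⟩
  nat_id X := (α.toStrongTrans.vcomp β.toStrongTrans).naturality_id (.mk X)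
  nat_comp {X Y Z} f g := by
    refine ((α.toStrongTrans.vcomp β.toStrongTrans).naturality_comp
      (a := .mk X) (b := .mk Y) (c := .mk Z) f g).trans ?_
    simp only [vpaste, Iso.trans_hom, whiskerLeftIso_hom, whiskerRightIso_hom, Iso.symm_hom]
    rfl

end Ps

section Families

variable {C : Type u₁} [Bicategory.{w₁, v₁} C] {D : Type u₂} [Bicategory.{w₂, v₂} D]

/-- The objects of `D^{Ob C}`: maps from the objects of `C` to the objects of `D`. -/
structure Pow (C : Type u₁) (D : Type u₂) where
  obj : C → D

namespace Pow

/-- A morphism of `D^{Ob C}` is a family of morphisms of `D`. -/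
structure Hom (F G : Pow C D) where
  app (x : C) : F.obj x ⟶ G.obj x

/-- A 2-cell of `D^{Ob C}` is a family of 2-cells of `D`. -/
@[ext]
structure Hom₂ {F G : Pow C D} (α β : Hom F G) where
  app (x : C) : α.app x ⟶ β.app x

instance : CategoryStruct (Pow C D) where
  Hom := Hom
  id F := ⟨fun x => 𝟙 (F.obj x)⟩
  comp α β := ⟨fun x => α.app x ≫ β.app x⟩

instance homCategory (F G : Pow C D) : Category (F ⟶ G) where
  Hom := Hom₂
  id α := ⟨fun x => 𝟙 (α.app x)⟩
  comp Γ Θ := ⟨fun x => Γ.app x ≫ Θ.app x⟩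
  id_comp _ := Hom₂.ext (funext fun _ => Category.id_comp _)
  comp_id _ := Hom₂.ext (funext fun _ => Category.comp_id _)
  assoc _ _ _ := Hom₂.ext (funext fun _ => Category.assoc _ _ _)

/-- Invertible 2-cells of `D^{Ob C}`. -/
def isoMk {F G : Pow C D} {α β : F ⟶ G} (e : ∀ x, α.app x ≅ β.app x) : α ≅ β where
  hom := Hom₂.mk fun x => (e x).hom
  inv := Hom₂.mk fun x => (e x).inv
  hom_inv_id := Hom₂.ext (funext fun x => (e x).hom_inv_id)
  inv_hom_id := Hom₂.ext (funext fun x => (e x).inv_hom_id)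

instance : Bicategory (Pow C D) where
  homCategory := homCategory
  whiskerLeft α _ _ Γ := Hom₂.mk fun x => α.app x ◁ Γ.app x
  whiskerRight Γ β := Hom₂.mk fun x => Γ.app x ▷ β.app x
  associator α β γ := isoMk fun x => α_ (α.app x) (β.app x) (γ.app x)
  leftUnitor α := isoMk fun x => λ_ (α.app x)
  rightUnitor α := isoMk fun x => ρ_ (α.app x)
  whiskerLeft_id _ _ := Hom₂.ext (funext fun _ => whiskerLeft_id _ _)
  whiskerLeft_comp _ _ _ _ _ _ := Hom₂.ext (funext fun _ => whiskerLeft_comp _ _ _)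
  id_whiskerLeft _ := Hom₂.ext (funext fun _ => id_whiskerLeft _)
  comp_whiskerLeft _ _ _ _ _ := Hom₂.ext (funext fun _ => comp_whiskerLeft _ _ _)
  id_whiskerRight _ _ := Hom₂.ext (funext fun _ => id_whiskerRight _ _)
  comp_whiskerRight _ _ _ := Hom₂.ext (funext fun _ => comp_whiskerRight _ _ _)
  whiskerRight_id _ := Hom₂.ext (funext fun _ => whiskerRight_id _)
  whiskerRight_comp _ _ _ := Hom₂.ext (funext fun _ => whiskerRight_comp _ _ _)
  whisker_assoc _ _ _ _ _ := Hom₂.ext (funext fun _ => whisker_assoc _ _ _)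
  whisker_exchange _ _ := Hom₂.ext (funext fun _ => whisker_exchange _ _)
  pentagon _ _ _ _ := Hom₂.ext (funext fun _ => pentagon _ _ _ _)
  triangle _ _ := Hom₂.ext (funext fun _ => triangle _ _)

theorem eq_of_iso {F G : Pow C D} {α β : F ⟶ G} (h : ∀ x, α.app x = β.app x) (e : α ≅ β)
    (he : ∀ x, e.hom.app x = eqToHom (h x)) : ∃ h' : α = β, e = eqToIso h' := by
  obtain ⟨a⟩ := α
  obtain ⟨b⟩ := β
  obtain rfl : a = b := funext h
  exact ⟨rfl, Iso.ext (Hom₂.ext (funext he))⟩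

instance [Strict D] : Strict (Pow C D) := by
  have h₁ {X Y : Pow C D} (f : X ⟶ Y) := eq_of_iso (fun x => Strict.id_comp (f.app x)) (λ_ f)
    fun x => congrArg Iso.hom (Strict.leftUnitor_eqToIso (f.app x))
  have h₂ {X Y : Pow C D} (f : X ⟶ Y) := eq_of_iso (fun x => Strict.comp_id (f.app x)) (ρ_ f)
    fun x => congrArg Iso.hom (Strict.rightUnitor_eqToIso (f.app x))
  have h₃ {X Y Z W : Pow C D} (f : X ⟶ Y) (g : Y ⟶ Z) (h : Z ⟶ W) :=
    eq_of_iso (fun x => Strict.assoc (f.app x) (g.app x) (h.app x)) (α_ f g h)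
      fun x => congrArg Iso.hom (Strict.associator_eqToIso (f.app x) (g.app x) (h.app x))
  exact
    { id_comp := fun f => (h₁ f).1
      comp_id := fun f => (h₂ f).1
      assoc := fun f g h => (h₃ f g h).1
      leftUnitor_eqToIso := fun f => (h₁ f).2
      rightUnitor_eqToIso := fun f => (h₂ f).2
      associator_eqToIso := fun f g h => (h₃ f g h).2 }

end Pow

variable {n : ℕ}

/-- A family of pseudofunctors `F i : A i → D`, all with the same map on objects. -/
structure Fam (A : Fin n → ArrowySub C) (D : Type u₂) [Bicategory.{w₂, v₂} D] where
  obj : C → D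
  F (i : Fin n) : PsOn (A i) obj

namespace Fam

variable {A : Fin n → ArrowySub C}

/-- A family of pseudonatural transformations, all with the same components. -/
structure Hom (X Y : Fam A D) where
  app (x : C) : X.obj x ⟶ Y.obj x
  tr (i : Fin n) : StrongOn (X.F i) (Y.F i) app

/-- A family of modifications, all with the same components. -/
@[ext]
structure Hom₂ {X Y : Fam A D} (α β : Hom X Y) where
  app (x : C) : α.app x ⟶ β.app x
  naturality (i : Fin n) {x y : C} (f : (A i).Hom x y) :
    (X.F i).map f ◁ app y ≫ ((β.tr i).nat f).hom = ((α.tr i).nat f).hom ≫ app x ▷ (Y.F i).map f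

instance : CategoryStruct (Fam A D) where
  Hom := Hom
  id X := ⟨fun x => 𝟙 (X.obj x), fun i => .id (X.F i)⟩
  comp α β := ⟨fun x => α.app x ≫ β.app x, fun i => (α.tr i).comp (β.tr i)⟩

instance homCategory (X Y : Fam A D) : Category (X ⟶ Y) where
  Hom := Hom₂
  id α := ⟨fun x => 𝟙 (α.app x), fun i _ _ f => by simp⟩
  comp Γ Θ := ⟨fun x => Γ.app x ≫ Θ.app x, fun i _ _ f => by
    rw [whiskerLeft_comp, Category.assoc, Θ.naturality, ← Category.assoc, Γ.naturality,
      Category.assoc, comp_whiskerRight]⟩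
  id_comp _ := Hom₂.ext (funext fun _ => Category.id_comp _)
  comp_id _ := Hom₂.ext (funext fun _ => Category.comp_id _)
  assoc _ _ _ := Hom₂.ext (funext fun _ => Category.assoc _ _ _)

/-- Invertible 2-cells of families. -/
def isoMk {X Y : Fam A D} {α β : X ⟶ Y} (e : ∀ x, α.app x ≅ β.app x)
    (h : ∀ (i : Fin n) {x y : C} (f : (A i).Hom x y),
      (X.F i).map f ◁ (e y).hom ≫ ((β.tr i).nat f).hom =
        ((α.tr i).nat f).hom ≫ (e x).hom ▷ (Y.F i).map f) : α ≅ β where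
  hom := Hom₂.mk (fun x => (e x).hom) h
  inv := Hom₂.mk (fun x => (e x).inv) fun i x y f => by
    rw [← cancel_epi (_ ◁ (e y).hom), ← cancel_mono ((e x).hom ▷ _)]
    simpa using (h i f).symm
  hom_inv_id := Hom₂.ext (funext fun x => (e x).hom_inv_id)
  inv_hom_id := Hom₂.ext (funext fun x => (e x).inv_hom_id)

instance : Bicategory (Fam A D) where
  homCategory := homCategory
  whiskerLeft {X Y Z} α β γ Γ := Hom₂.mk (fun x => α.app x ◁ Γ.app x) fun i x y f => by
    change _ ◁ _ ◁ _ ≫ (hpaste ((α.tr i).nat f) ((γ.tr i).nat f)).hom =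
      (hpaste ((α.tr i).nat f) ((β.tr i).nat f)).hom ≫ _
    simp only [hpaste, Iso.trans_hom, Iso.symm_hom, whiskerLeftIso_hom, whiskerRightIso_hom]
    calc
      _ = 𝟙 _ ⊗≫ (((X.F i).map f ≫ α.app y) ◁ Γ.app y ≫
            ((α.tr i).nat f).hom ▷ γ.app y) ⊗≫
              α.app x ◁ ((γ.tr i).nat f).hom ⊗≫ 𝟙 _ := by bicategory
      _ = 𝟙 _ ⊗≫ ((α.tr i).nat f).hom ▷ β.app y ⊗≫
            α.app x ◁ ((Y.F i).map f ◁ Γ.app y ≫ ((γ.tr i).nat f).hom) ⊗≫ 𝟙 _ := by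
        rw [whisker_exchange]; bicategory
      _ = _ := by rw [Γ.naturality]; bicategory
  whiskerRight {X Y Z} α β Γ γ := Hom₂.mk (fun x => Γ.app x ▷ γ.app x) fun i x y f => by
    change _ ◁ (_ ▷ _) ≫ (hpaste ((β.tr i).nat f) ((γ.tr i).nat f)).hom =
      (hpaste ((α.tr i).nat f) ((γ.tr i).nat f)).hom ≫ _
    simp only [hpaste, Iso.trans_hom, Iso.symm_hom, whiskerLeftIso_hom, whiskerRightIso_hom]
    calc
      _ = 𝟙 _ ⊗≫ ((X.F i).map f ◁ Γ.app y ≫ ((β.tr i).nat f).hom) ▷ γ.app y ⊗≫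
            β.app x ◁ ((γ.tr i).nat f).hom ⊗≫ 𝟙 _ := by bicategory
      _ = 𝟙 _ ⊗≫ ((α.tr i).nat f).hom ▷ γ.app y ⊗≫ (Γ.app x ▷ ((Y.F i).map f ≫ γ.app y) ≫
            β.app x ◁ ((γ.tr i).nat f).hom) ⊗≫ 𝟙 _ := by
        rw [Γ.naturality]; bicategory
      _ = _ := by rw [← whisker_exchange]; bicategory
  associator α β γ := isoMk (fun x => α_ (α.app x) (β.app x) (γ.app x)) fun i x y f => by
    change _ ≫ (hpaste ((α.tr i).nat f) (hpaste ((β.tr i).nat f) ((γ.tr i).nat f))).hom =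
      (hpaste (hpaste ((α.tr i).nat f) ((β.tr i).nat f)) ((γ.tr i).nat f)).hom ≫ _
    simp only [hpaste, Iso.trans_hom, Iso.symm_hom, whiskerLeftIso_hom, whiskerRightIso_hom]
    bicategory
  leftUnitor {X Y} α := isoMk (fun x => λ_ (α.app x)) fun i x y f => by
    change _ ≫ ((α.tr i).nat f).hom =
      (hpaste (ρ_ ((X.F i).map f) ≪≫ (λ_ ((X.F i).map f)).symm) ((α.tr i).nat f)).hom ≫ _
    simp only [hpaste, Iso.trans_hom, Iso.symm_hom, whiskerLeftIso_hom, whiskerRightIso_hom]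
    bicategory
  rightUnitor {X Y} α := isoMk (fun x => ρ_ (α.app x)) fun i x y f => by
    change _ ≫ ((α.tr i).nat f).hom =
      (hpaste ((α.tr i).nat f) (ρ_ ((Y.F i).map f) ≪≫ (λ_ ((Y.F i).map f)).symm)).hom ≫ _
    simp only [hpaste, Iso.trans_hom, Iso.symm_hom, whiskerLeftIso_hom, whiskerRightIso_hom]
    bicategory
  whiskerLeft_id _ _ := Hom₂.ext (funext fun _ => whiskerLeft_id _ _)
  whiskerLeft_comp _ _ _ _ _ _ := Hom₂.ext (funext fun _ => whiskerLeft_comp _ _ _)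
  id_whiskerLeft _ := Hom₂.ext (funext fun _ => id_whiskerLeft _)
  comp_whiskerLeft _ _ _ _ _ := Hom₂.ext (funext fun _ => comp_whiskerLeft _ _ _)
  id_whiskerRight _ _ := Hom₂.ext (funext fun _ => id_whiskerRight _ _)
  comp_whiskerRight _ _ _ := Hom₂.ext (funext fun _ => comp_whiskerRight _ _ _)
  whiskerRight_id _ := Hom₂.ext (funext fun _ => whiskerRight_id _)
  whiskerRight_comp _ _ _ := Hom₂.ext (funext fun _ => whiskerRight_comp _ _ _)
  whisker_assoc _ _ _ _ _ := Hom₂.ext (funext fun _ => whisker_assoc _ _ _)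
  whisker_exchange _ _ := Hom₂.ext (funext fun _ => whisker_exchange _ _)
  pentagon _ _ _ _ := Hom₂.ext (funext fun _ => pentagon _ _ _ _)
  triangle _ _ := Hom₂.ext (funext fun _ => triangle _ _)

theorem eq_of_iso {X Y : Fam A D} {α β : X ⟶ Y} (h : ∀ x, α.app x = β.app x) (e : α ≅ β)
    (he : ∀ x, e.hom.app x = eqToHom (h x)) : ∃ h' : α = β, e = eqToIso h' := by
  obtain ⟨a, t⟩ := α
  obtain ⟨b, u⟩ := β
  obtain rfl : a = b := funext h
  have ht : t = u := funext fun i => StrongOn.ext (funext fun x => funext fun y => funext fun f =>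
    Iso.ext (by
      have := e.hom.naturality i f
      rw [he, he] at this
      simpa using this.symm))
  subst ht
  exact ⟨rfl, Iso.ext (Hom₂.ext (funext he))⟩

instance [Strict D] : Strict (Fam A D) := by
  have h₁ {X Y : Fam A D} (f : X ⟶ Y) := eq_of_iso (fun x => Strict.id_comp (f.app x)) (λ_ f)
    fun x => congrArg Iso.hom (Strict.leftUnitor_eqToIso (f.app x))
  have h₂ {X Y : Fam A D} (f : X ⟶ Y) := eq_of_iso (fun x => Strict.comp_id (f.app x)) (ρ_ f)
    fun x => congrArg Iso.hom (Strict.rightUnitor_eqToIso (f.app x))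
  have h₃ {X Y Z W : Fam A D} (f : X ⟶ Y) (g : Y ⟶ Z) (h : Z ⟶ W) :=
    eq_of_iso (fun x => Strict.assoc (f.app x) (g.app x) (h.app x)) (α_ f g h)
      fun x => congrArg Iso.hom (Strict.associator_eqToIso (f.app x) (g.app x) (h.app x))
  exact
    { id_comp := fun f => (h₁ f).1
      comp_id := fun f => (h₂ f).1
      assoc := fun f g h => (h₃ f g h).1
      leftUnitor_eqToIso := fun f => (h₁ f).2
      rightUnitor_eqToIso := fun f => (h₂ f).2
      associator_eqToIso := fun f g h => (h₃ f g h).2 }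

/-- The 2-functor remembering only the maps on objects and the components. -/
def forget : StrictPseudofunctor (Fam A D) (Pow C D) :=
  StrictPseudofunctor.mk'
    { obj := fun X => ⟨X.obj⟩
      map := fun α => ⟨α.app⟩
      map₂ := fun Γ => ⟨Γ.app⟩
      map₂_id := fun _ => rfl
      map₂_comp := fun _ _ => rfl
      map_id := fun _ => rfl
      map_comp := fun _ _ => rfl
      map₂_whisker_left := fun _ _ _ _ => by simp; rfl
      map₂_whisker_right := fun _ _ => by simp; rfl
      map₂_left_unitor := fun _ => by simp; rfl
      map₂_right_unitor := fun _ => by simp; rfl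
      map₂_associator := fun _ _ _ => by simp; rfl }

end Fam

end Families

section Sub

variable {B : Type u₁} [Bicategory.{w₁, v₁} B] {O : Type u₃} {U : O → B}

/-- A class of 1-cells of `B` between the objects `U X`, containing the identities and closed under
composition. It defines a bicategory with objects `O`, with these 1-cells and with all 2-cells of
`B` between them. -/
structure Sub (U : O → B) where
  mem : ∀ {X Y : O}, (U X ⟶ U Y) → Prop
  id_mem : ∀ X, mem (𝟙 (U X))
  comp_mem : ∀ {X Y Z : O} {f : U X ⟶ U Y} {g : U Y ⟶ U Z}, mem f → mem g → mem (f ≫ g)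

namespace Sub

/-- Morphisms of the bicategory defined by `S`. -/
structure Hom (S : Sub U) (X Y : O) where
  hom : U X ⟶ U Y
  mem : S.mem hom

/-- 2-cells of the bicategory defined by `S`. -/
@[ext]
structure Hom₂ {S : Sub U} {X Y : O} (f g : S.Hom X Y) where
  cell : f.hom ⟶ g.hom

instance homCategory (S : Sub U) (X Y : O) : Category (S.Hom X Y) where
  Hom f g := Hom₂ f g
  id f := ⟨𝟙 f.hom⟩
  comp η θ := ⟨η.cell ≫ θ.cell⟩
  id_comp _ := Hom₂.ext (Category.id_comp _)
  comp_id _ := Hom₂.ext (Category.comp_id _)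
  assoc _ _ _ := Hom₂.ext (Category.assoc _ _ _)

/-- Invertible 2-cells. -/
def isoMk {S : Sub U} {X Y : O} {f g : S.Hom X Y} (e : f.hom ≅ g.hom) : f ≅ g where
  hom := Hom₂.mk e.hom
  inv := Hom₂.mk e.inv
  hom_inv_id := Hom₂.ext e.hom_inv_id
  inv_hom_id := Hom₂.ext e.inv_hom_id

/-- The bicategory defined by `S`. -/
@[reducible]
def bicategory (S : Sub U) : Bicategory O where
  Hom X Y := S.Hom X Y
  id X := ⟨𝟙 (U X), S.id_mem X⟩
  comp f g := ⟨f.hom ≫ g.hom, S.comp_mem f.mem g.mem⟩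
  homCategory := S.homCategory
  whiskerLeft f _ _ η := Hom₂.mk (f.hom ◁ η.cell)
  whiskerRight η h := Hom₂.mk (η.cell ▷ h.hom)
  associator f g h := isoMk (α_ f.hom g.hom h.hom)
  leftUnitor f := isoMk (λ_ f.hom)
  rightUnitor f := isoMk (ρ_ f.hom)
  whiskerLeft_id _ _ := Hom₂.ext (whiskerLeft_id _ _)
  whiskerLeft_comp _ _ _ _ _ _ := Hom₂.ext (whiskerLeft_comp _ _ _)
  id_whiskerLeft _ := Hom₂.ext (id_whiskerLeft _)
  comp_whiskerLeft _ _ _ _ _ := Hom₂.ext (comp_whiskerLeft _ _ _)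
  id_whiskerRight _ _ := Hom₂.ext (id_whiskerRight _ _)
  comp_whiskerRight _ _ _ := Hom₂.ext (comp_whiskerRight _ _ _)
  whiskerRight_id _ := Hom₂.ext (whiskerRight_id _)
  whiskerRight_comp _ _ _ := Hom₂.ext (whiskerRight_comp _ _ _)
  whisker_assoc _ _ _ _ _ := Hom₂.ext (whisker_assoc _ _ _)
  whisker_exchange _ _ := Hom₂.ext (whisker_exchange _ _)
  pentagon _ _ _ _ := Hom₂.ext (pentagon _ _ _ _)
  triangle _ _ := Hom₂.ext (triangle _ _)

theorem eq_of_iso {S : Sub U} {X Y : O} {f g : S.Hom X Y} (h : f.hom = g.hom) (e : f ≅ g)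
    (he : e.hom.cell = eqToHom h) : ∃ h' : f = g, e = eqToIso h' := by
  obtain ⟨f, hf⟩ := f
  obtain ⟨g, hg⟩ := g
  obtain rfl : f = g := h
  exact ⟨rfl, Iso.ext (Hom₂.ext he)⟩

theorem strict [Strict B] (S : Sub U) : let _ := S.bicategory; Strict O := by
  letI := S.bicategory
  have h₁ {X Y : O} (f : X ⟶ Y) := eq_of_iso (S := S) (Strict.id_comp f.hom) (λ_ f)
    (congrArg Iso.hom (Strict.leftUnitor_eqToIso f.hom))
  have h₂ {X Y : O} (f : X ⟶ Y) := eq_of_iso (S := S) (Strict.comp_id f.hom) (ρ_ f)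
    (congrArg Iso.hom (Strict.rightUnitor_eqToIso f.hom))
  have h₃ {X Y Z W : O} (f : X ⟶ Y) (g : Y ⟶ Z) (h : Z ⟶ W) :=
    eq_of_iso (S := S) (Strict.assoc f.hom g.hom h.hom) (α_ f g h)
      (congrArg Iso.hom (Strict.associator_eqToIso f.hom g.hom h.hom))
  exact
    { id_comp := fun f => (h₁ f).1
      comp_id := fun f => (h₂ f).1
      assoc := fun f g h => (h₃ f g h).1
      leftUnitor_eqToIso := fun f => (h₁ f).2
      rightUnitor_eqToIso := fun f => (h₂ f).2
      associator_eqToIso := fun f g h => (h₃ f g h).2 }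

/-- The inclusion into `B`. -/
def forget (S : Sub U) : letI := S.bicategory; StrictPseudofunctor O B :=
  letI := S.bicategory
  StrictPseudofunctor.mk'
    { obj := U
      map := fun f => f.hom
      map₂ := fun η => η.cell
      map₂_id := fun _ => rfl
      map₂_comp := fun _ _ => rfl
      map_id := fun _ => rfl
      map_comp := fun _ _ => rfl
      map₂_whisker_left := fun _ _ _ _ => by simp; rfl
      map₂_whisker_right := fun _ _ => by simp; rfl
      map₂_left_unitor := fun _ => by simp; rfl
      map₂_right_unitor := fun _ => by simp; rfl
      map₂_associator := fun _ _ _ => by simp; rfl }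

/-- For a map `Φ : O' → O` carrying the morphisms in `S'` to morphisms in `S`, the 2-functor which
is `Φ` on objects and does not change the underlying morphisms and 2-cells in `B`. -/
def lift {O' : Type u₄} (S : Sub U) (Φ : O' → O) (S' : Sub fun X => U (Φ X))
    (h : ∀ (X Y : O') (f : U (Φ X) ⟶ U (Φ Y)), S'.mem f → S.mem (X := Φ X) (Y := Φ Y) f) :
    letI := S.bicategory
    letI := S'.bicategory
    StrictPseudofunctor O' O :=
  letI := S.bicategory
  letI := S'.bicategory
  StrictPseudofunctor.mk'
    { obj := Φ
      map := fun f => ⟨f.hom, h _ _ _ f.mem⟩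
      map₂ := fun η => ⟨η.cell⟩
      map₂_id := fun _ => rfl
      map₂_comp := fun _ _ => rfl
      map_id := fun _ => rfl
      map_comp := fun _ _ => rfl
      map₂_whisker_left := fun _ _ _ _ => by simp; rfl
      map₂_whisker_right := fun _ _ => by simp; rfl
      map₂_left_unitor := fun _ => by simp; rfl
      map₂_right_unitor := fun _ => by simp; rfl
      map₂_associator := fun _ _ _ => by simp; rfl }

end Sub

end Sub

section Squares

variable {C : Type u₁} [Bicategory.{w₁, v₁} C]

/-- An `(A, B)`-square: horizontal morphisms `b`, `a` (top, bottom) in `A`, vertical morphisms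
`q`, `p` (left, right) in `B`, and a 2-cell filling the square. All 2-cells of a
(2,1)-category are invertible, so the 2-cell is recorded as an isomorphism. -/
structure Square {A B : ArrowySub C} {X Y Z W : C} (b : A.Hom X Y) (q : B.Hom X Z)
    (a : A.Hom Z W) (p : B.Hom Y W) where
  cell : q.hom ≫ a.hom ≅ b.hom ≫ p.hom

namespace Square

variable {A B E : ArrowySub C}

/-- Horizontal composition of squares. -/
def hcomp {X₁ X₂ X₃ Y₁ Y₂ Y₃ : C} {j : A.Hom X₁ X₂} {j' : A.Hom X₂ X₃} {i : A.Hom Y₁ Y₂}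
    {i' : A.Hom Y₂ Y₃} {p₁ : B.Hom X₁ Y₁} {p₂ : B.Hom X₂ Y₂} {p₃ : B.Hom X₃ Y₃}
    (S : Square j p₁ i p₂) (S' : Square j' p₂ i' p₃) : Square (j.comp j') p₁ (i.comp i') p₃ :=
  ⟨hpaste S.cell S'.cell⟩

/-- Vertical composition of squares. -/
def vcomp {X₁ X₂ X₃ Y₁ Y₂ Y₃ : C} {i₁ : A.Hom X₁ Y₁} {i₂ : A.Hom X₂ Y₂} {i₃ : A.Hom X₃ Y₃}
    {q : B.Hom X₁ X₂} {q' : B.Hom X₂ X₃} {p : B.Hom Y₁ Y₂} {p' : B.Hom Y₂ Y₃}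
    (S : Square i₁ q i₂ p) (S' : Square i₂ q' i₃ p') : Square i₁ (q.comp q') i₃ (p.comp p') :=
  ⟨vpaste S.cell S'.cell⟩

/-- The transposed `(B, A)`-square, filled by the inverse 2-cell. -/
def transpose {X Y Z W : C} {b : A.Hom X Y} {q : B.Hom X Z} {a : A.Hom Z W} {p : B.Hom Y W}
    (S : Square b q a p) : Square q b p a :=
  ⟨S.cell.symm⟩

/-- The square given by a 2-cell `σ : a ⇒ b` of `A`, with identities as vertical morphisms. -/
def vId (B : ArrowySub C) {X Y : C} {a b : A.Hom X Y} (σ : a.hom ≅ b.hom) :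
    Square b (.id B X) a (.id B Y) :=
  ⟨λ_ a.hom ≪≫ σ ≪≫ (ρ_ b.hom).symm⟩

/-- The square given by a 2-cell `σ : q ⇒ p` of `B`, with identities as horizontal morphisms. -/
def hId (A : ArrowySub C) {X Y : C} {q p : B.Hom X Y} (σ : q.hom ≅ p.hom) :
    Square (.id A X) q (.id A Y) p :=
  ⟨ρ_ q.hom ≪≫ σ ≪≫ (λ_ p.hom).symm⟩

/-- For `f` in `A ∩ B`, the square with top and left morphisms `f`, with identities as bottom and
right morphisms, and filled by the identity 2-cell. -/
def corner {X Y : C} (f : (A.inter B).Hom X Y) : Square f.fst f.snd (.id A Y) (.id B Y) :=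
  ⟨Iso.refl (f.hom ≫ 𝟙 Y)⟩

/-- A square of `A` and `B ∩ E`, as a square of `A` and `B`. -/
def toFst {X Y Z W : C} {b : A.Hom X Y} {q : (B.inter E).Hom X Z} {a : A.Hom Z W}
    {p : (B.inter E).Hom Y W} (S : Square b q a p) : Square b q.fst a p.fst :=
  ⟨S.cell⟩

/-- A square of `A` and `B ∩ E`, as a square of `A` and `E`. -/
def toSnd {X Y Z W : C} {b : A.Hom X Y} {q : (B.inter E).Hom X Z} {a : A.Hom Z W}
    {p : (B.inter E).Hom Y W} (S : Square b q a p) : Square b q.snd a p.snd :=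
  ⟨S.cell⟩

end Square

/-- The 2-commutative square `q ≫ i ≅ j ≫ p` is 2-Cartesian in `C`, i.e. it exhibits `P` as a
2-fiber product: for every `T`, the functor from `C(T, P)` to the category of triples
`(u, v, θ : u ≫ i ≅ v ≫ p)` is essentially surjective and fully faithful. -/
structure IsTwoCartesian {P Z Y W : C} {q : P ⟶ Z} {i : Z ⟶ W} {j : P ⟶ Y} {p : Y ⟶ W}
    (α : q ≫ i ≅ j ≫ p) : Prop where
  essSurj : ∀ {T : C} (u : T ⟶ Z) (v : T ⟶ Y) (θ : u ≫ i ≅ v ≫ p),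
    ∃ (t : T ⟶ P) (σ : t ≫ q ≅ u) (τ : t ≫ j ≅ v),
      σ.hom ▷ i ≫ θ.hom =
        (α_ t q i).hom ≫ t ◁ α.hom ≫ (α_ t j p).inv ≫ τ.hom ▷ p
  fullyFaithful : ∀ {T : C} (t t' : T ⟶ P) (σ : t ≫ q ⟶ t' ≫ q) (τ : t ≫ j ⟶ t' ≫ j),
    σ ▷ i ≫ (α_ t' q i).hom ≫ t' ◁ α.hom ≫ (α_ t' j p).inv =
        ((α_ t q i).hom ≫ t ◁ α.hom ≫ (α_ t j p).inv) ≫ τ ▷ p →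
      ∃! ω : t ⟶ t', ω ▷ q = σ ∧ ω ▷ j = τ

theorem IsTwoCartesian.symm {P Z Y W : C} {q : P ⟶ Z} {i : Z ⟶ W} {j : P ⟶ Y} {p : Y ⟶ W}
    {α : q ≫ i ≅ j ≫ p} (h : IsTwoCartesian α) : IsTwoCartesian α.symm where
  essSurj {T} u v θ := by
    obtain ⟨t, σ, τ, e⟩ := h.essSurj v u θ.symm
    refine ⟨t, τ, σ, ?_⟩
    rw [← cancel_mono θ.inv]
    simp only [Iso.symm_hom] at e ⊢
    have e' := congrArg (fun k => (α_ t j p).hom ≫ t ◁ α.inv ≫ (α_ t q i).inv ≫ k) e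
    simpa [← whiskerLeft_comp_assoc] using e'.symm
  fullyFaithful {T} t t' σ τ e := by
    obtain ⟨ω, hω, hu⟩ := h.fullyFaithful t t' τ σ (by
      have e' := congrArg (fun k => ((α_ t q i).hom ≫ t ◁ α.hom ≫ (α_ t j p).inv) ≫ k ≫
        ((α_ t' q i).hom ≫ t' ◁ α.hom ≫ (α_ t' j p).inv)) e
      simpa [← whiskerLeft_comp_assoc] using e'.symm)
    exact ⟨ω, hω.symm, fun ω' h' => hu ω' h'.symm⟩

namespace Square

variable {A B E : ArrowySub C}

/-- An `(A, B)`-square is 2-Cartesian if it is 2-Cartesian in `C`. -/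
def IsCart {X Y Z W : C} {b : A.Hom X Y} {q : B.Hom X Z} {a : A.Hom Z W} {p : B.Hom Y W}
    (S : Square b q a p) : Prop :=
  IsTwoCartesian S.cell

theorem IsCart.transpose {X Y Z W : C} {b : A.Hom X Y} {q : B.Hom X Z} {a : A.Hom Z W}
    {p : B.Hom Y W} {S : Square b q a p} (h : S.IsCart) : S.transpose.IsCart :=
  IsTwoCartesian.symm h

/-- The square `S` is obtained by pasting the square `S'` (with the same bottom and right
morphisms) with the 2-cells `γ : q ⇒ f ≫ r` and `δ : f ≫ k ⇒ b`. -/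
def DecomposesAs {X X' Y Z W : C} {b : A.Hom X Y} {q : B.Hom X Z} {a : A.Hom Z W}
    {p : B.Hom Y W} (S : Square b q a p) {k : A.Hom X' Y} {r : B.Hom X' Z}
    (S' : Square k r a p) (f : (A.inter B).Hom X X')
    (γ : q.hom ≅ f.hom ≫ r.hom) (δ : f.hom ≫ k.hom ≅ b.hom) : Prop :=
  S.cell.hom =
    γ.hom ▷ a.hom ≫ (α_ f.hom r.hom a.hom).hom ≫ f.hom ◁ S'.cell.hom ≫
      (α_ f.hom k.hom p.hom).inv ≫ δ.hom ▷ p.hom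

end Square

/-- `(A, B)` is squaring in `C`: every `(A, B)`-square factors through a 2-Cartesian
`(A, B)`-square along a morphism of `A ∩ B`. -/
def IsSquaring (A B : ArrowySub C) : Prop :=
  ∀ ⦃X Y Z W : C⦄ ⦃b : A.Hom X Y⦄ ⦃q : B.Hom X Z⦄ ⦃a : A.Hom Z W⦄ ⦃p : B.Hom Y W⦄
    (S : Square b q a p),
    ∃ (X' : C) (k : A.Hom X' Y) (r : B.Hom X' Z) (S' : Square k r a p)
      (f : (A.inter B).Hom X X') (γ : q.hom ≅ f.hom ≫ r.hom) (δ : f.hom ≫ k.hom ≅ b.hom),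
      S'.IsCart ∧ S.DecomposesAs S' f γ δ

/-- `(A, B)` is `E`-squaring in `C`: every 2-commutative cube, with edges in the three directions
belonging to `A`, `B`, `E`, decomposes as an inner 2-commutative cube (with bottom `L` and top
`L'` 2-Cartesian) pasted with a square `M` between the morphisms `f`, `f'` of `A ∩ B`; `K`, `K'`,
`J`, `J'`, `I`, `I'` are the bottom, top, front, back, right, left faces of the cube, and `J₁`,
`I₁` are the back and left faces of the inner cube. -/
def IsCubeSquaring (A B E : ArrowySub C) : Prop :=
  ∀ ⦃X Y Z W X' Y' Z' W' : C⦄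
    ⦃b : A.Hom X Y⦄ ⦃q : B.Hom X Z⦄ ⦃a : A.Hom Z W⦄ ⦃p : B.Hom Y W⦄
    ⦃b' : A.Hom X' Y'⦄ ⦃q' : B.Hom X' Z'⦄ ⦃a' : A.Hom Z' W'⦄ ⦃p' : B.Hom Y' W'⦄
    ⦃x : E.Hom X' X⦄ ⦃y : E.Hom Y' Y⦄ ⦃z : E.Hom Z' Z⦄ ⦃w : E.Hom W' W⦄
    (K : Square b q a p) (K' : Square b' q' a' p') (J : Square a' z a w)
    (J' : Square b' x b y) (I : Square p' y p w) (I' : Square q' x q z),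
    CubeComm K.cell K'.cell J.cell J'.cell I.cell I'.cell →
    ∃ (V V' : C) (c : A.Hom V Y) (r : B.Hom V Z) (c' : A.Hom V' Y') (r' : B.Hom V' Z')
      (v : E.Hom V' V) (f : (A.inter B).Hom X V) (f' : (A.inter B).Hom X' V')
      (L : Square c r a p) (L' : Square c' r' a' p') (J₁ : Square c' v c y)
      (I₁ : Square r' v r z) (M : Square f' x f v)
      (γ : q.hom ≅ f.hom ≫ r.hom) (δ : f.hom ≫ c.hom ≅ b.hom)
      (γ' : q'.hom ≅ f'.hom ≫ r'.hom) (δ' : f'.hom ≫ c'.hom ≅ b'.hom),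
      L.IsCart ∧ L'.IsCart ∧
      CubeComm L.cell L'.cell J.cell J₁.cell I.cell I₁.cell ∧
      K.DecomposesAs L f γ δ ∧ K'.DecomposesAs L' f' γ' δ' ∧
      I'.cell.hom =
        x.hom ◁ γ.hom ≫ (α_ x.hom f.hom r.hom).inv ≫ M.cell.hom ▷ r.hom ≫
          (α_ f'.hom v.hom r.hom).hom ≫ f'.hom ◁ I₁.cell.hom ≫
            (α_ f'.hom r'.hom z.hom).inv ≫ γ'.inv ▷ z.hom ∧
      J'.cell.hom =
        x.hom ◁ δ.inv ≫ (α_ x.hom f.hom c.hom).inv ≫ M.cell.hom ▷ c.hom ≫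
          (α_ f'.hom v.hom c.hom).hom ≫ f'.hom ◁ J₁.cell.hom ≫
            (α_ f'.hom c'.hom y.hom).inv ≫ δ'.hom ▷ y.hom

end Squares

section PairGluing

variable {C : Type u₁} [Bicategory.{w₁, v₁} C] {D : Type u₂} [Bicategory.{w₂, v₂} D]
  {A B E : ArrowySub C} {F₀ F₀' : C → D}

/-- A family of invertible 2-cells `G_S : F_A(a) F_B(q) ⇒ F_B(p) F_A(b)`, indexed by all
`(A, B)`-squares `S`. -/
def SquareData (FA : PsOn A F₀) (FB : PsOn B F₀) :=
  ∀ ⦃X Y Z W : C⦄ ⦃b : A.Hom X Y⦄ ⦃q : B.Hom X Z⦄ ⦃a : A.Hom Z W⦄ ⦃p : B.Hom Y W⦄,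
    Square b q a p → (FB.map q ≫ FA.map a ≅ FA.map b ≫ FB.map p)

/-- The same, indexed by the 2-Cartesian `(A, B)`-squares. -/
def CartSquareData (FA : PsOn A F₀) (FB : PsOn B F₀) :=
  ∀ ⦃X Y Z W : C⦄ ⦃b : A.Hom X Y⦄ ⦃q : B.Hom X Z⦄ ⦃a : A.Hom Z W⦄ ⦃p : B.Hom Y W⦄
    (S : Square b q a p), S.IsCart → (FB.map q ≫ FA.map a ≅ FA.map b ≫ FB.map p)

/-- Restriction to 2-Cartesian squares. -/
def SquareData.toCart {FA : PsOn A F₀} {FB : PsOn B F₀} (G : SquareData FA FB) :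
    CartSquareData FA FB :=
  fun _ _ _ _ _ _ _ _ S _ => G S

/-- The family of 2-cells indexed by `(B, A)`-squares, given by transposition and inversion. -/
def CartSquareData.transpose {FA : PsOn A F₀} {FB : PsOn B F₀} (G : CartSquareData FA FB) :
    CartSquareData FB FA :=
  fun _ _ _ _ _ _ _ _ S h => (G S.transpose h.transpose).symm

/-- `(F_A, F_B, G)` is a gluing datum for the pair `(A, B)`: compatibility with 2-cells of `A`
and of `B` (and with identities), and with vertical and horizontal composition of squares. -/
structure IsPairGluing {FA : PsOn A F₀} {FB : PsOn B F₀} (G : SquareData FA FB) : Prop where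
  vId {X Y : C} {a b : A.Hom X Y} (σ : a.hom ≅ b.hom) :
    (G (Square.vId B σ)).hom =
      (FB.mapId X).hom ▷ FA.map a ≫ (λ_ (FA.map a)).hom ≫ FA.map₂ σ.hom ≫
        (ρ_ (FA.map b)).inv ≫ FA.map b ◁ (FB.mapId Y).inv
  hId {X Y : C} {q p : B.Hom X Y} (σ : q.hom ≅ p.hom) :
    (G (Square.hId A σ)).hom =
      FB.map q ◁ (FA.mapId Y).hom ≫ (ρ_ (FB.map q)).hom ≫ FB.map₂ σ.hom ≫
        (λ_ (FB.map p)).inv ≫ (FA.mapId X).inv ▷ FB.map p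
  vcomp {X₁ X₂ X₃ Y₁ Y₂ Y₃ : C} {i₁ : A.Hom X₁ Y₁} {i₂ : A.Hom X₂ Y₂} {i₃ : A.Hom X₃ Y₃}
    {q : B.Hom X₁ X₂} {q' : B.Hom X₂ X₃} {p : B.Hom Y₁ Y₂} {p' : B.Hom Y₂ Y₃}
    (S : Square i₁ q i₂ p) (S' : Square i₂ q' i₃ p') :
    (G (S.vcomp S')).hom ≫ FA.map i₁ ◁ (FB.mapComp p p').hom =
      (FB.mapComp q q').hom ▷ FA.map i₃ ≫ (vpaste (G S) (G S')).hom
  hcomp {X₁ X₂ X₃ Y₁ Y₂ Y₃ : C} {j : A.Hom X₁ X₂} {j' : A.Hom X₂ X₃} {i : A.Hom Y₁ Y₂}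
    {i' : A.Hom Y₂ Y₃} {p₁ : B.Hom X₁ Y₁} {p₂ : B.Hom X₂ Y₂} {p₃ : B.Hom X₃ Y₃}
    (S : Square j p₁ i p₂) (S' : Square j' p₂ i' p₃) :
    (G (S.hcomp S')).hom ≫ (FA.mapComp j j').hom ▷ FB.map p₃ =
      FB.map p₁ ◁ (FA.mapComp i i').hom ≫ (hpaste (G S) (G S')).hom

/-- A family of invertible 2-cells `ρ(f) : F_B(f) ⇒ F_A(f)` for the morphisms `f` of `A ∩ B`. -/
def MeetData (FA : PsOn A F₀) (FB : PsOn B F₀) :=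
  ∀ ⦃X Y : C⦄ (f : (A.inter B).Hom X Y), FB.map f.snd ≅ FA.map f.fst

/-- `ρ` is an invertible pseudonatural transformation from `F_B` to `F_A`, both restricted to
`A ∩ B`, whose components at all objects are identities. -/
structure IsIcon {FA : PsOn A F₀} {FB : PsOn B F₀} (ρ : MeetData FA FB) : Prop where
  nat {X Y : C} {f g : (A.inter B).Hom X Y} (η : f.hom ⟶ g.hom) :
    FB.map₂ (f := f.snd) (g := g.snd) η ≫ (ρ g).hom =
      (ρ f).hom ≫ FA.map₂ (f := f.fst) (g := g.fst) η
  map_id (X : C) : (ρ (.id _ X)).hom ≫ (FA.mapId X).hom = (FB.mapId X).hom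
  map_comp {X Y Z : C} (f : (A.inter B).Hom X Y) (g : (A.inter B).Hom Y Z) :
    (ρ (f.comp g)).hom ≫ (FA.mapComp f.fst g.fst).hom =
      (FB.mapComp f.snd g.snd).hom ≫ (ρ f).hom ▷ FB.map g.snd ≫ FA.map f.fst ◁ (ρ g).hom

/-- The 2-cells `ρ(f)` induced by `G`: up to unit constraints, `ρ(f)` is the value of `G` on the
square with top and left morphisms `f` and with identities as bottom and right morphisms. -/
def SquareData.meet {FA : PsOn A F₀} {FB : PsOn B F₀} (G : SquareData FA FB) :
    MeetData FA FB :=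
  fun _ Y f =>
    (ρ_ (FB.map f.snd)).symm ≪≫ whiskerLeftIso (FB.map f.snd) (FA.mapId Y).symm ≪≫
      G (Square.corner f) ≪≫ whiskerLeftIso (FA.map f.fst) (FB.mapId Y) ≪≫ ρ_ (FA.map f.fst)

/-- `(F_A, F_B, G, ρ)` is a Cartesian gluing datum for the pair `(A, B)`. -/
structure IsCartPairGluing {FA : PsOn A F₀} {FB : PsOn B F₀} (G : CartSquareData FA FB)
    (ρ : MeetData FA FB) : Prop where
  icon : IsIcon ρ
  vcomp {X₁ X₂ X₃ Y₁ Y₂ Y₃ : C} {i₁ : A.Hom X₁ Y₁} {i₂ : A.Hom X₂ Y₂} {i₃ : A.Hom X₃ Y₃}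
    {q : B.Hom X₁ X₂} {q' : B.Hom X₂ X₃} {p : B.Hom Y₁ Y₂} {p' : B.Hom Y₂ Y₃}
    (S : Square i₁ q i₂ p) (S' : Square i₂ q' i₃ p') (h : S.IsCart) (h' : S'.IsCart)
    (h'' : (S.vcomp S').IsCart) :
    (G (S.vcomp S') h'').hom ≫ FA.map i₁ ◁ (FB.mapComp p p').hom =
      (FB.mapComp q q').hom ▷ FA.map i₃ ≫ (vpaste (G S h) (G S' h')).hom
  hcomp {X₁ X₂ X₃ Y₁ Y₂ Y₃ : C} {j : A.Hom X₁ X₂} {j' : A.Hom X₂ X₃} {i : A.Hom Y₁ Y₂}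
    {i' : A.Hom Y₂ Y₃} {p₁ : B.Hom X₁ Y₁} {p₂ : B.Hom X₂ Y₂} {p₃ : B.Hom X₃ Y₃}
    (S : Square j p₁ i p₂) (S' : Square j' p₂ i' p₃) (h : S.IsCart) (h' : S'.IsCart)
    (h'' : (S.hcomp S').IsCart) :
    (G (S.hcomp S') h'').hom ≫ (FA.mapComp j j').hom ▷ FB.map p₃ =
      FB.map p₁ ◁ (FA.mapComp i i').hom ≫ (hpaste (G S h) (G S' h')).hom
  vMeet {X Y Z W : C} {b : A.Hom X Y} {q : (A.inter B).Hom X Z} {a : A.Hom Z W}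
    {p : (A.inter B).Hom Y W} (S : Square b q.snd a p.snd) (h : S.IsCart) :
    (G S h).hom ≫ FA.map b ◁ (ρ p).hom ≫ (FA.mapComp b p.fst).inv =
      (ρ q).hom ▷ FA.map a ≫ (FA.mapComp q.fst a).inv ≫
        FA.map₂ (f := q.fst.comp a) (g := b.comp p.fst) S.cell.hom
  hMeet {X Y Z W : C} {b : (A.inter B).Hom X Y} {q : B.Hom X Z} {a : (A.inter B).Hom Z W}
    {p : B.Hom Y W} (S : Square b.fst q a.fst p) (h : S.IsCart) :
    (G S h).hom ≫ (ρ b).inv ▷ FB.map p ≫ (FB.mapComp b.snd p).inv =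
      FB.map q ◁ (ρ a).inv ≫ (FB.mapComp q a.snd).inv ≫
        FB.map₂ (f := q.comp a.snd) (g := b.snd.comp p) S.cell.hom

/-- A pair of pseudonatural transformations with common components `α` is compatible with the
given 2-cells `e` and `e'` attached to one and the same square of `C`. -/
def CompatAt {FA : PsOn A F₀} {FB : PsOn B F₀} {FA' : PsOn A F₀'} {FB' : PsOn B F₀'}
    {α : ∀ X, F₀ X ⟶ F₀' X} (αA : StrongOn FA FA' α) (αB : StrongOn FB FB' α)
    {X Y Z W : C} {b : A.Hom X Y} {q : B.Hom X Z} {a : A.Hom Z W} {p : B.Hom Y W}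
    (e : FB.map q ≫ FA.map a ≅ FA.map b ≫ FB.map p)
    (e' : FB'.map q ≫ FA'.map a ≅ FA'.map b ≫ FB'.map p) : Prop :=
  CubeComm (αA.nat a) (αA.nat b) (αB.nat p) (αB.nat q) e' e

end PairGluing

section GluingFamilies

variable {C : Type u₁} [Bicategory.{w₁, v₁} C] {n : ℕ}

/-- The 2-category of gluing data from `C` to `D` relative to `A 1, …, A n`. An object consists of
pseudofunctors `F i : A i → D` with the same object map, and of gluing data `G i j` for the pairs
`(A i, A j)`, `i < j`, satisfying the hexagon condition for all 2-commutative cubes. -/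
structure GD (A : Fin n → ArrowySub C) (D : Type u₂) [Bicategory.{w₂, v₂} D]
    extends Fam A D where
  G (i j : Fin n) (h : i < j) : SquareData (F i) (F j)
  pair (i j : Fin n) (h : i < j) : IsPairGluing (G i j h)
  cube (i j k : Fin n) (hij : i < j) (hjk : j < k) {X Y Z W X' Y' Z' W' : C}
    {b : (A i).Hom X Y} {q : (A j).Hom X Z} {a : (A i).Hom Z W} {p : (A j).Hom Y W}
    {b' : (A i).Hom X' Y'} {q' : (A j).Hom X' Z'} {a' : (A i).Hom Z' W'} {p' : (A j).Hom Y' W'}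
    {x : (A k).Hom X' X} {y : (A k).Hom Y' Y} {z : (A k).Hom Z' Z} {w : (A k).Hom W' W}
    (K : Square b q a p) (K' : Square b' q' a' p') (J : Square a' z a w)
    (J' : Square b' x b y) (I : Square p' y p w) (I' : Square q' x q z)
    (comm : CubeComm K.cell K'.cell J.cell J'.cell I.cell I'.cell) :
    CubeComm (G i j hij K) (G i j hij K') (G i k (hij.trans hjk) J) (G i k (hij.trans hjk) J')
      (G j k hjk I) (G j k hjk I')

/-- The data underlying an object of the 2-category of Cartesian gluing data. -/
structure CartData (A : Fin n → ArrowySub C) (D : Type u₂) [Bicategory.{w₂, v₂} D]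
    extends Fam A D where
  G (i j : Fin n) (h : i < j) : CartSquareData (F i) (F j)
  ρ (i j : Fin n) (h : i < j) : MeetData (F i) (F j)

variable {D : Type u₂} [Bicategory.{w₂, v₂} D] {A : Fin n → ArrowySub C}

/-- The family `G i j` for arbitrary `i ≠ j`: for `j < i` it is obtained from `G j i` by
transposition and inversion. -/
def CartData.Gne (X : CartData A D) (i j : Fin n) (h : i ≠ j) : CartSquareData (X.F i) (X.F j) :=
  if hij : i < j then X.G i j hij
  else (X.G j i (lt_of_le_of_ne (not_lt.mp hij) h.symm)).transpose

/-- The conditions on an object of the 2-category of Cartesian gluing data: each pair is a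
Cartesian gluing datum; the hexagon condition holds for all 2-commutative cubes whose six faces
are 2-Cartesian; `G` is compatible with `ρ` for 2-Cartesian `(A i, A j ∩ A k)`-squares; and `ρ`
satisfies the cocycle condition. -/
structure CartData.IsGluing (X : CartData A D) : Prop where
  pair (i j : Fin n) (h : i < j) : IsCartPairGluing (X.G i j h) (X.ρ i j h)
  cube (i j k : Fin n) (hij : i < j) (hjk : j < k) {X₀ Y Z W X' Y' Z' W' : C}
    {b : (A i).Hom X₀ Y} {q : (A j).Hom X₀ Z} {a : (A i).Hom Z W} {p : (A j).Hom Y W}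
    {b' : (A i).Hom X' Y'} {q' : (A j).Hom X' Z'} {a' : (A i).Hom Z' W'} {p' : (A j).Hom Y' W'}
    {x : (A k).Hom X' X₀} {y : (A k).Hom Y' Y} {z : (A k).Hom Z' Z} {w : (A k).Hom W' W}
    (K : Square b q a p) (K' : Square b' q' a' p') (J : Square a' z a w)
    (J' : Square b' x b y) (I : Square p' y p w) (I' : Square q' x q z)
    (hK : K.IsCart) (hK' : K'.IsCart) (hJ : J.IsCart) (hJ' : J'.IsCart) (hI : I.IsCart)
    (hI' : I'.IsCart)
    (comm : CubeComm K.cell K'.cell J.cell J'.cell I.cell I'.cell) :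
    CubeComm (X.G i j hij K hK) (X.G i j hij K' hK') (X.G i k (hij.trans hjk) J hJ)
      (X.G i k (hij.trans hjk) J' hJ') (X.G j k hjk I hI) (X.G j k hjk I' hI')
  meet (i j k : Fin n) (hjk : j < k) (hij : i ≠ j) (hik : i ≠ k) {X₀ Y Z W : C}
    {b : (A i).Hom X₀ Y} {q : ((A j).inter (A k)).Hom X₀ Z} {a : (A i).Hom Z W}
    {p : ((A j).inter (A k)).Hom Y W} (S : Square b q a p) (h : S.IsCart) :
    (X.ρ j k hjk q).hom ▷ (X.F i).map a ≫ (X.Gne i j hij S.toFst h).hom =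
      (X.Gne i k hik S.toSnd h).hom ≫ (X.F i).map b ◁ (X.ρ j k hjk p).hom
  cocycle (i j k : Fin n) (hij : i < j) (hjk : j < k) {X₀ Y : C} (f : X₀ ⟶ Y)
    (hi : (A i).mem f) (hj : (A j).mem f) (hk : (A k).mem f) :
    (X.ρ j k hjk ⟨f, hj, hk⟩).hom ≫ (X.ρ i j hij ⟨f, hi, hj⟩).hom =
      (X.ρ i k (hij.trans hjk) ⟨f, hi, hk⟩).hom

/-- The 2-category of Cartesian gluing data from `C` to `D` relative to `A 1, …, A n`. -/
structure GDCart (A : Fin n → ArrowySub C) (D : Type u₂) [Bicategory.{w₂, v₂} D]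
    extends CartData A D where
  isGluing : toCartData.IsGluing

/-- A morphism of families is a morphism of gluing data if it is compatible with `G i j` on all
`(A i, A j)`-squares, `i < j`. -/
def GD.IsMor (X Y : GD A D) (α : X.toFam ⟶ Y.toFam) : Prop :=
  ∀ (i j : Fin n) (h : i < j) ⦃X₀ Y₀ Z₀ W₀ : C⦄ ⦃b : (A i).Hom X₀ Y₀⦄ ⦃q : (A j).Hom X₀ Z₀⦄
    ⦃a : (A i).Hom Z₀ W₀⦄ ⦃p : (A j).Hom Y₀ W₀⦄ (S : Square b q a p),
    CompatAt (α.tr i) (α.tr j) (X.G i j h S) (Y.G i j h S)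

/-- A morphism of families is a morphism of Cartesian gluing data if it is compatible with `G i j`
on 2-Cartesian `(A i, A j)`-squares and with `ρ i j`, for all `i < j`. -/
structure CartData.IsMor (X Y : CartData A D) (α : X.toFam ⟶ Y.toFam) : Prop where
  square (i j : Fin n) (h : i < j) ⦃X₀ Y₀ Z₀ W₀ : C⦄ ⦃b : (A i).Hom X₀ Y₀⦄ ⦃q : (A j).Hom X₀ Z₀⦄
    ⦃a : (A i).Hom Z₀ W₀⦄ ⦃p : (A j).Hom Y₀ W₀⦄ (S : Square b q a p) (hS : S.IsCart) :
    CompatAt (α.tr i) (α.tr j) (X.G i j h S hS) (Y.G i j h S hS)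
  meet (i j : Fin n) (h : i < j) ⦃X₀ Y₀ : C⦄ (f : ((A i).inter (A j)).Hom X₀ Y₀) :
    (X.ρ i j h f).hom ▷ α.app Y₀ ≫ ((α.tr i).nat f.fst).hom =
      ((α.tr j).nat f.snd).hom ≫ α.app X₀ ◁ (Y.ρ i j h f).hom

theorem CompatAt.id {A B : ArrowySub C} {F₀ : C → D} {FA : PsOn A F₀} {FB : PsOn B F₀}
    {X Y Z W : C} {b : A.Hom X Y} {q : B.Hom X Z} {a : A.Hom Z W} {p : B.Hom Y W}
    (e : FB.map q ≫ FA.map a ≅ FA.map b ≫ FB.map p) :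
    CompatAt (StrongOn.id FA) (StrongOn.id FB) e e :=
  CubeComm.refl e

theorem CompatAt.comp {A B : ArrowySub C} {F₀ G₀ H₀ : C → D} {FA : PsOn A F₀} {FB : PsOn B F₀}
    {GA : PsOn A G₀} {GB : PsOn B G₀} {HA : PsOn A H₀} {HB : PsOn B H₀}
    {α : ∀ X, F₀ X ⟶ G₀ X} {β : ∀ X, G₀ X ⟶ H₀ X}
    {αA : StrongOn FA GA α} {αB : StrongOn FB GB α} {βA : StrongOn GA HA β}
    {βB : StrongOn GB HB β}
    {X Y Z W : C} {b : A.Hom X Y} {q : B.Hom X Z} {a : A.Hom Z W} {p : B.Hom Y W}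
    {e : FB.map q ≫ FA.map a ≅ FA.map b ≫ FB.map p}
    {e' : GB.map q ≫ GA.map a ≅ GA.map b ≫ GB.map p}
    {e'' : HB.map q ≫ HA.map a ≅ HA.map b ≫ HB.map p}
    (h : CompatAt αA αB e e') (h' : CompatAt βA βB e' e'') :
    CompatAt (αA.comp βA) (αB.comp βB) e e'' :=
  CubeComm.hpaste h h'

/-- The morphisms of gluing data, as a class of morphisms of families. -/
def GD.mor (A : Fin n → ArrowySub C) (D : Type u₂) [Bicategory.{w₂, v₂} D] :
    Sub (GD.toFam : GD A D → Fam A D) where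
  mem {X Y} α := GD.IsMor X Y α
  id_mem X i j h _ _ _ _ _ _ _ _ S := CompatAt.id (X.G i j h S)
  comp_mem hf hg i j h _ _ _ _ _ _ _ _ S := CompatAt.comp (hf i j h S) (hg i j h S)

/-- The morphisms of Cartesian gluing data, as a class of morphisms of families. -/
def GDCart.mor (A : Fin n → ArrowySub C) (D : Type u₂) [Bicategory.{w₂, v₂} D] :
    Sub (fun X : GDCart A D => X.toFam) where
  mem {X Y} α := CartData.IsMor X.toCartData Y.toCartData α
  id_mem X :=
    { square := fun i j h _ _ _ _ _ _ _ _ S hS => CompatAt.id (X.G i j h S hS)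
      meet := fun i j h X₀ Y₀ f => by
        change _ ▷ 𝟙 _ ≫ (ρ_ _ ≪≫ (λ_ _).symm).hom = (ρ_ _ ≪≫ (λ_ _).symm).hom ≫ 𝟙 _ ◁ _
        simp }
  comp_mem {X Y Z α β} hf hg :=
    { square := fun i j h _ _ _ _ _ _ _ _ S hS =>
        CompatAt.comp (hf.square i j h S hS) (hg.square i j h S hS)
      meet := fun i j h X₀ Y₀ f => by
        have h₁ := hf.meet i j h f
        have h₂ := hg.meet i j h f
        change _ ▷ (α.app Y₀ ≫ β.app Y₀) ≫
          (hpaste ((α.tr i).nat f.fst) ((β.tr i).nat f.fst)).hom =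
            (hpaste ((α.tr j).nat f.snd) ((β.tr j).nat f.snd)).hom ≫
              (α.app X₀ ≫ β.app X₀) ◁ _
        simp only [hpaste, Iso.trans_hom, Iso.symm_hom, whiskerLeftIso_hom, whiskerRightIso_hom]
        calc
          _ = 𝟙 _ ⊗≫ ((X.ρ i j h f).hom ▷ α.app Y₀ ≫ ((α.tr i).nat f.fst).hom) ▷ β.app Y₀ ⊗≫
                α.app X₀ ◁ ((β.tr i).nat f.fst).hom ⊗≫ 𝟙 _ := by bicategory
          _ = 𝟙 _ ⊗≫ ((α.tr j).nat f.snd).hom ▷ β.app Y₀ ⊗≫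
                α.app X₀ ◁ ((Y.ρ i j h f).hom ▷ β.app Y₀ ≫ ((β.tr i).nat f.fst).hom) ⊗≫
                  𝟙 _ := by rw [h₁]; bicategory
          _ = _ := by rw [h₂]; bicategory }

instance : Bicategory (GD A D) := (GD.mor A D).bicategory

instance : Bicategory (GDCart A D) := (GDCart.mor A D).bicategory

instance [Strict D] : Strict (GD A D) := (GD.mor A D).strict

instance [Strict D] : Strict (GDCart A D) := (GDCart.mor A D).strict

/-- The 2-functor making `GD A D` a `D^{Ob C}`-category. -/
def GD.forget (A : Fin n → ArrowySub C) (D : Type u₂) [Bicategory.{w₂, v₂} D] :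
    StrictPseudofunctor (GD A D) (Pow C D) :=
  (GD.mor A D).forget.comp Fam.forget

/-- The 2-functor making `GDCart A D` a `D^{Ob C}`-category. -/
def GDCart.forget (A : Fin n → ArrowySub C) (D : Type u₂) [Bicategory.{w₂, v₂} D] :
    StrictPseudofunctor (GDCart A D) (Pow C D) :=
  (GDCart.mor A D).forget.comp Fam.forget

/-- The Cartesian gluing datum associated with a gluing datum: the same pseudofunctors, the
restriction of `G i j` to 2-Cartesian squares, and the 2-cells `ρ i j` induced by `G i j`. -/
def GD.toCartData (X : GD A D) : CartData A D where
  toFam := X.toFam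
  G i j h := (X.G i j h).toCart
  ρ i j h := (X.G i j h).meet

/-- The 2-functor from gluing data to Cartesian gluing data. It does not change the underlying
morphisms of families and their 2-cells. -/
def GD.toCart (hobj : ∀ X : GD A D, X.toCartData.IsGluing)
    (hmor : ∀ (X Y : GD A D) (α : X.toFam ⟶ Y.toFam), GD.IsMor X Y α →
      CartData.IsMor X.toCartData Y.toCartData α) :
    StrictPseudofunctor (GD A D) (GDCart A D) :=
  (GDCart.mor A D).lift (fun X : GD A D => ⟨X.toCartData, hobj X⟩) (GD.mor A D) hmor

end GluingFamilies

section Isomorphisms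

variable {P : Type u₁} [Bicategory.{w₁, v₁} P] {M : Type u₂} [Bicategory.{w₂, v₂} M]
  {N : Type u₃} [Bicategory.{w₃, v₃} N]

/-- For 2-categories `M`, `N` over `P`, the strict 2-functor `Φ : M → N` is an isomorphism of
2-categories over `P`: it commutes with the 2-functors to `P`, and it is bijective on objects,
on morphisms and on 2-cells. -/
structure IsIsoOver (p : StrictPseudofunctor M P) (q : StrictPseudofunctor N P)
    (Φ : StrictPseudofunctor M N) : Prop where
  comm : Φ.comp q = p
  obj : Function.Bijective Φ.obj
  map (X Y : M) : Function.Bijective fun f : X ⟶ Y => Φ.map f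
  map₂ {X Y : M} (f g : X ⟶ Y) : Function.Bijective fun η : f ⟶ g => Φ.map₂ η

end Isomorphisms

end GluingData

/-! Why a gluing datum for a pair $(A,B)$ is determined by its Cartesian part: every $(A,B)$-square
$S$ is a 2-Cartesian square $S'$ over the same cospan, pasted with a morphism $f$ of $A\cap B$. The
contribution of $f$ is a square with left edge $f$ and an identity as right edge, and the axioms
force its value to be $\rho(f)$ up to constraints. Hence $G_S$ must be $G_{S'}$ pasted with
$\rho(f)$ (`MeetGluing.form`, `MeetGluing.fill_eq_push`). This is injectivity on objects. The same
formula shows that (m) at $S$ follows from (m) at $S'$ and (n) at $f$, so the two notions of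
morphism agree; 2-cells are the same on both sides.

For surjectivity the formula becomes a definition (`MeetGluing.ext`). It does not depend on the
decomposition (`ext_eq_ext`): two 2-fiber products of one cospan are equivalent, equivalences lie in
$A\cap B$, and the square attached to such an equivalence is itself 2-Cartesian, so the formula
already holds for it. Compatibility with vertical composition (`ext_vcomp`) rests on `ext_absorb`,
which moves a morphism of $A\cap B$ from the bottom edge of the upper square to its left edge; the
2-Cartesian square needed there comes from $(B,B\cap A)$ being squaring. Horizontal composition
follows by transposition.

For three subcategories the link between cubes and $\rho$ is `MeetCompat`, the condition (E) for all
squares. From the hexagon one obtains (E), and then (F), by looking at cubes and squares with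
identity edges. In the other direction, (E) on 2-Cartesian squares and (F) give (E) on all squares
because $(A\cap B,A')$ is squaring (`MeetCompat.of_cart`). Cube squaring then reduces the hexagon to
cubes with 2-Cartesian bottom and top (`hex_of_inner`). Applying this in the three directions in
turn makes the three faces at the terminal vertex 2-Cartesian, together with one opposite face, and
cancellation of 2-Cartesian squares gives the remaining two (`HexAll.of_cart`).

To keep coherence under control, these constructions are carried out for actions. A pseudofunctor on
$A$ makes $A$ act on the categories $\mathcal D(T,F_0X)$ by composition, for every $T$. Gluing data
become natural isomorphisms between composites of functors, where associators of $\mathcal D$ no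
longer appear. Since 2-cells of $\mathcal D$ are detected by whiskering with all $x:T\to F_0X$, each
axiom is equivalent to its evaluated form. The extension is given by one 2-cell of $\mathcal D$ per
square (`extCell`), whose evaluations are the extensions for the actions. -/

namespace GluingData

universe w₁ v₁ u₁ w₂ v₂ u₂ w₃ v₃ u₃ u₄

/-! ### Evaluation of squares and cubes at morphisms into the initial vertex -/

section SquareAction

variable {B : Type u₁} [Bicategory.{w₁, v₁} B]

/-- A 2-cell filling a square, evaluated at a morphism `x` into the initial vertex. -/
def sqAct {T X Y Z W : B} {q : X ⟶ Z} {a : Z ⟶ W} {b : X ⟶ Y} {p : Y ⟶ W}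
    (S : q ≫ a ≅ b ≫ p) (x : T ⟶ X) : (x ≫ q) ≫ a ≅ (x ≫ b) ≫ p :=
  α_ x q a ≪≫ whiskerLeftIso x S ≪≫ (α_ x b p).symm

/-- By the interchange law; the evaluations at varying `x` thus form a natural transformation. -/
theorem sqAct_naturality {T X Y Z W : B} {q : X ⟶ Z} {a : Z ⟶ W} {b : X ⟶ Y} {p : Y ⟶ W}
    (S : q ≫ a ≅ b ≫ p) {x y : T ⟶ X} (u : x ⟶ y) :
    u ▷ q ▷ a ≫ (sqAct S y).hom = (sqAct S x).hom ≫ u ▷ b ▷ p := by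
  simp only [sqAct, Iso.trans_hom, whiskerLeftIso_hom, Iso.symm_hom, Category.assoc]
  rw [associator_naturality_left_assoc, ← whisker_exchange_assoc, associator_inv_naturality_left]

theorem sqAct_vpaste {T X₁ X₂ X₃ Y₁ Y₂ Y₃ : B} {i₁ : X₁ ⟶ Y₁} {i₂ : X₂ ⟶ Y₂} {i₃ : X₃ ⟶ Y₃}
    {q : X₁ ⟶ X₂} {q' : X₂ ⟶ X₃} {p : Y₁ ⟶ Y₂} {p' : Y₂ ⟶ Y₃}
    (S : q ≫ i₂ ≅ i₁ ≫ p) (S' : q' ≫ i₃ ≅ i₂ ≫ p') (x : T ⟶ X₁) :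
    (sqAct (vpaste S S') x).hom = (α_ x q q').inv ▷ i₃ ≫ (sqAct S' (x ≫ q)).hom ≫
      (sqAct S x).hom ▷ p' ≫ (α_ (x ≫ i₁) p p').hom := by
  simp [sqAct, vpaste]

theorem sqAct_hpaste {T X₁ X₂ X₃ Y₁ Y₂ Y₃ : B} {j : X₁ ⟶ X₂} {j' : X₂ ⟶ X₃} {i : Y₁ ⟶ Y₂}
    {i' : Y₂ ⟶ Y₃} {p₁ : X₁ ⟶ Y₁} {p₂ : X₂ ⟶ Y₂} {p₃ : X₃ ⟶ Y₃}
    (S : p₁ ≫ i ≅ j ≫ p₂) (S' : p₂ ≫ i' ≅ j' ≫ p₃) (x : T ⟶ X₁) :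
    (sqAct (hpaste S S') x).hom = (α_ (x ≫ p₁) i i').inv ≫ (sqAct S x).hom ▷ i' ≫
      (sqAct S' (x ≫ j)).hom ≫ (α_ x j j').hom ▷ p₃ := by
  simp [sqAct, hpaste]

theorem sqAct_symm {T X Y Z W : B} {q : X ⟶ Z} {a : Z ⟶ W} {b : X ⟶ Y} {p : Y ⟶ W}
    (S : q ≫ a ≅ b ≫ p) (x : T ⟶ X) : sqAct S.symm x = (sqAct S x).symm := by
  ext; simp [sqAct]

/-- Whiskering with `𝟙 X` recovers the 2-cell up to unitors. All translations between 2-cells and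
their evaluations rest on this. -/
theorem eq_iff_whiskerLeft {X Y : B} {f g : X ⟶ Y} {η θ : f ⟶ g} :
    η = θ ↔ ∀ (T : B) (x : T ⟶ X), x ◁ η = x ◁ θ := by
  refine ⟨fun h _ _ => h ▸ rfl, fun h => ?_⟩
  simpa using h X (𝟙 X)

theorem sqAct_injective {X Y Z W : B} {q : X ⟶ Z} {a : Z ⟶ W} {b : X ⟶ Y} {p : Y ⟶ W}
    {S S' : q ≫ a ≅ b ≫ p} (h : ∀ (T : B) (x : T ⟶ X), (sqAct S x).hom = (sqAct S' x).hom) :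
    S = S' := by
  refine Iso.ext (eq_iff_whiskerLeft.mpr fun T x => ?_)
  simpa [sqAct] using h T x

/-- Inverting the filling exchanges the two kinds of pasting, so that of two dual statements only
one needs a direct proof. -/
theorem hpaste_symm {X₁ X₂ X₃ Y₁ Y₂ Y₃ : B} {j : X₁ ⟶ X₂} {j' : X₂ ⟶ X₃} {i : Y₁ ⟶ Y₂}
    {i' : Y₂ ⟶ Y₃} {p₁ : X₁ ⟶ Y₁} {p₂ : X₂ ⟶ Y₂} {p₃ : X₃ ⟶ Y₃}
    (S : p₁ ≫ i ≅ j ≫ p₂) (S' : p₂ ≫ i' ≅ j' ≫ p₃) :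
    (hpaste S S').symm = vpaste S.symm S'.symm := by
  ext; simp [hpaste, vpaste]

theorem vpaste_symm {X₁ X₂ X₃ Y₁ Y₂ Y₃ : B} {i₁ : X₁ ⟶ Y₁} {i₂ : X₂ ⟶ Y₂} {i₃ : X₃ ⟶ Y₃}
    {q : X₁ ⟶ X₂} {q' : X₂ ⟶ X₃} {p : Y₁ ⟶ Y₂} {p' : Y₂ ⟶ Y₃}
    (S : q ≫ i₂ ≅ i₁ ≫ p) (S' : q' ≫ i₃ ≅ i₂ ≫ p') :
    (vpaste S S').symm = hpaste S.symm S'.symm := by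
  ext; simp [hpaste, vpaste]

section Cubes

variable {X Y Z W X' Y' Z' W' : B}
    {a : Z ⟶ W} {b : X ⟶ Y} {a' : Z' ⟶ W'} {b' : X' ⟶ Y'}
    {p : Y ⟶ W} {q : X ⟶ Z} {p' : Y' ⟶ W'} {q' : X' ⟶ Z'}
    {x : X' ⟶ X} {y : Y' ⟶ Y} {z : Z' ⟶ Z} {w : W' ⟶ W}
    {K : q ≫ a ≅ b ≫ p} {K' : q' ≫ a' ≅ b' ≫ p'}
    {J : z ≫ a ≅ a' ≫ w} {J' : x ≫ b ≅ b' ≫ y}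
    {I : y ≫ p ≅ p' ≫ w} {I' : x ≫ q ≅ q' ≫ z}

/-- The hexagon of a cube, evaluated at the morphisms into the initial vertex. -/
theorem cubeComm_iff : CubeComm K K' J J' I I' ↔ ∀ (T : B) (t : T ⟶ X'),
    (sqAct I' t).hom ▷ a ≫ (sqAct J (t ≫ q')).hom ≫ (sqAct K' t).hom ▷ w =
      (sqAct K (t ≫ x)).hom ≫ (sqAct J' t).hom ▷ p ≫ (sqAct I (t ≫ b')).hom := by
  rw [CubeComm, eq_iff_whiskerLeft]
  refine forall₂_congr fun T t => ?_
  -- Whiskering the hexagon with `t` differs from the evaluated hexagon only by bracketing; these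
  -- associators make the two agree.
  rw [← cancel_epi ((α_ t x q).hom ▷ a ≫ (α_ t (x ≫ q) a).hom ≫ t ◁ (α_ x q a).hom),
    ← cancel_mono (t ◁ (α_ b' p' w).inv ≫ (α_ t (b' ≫ p') w).inv ≫ (α_ t b' p').inv ▷ w)]
  refine Eq.congr ?_ ?_
  · simp [sqAct]
  · simp [sqAct]

/-- The hexagon is an equation between invertible 2-cells, so a face can be moved to the other side.
This exchange and `CubeComm.swap_snd_trd` generate all permutations of the three directions; the
faces spanned by the exchanged directions are transposed. -/
theorem CubeComm.swap_fst_snd (h : CubeComm K K' J J' I I') :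
    CubeComm K.symm K'.symm I I' J J' := by
  rw [cubeComm_iff] at h ⊢
  intro T t
  have := h T t
  simp only [sqAct_symm, Iso.symm_hom]
  rw [← cancel_epi (sqAct K (t ≫ x)).hom, Iso.hom_inv_id_assoc, ← Category.assoc,
    ← Category.assoc, Category.assoc _ (_ ▷ p), ← this]
  simp

theorem CubeComm.swap_snd_trd (h : CubeComm K K' J J' I I') :
    CubeComm J J' K K' I.symm I'.symm := by
  rw [cubeComm_iff] at h ⊢
  intro T t
  have := h T t
  simp only [sqAct_symm, Iso.symm_hom]
  rw [← cancel_epi ((sqAct I' t).hom ▷ a), ← cancel_mono (sqAct I (t ≫ b')).hom]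
  simp [this]

end Cubes

end SquareAction

/-! ### Pasting, cancellation and uniqueness of 2-Cartesian squares -/

section TwoCartesian

variable {C : Type u₁} [Bicategory.{w₁, v₁} C]

theorem IsTwoCartesian.exists_lift {P Z Y W : C} {q : P ⟶ Z} {i : Z ⟶ W} {j : P ⟶ Y} {p : Y ⟶ W}
    {α : q ≫ i ≅ j ≫ p} (h : IsTwoCartesian α) {T : C} (u : T ⟶ Z) (v : T ⟶ Y)
    (θ : u ≫ i ≅ v ≫ p) : ∃ (t : T ⟶ P) (σ : t ≫ q ≅ u) (τ : t ≫ j ≅ v),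
      σ.hom ▷ i ≫ θ.hom = (sqAct α t).hom ≫ τ.hom ▷ p := by
  obtain ⟨t, σ, τ, e⟩ := h.essSurj u v θ
  exact ⟨t, σ, τ, by simpa [sqAct] using e⟩

theorem IsTwoCartesian.exists_cell {P Z Y W : C} {q : P ⟶ Z} {i : Z ⟶ W} {j : P ⟶ Y} {p : Y ⟶ W}
    {α : q ≫ i ≅ j ≫ p} (h : IsTwoCartesian α) {T : C} {t t' : T ⟶ P} (σ : t ≫ q ⟶ t' ≫ q)
    (τ : t ≫ j ⟶ t' ≫ j) (e : σ ▷ i ≫ (sqAct α t').hom = (sqAct α t).hom ≫ τ ▷ p) :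
    ∃ ω : t ⟶ t', ω ▷ q = σ ∧ ω ▷ j = τ :=
  (h.fullyFaithful t t' σ τ (by simpa [sqAct] using e)).exists

theorem IsTwoCartesian.hom_ext {P Z Y W : C} {q : P ⟶ Z} {i : Z ⟶ W} {j : P ⟶ Y} {p : Y ⟶ W}
    {α : q ≫ i ≅ j ≫ p} (h : IsTwoCartesian α) {T : C} {t t' : T ⟶ P} {ω ω' : t ⟶ t'}
    (h₁ : ω ▷ q = ω' ▷ q) (h₂ : ω ▷ j = ω' ▷ j) : ω = ω' :=
  (h.fullyFaithful t t' (ω' ▷ q) (ω' ▷ j) (by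
    simpa [sqAct] using sqAct_naturality α ω')).unique ⟨h₁, h₂⟩ ⟨rfl, rfl⟩

theorem IsTwoCartesian.mk' {P Z Y W : C} {q : P ⟶ Z} {i : Z ⟶ W} {j : P ⟶ Y} {p : Y ⟶ W}
    {α : q ≫ i ≅ j ≫ p}
    (h₁ : ∀ {T : C} (u : T ⟶ Z) (v : T ⟶ Y) (θ : u ≫ i ≅ v ≫ p),
      ∃ (t : T ⟶ P) (σ : t ≫ q ≅ u) (τ : t ≫ j ≅ v),
        σ.hom ▷ i ≫ θ.hom = (sqAct α t).hom ≫ τ.hom ▷ p)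
    (h₂ : ∀ {T : C} (t t' : T ⟶ P) (σ : t ≫ q ⟶ t' ≫ q) (τ : t ≫ j ⟶ t' ≫ j),
      σ ▷ i ≫ (sqAct α t').hom = (sqAct α t).hom ≫ τ ▷ p → ∃ ω : t ⟶ t', ω ▷ q = σ ∧ ω ▷ j = τ)
    (h₃ : ∀ {T : C} {t t' : T ⟶ P} {ω ω' : t ⟶ t'}, ω ▷ q = ω' ▷ q → ω ▷ j = ω' ▷ j → ω = ω') :
    IsTwoCartesian α where
  essSurj u v θ := by
    obtain ⟨t, σ, τ, e⟩ := h₁ u v θ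
    exact ⟨t, σ, τ, by simpa [sqAct] using e⟩
  fullyFaithful t t' σ τ e := by
    obtain ⟨ω, e₁, e₂⟩ := h₂ t t' σ τ (by simpa [sqAct] using e)
    exact ⟨ω, ⟨e₁, e₂⟩, fun ω' h => h₃ (h.1.trans e₁.symm) (h.2.trans e₂.symm)⟩

/-- The usual pasting argument in two stages: 1-cells and 2-cells are first lifted to the vertex
`X₂` of the lower square, and then to `X₁`. -/
theorem IsTwoCartesian.vpaste {X₁ X₂ X₃ Y₁ Y₂ Y₃ : C} {i₁ : X₁ ⟶ Y₁} {i₂ : X₂ ⟶ Y₂}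
    {i₃ : X₃ ⟶ Y₃} {q : X₁ ⟶ X₂} {q' : X₂ ⟶ X₃} {p : Y₁ ⟶ Y₂} {p' : Y₂ ⟶ Y₃}
    {S : q ≫ i₂ ≅ i₁ ≫ p} {S' : q' ≫ i₃ ≅ i₂ ≫ p'} (h : IsTwoCartesian S)
    (h' : IsTwoCartesian S') : IsTwoCartesian (vpaste S S') := by
  refine .mk' ?_ ?_ ?_
  · intro T u v θ
    obtain ⟨t', σ', τ', e'⟩ := h'.exists_lift u (v ≫ p) (θ ≪≫ (α_ v p p').symm)
    obtain ⟨t, σ, τ, e⟩ := h.exists_lift t' v τ'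
    refine ⟨t, (α_ t q q').symm ≪≫ whiskerRightIso σ q' ≪≫ σ', τ, ?_⟩
    have h₁ := sqAct_naturality S' σ.hom
    simp only [Iso.trans_hom, Iso.symm_hom, whiskerRightIso_hom, comp_whiskerRight,
      Category.assoc, sqAct_vpaste] at e' ⊢
    rw [← cancel_mono (α_ v p p').inv]
    simp only [Category.assoc]
    rw [e', reassoc_of% h₁]
    simp only [← comp_whiskerRight, e]
    simp
  · intro T t t' σ τ e
    obtain ⟨ω₁, e₁, e₂⟩ := h'.exists_cell (t := t ≫ q) (t' := t' ≫ q)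
      ((α_ t q q').hom ≫ σ ≫ (α_ t' q q').inv)
      ((sqAct S t).hom ≫ τ ▷ p ≫ (sqAct S t').inv) (by
        simp only [sqAct_vpaste] at e
        rw [← cancel_epi ((α_ t q q').inv ▷ i₃), ← cancel_mono ((sqAct S t').hom ▷ p' ≫
          (α_ _ p p').hom)]
        simp only [Category.assoc, comp_whiskerRight, inv_hom_whiskerRight_assoc] at e ⊢
        rw [e]
        simp)
    obtain ⟨ω, e₃, e₄⟩ := h.exists_cell ω₁ τ (by rw [e₂]; simp)
    refine ⟨ω, ?_, e₄⟩
    rw [← cancel_mono (α_ t' q q').inv, ← cancel_epi (α_ t q q').hom, ← e₁, ← e₃]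
    simp
  · intro T t t' ω ω' h₁ h₂
    refine h.hom_ext (h'.hom_ext ?_ ?_) h₂
    · have : (α_ t q q').hom ≫ ω ▷ (q ≫ q') ≫ (α_ t' q q').inv =
        (α_ t q q').hom ≫ ω' ▷ (q ≫ q') ≫ (α_ t' q q').inv := by rw [h₁]
      simpa using this
    · rw [← cancel_mono (sqAct S t').hom, sqAct_naturality, sqAct_naturality, h₂]

theorem IsTwoCartesian.hpaste {X₁ X₂ X₃ Y₁ Y₂ Y₃ : C} {j : X₁ ⟶ X₂} {j' : X₂ ⟶ X₃} {i : Y₁ ⟶ Y₂}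
    {i' : Y₂ ⟶ Y₃} {p₁ : X₁ ⟶ Y₁} {p₂ : X₂ ⟶ Y₂} {p₃ : X₃ ⟶ Y₃}
    {S : p₁ ≫ i ≅ j ≫ p₂} {S' : p₂ ≫ i' ≅ j' ≫ p₃} (h : IsTwoCartesian S)
    (h' : IsTwoCartesian S') : IsTwoCartesian (hpaste S S') := by
  have := (h.symm.vpaste h'.symm).symm
  rwa [vpaste_symm] at this

/-- Cancellation. A cone over the upper cospan extends to one over the outer cospan and lifts there;
the universal property of the lower square then identifies the two morphisms to `X₂`. -/
theorem IsTwoCartesian.of_vpaste [IsLocallyGroupoid C] {X₁ X₂ X₃ Y₁ Y₂ Y₃ : C} {i₁ : X₁ ⟶ Y₁}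
    {i₂ : X₂ ⟶ Y₂}
    {i₃ : X₃ ⟶ Y₃} {q : X₁ ⟶ X₂} {q' : X₂ ⟶ X₃} {p : Y₁ ⟶ Y₂} {p' : Y₂ ⟶ Y₃}
    {S : q ≫ i₂ ≅ i₁ ≫ p} {S' : q' ≫ i₃ ≅ i₂ ≫ p'}
    (h' : IsTwoCartesian S') (h : IsTwoCartesian (GluingData.vpaste S S')) :
    IsTwoCartesian S := by
  refine .mk' ?_ ?_ ?_
  · intro T u v θ
    obtain ⟨t, σ, τ, e⟩ := h.exists_lift (u ≫ q') v (sqAct S' u ≪≫ whiskerRightIso θ p' ≪≫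
      α_ _ _ _)
    obtain ⟨ω, e₁, e₂⟩ := h'.exists_cell (t := t ≫ q) (t' := u) ((α_ t q q').hom ≫ σ.hom)
      ((sqAct S t).hom ≫ τ.hom ▷ p ≫ θ.inv) (by
        rw [← cancel_mono (θ.hom ▷ p' ≫ (α_ _ p p').hom), ← cancel_epi ((α_ t q q').inv ▷ i₃)]
        simp only [Iso.trans_hom, whiskerRightIso_hom, sqAct_vpaste] at e
        simp only [comp_whiskerRight, Category.assoc, inv_hom_whiskerRight_assoc, e]
        simp)
    -- The universal property only produces a 2-cell; it is invertible because all 2-cells of `C`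
    -- are.
    exact ⟨t, asIso ω, τ, by simp [e₂]⟩
  · intro T t t' σ τ e
    obtain ⟨ω, e₁, e₂⟩ := h.exists_cell (t := t) (t' := t')
      ((α_ t q q').inv ≫ σ ▷ q' ≫ (α_ t' q q').hom) τ (by
        have h₁ := sqAct_naturality S' σ
        simp only [sqAct_vpaste, comp_whiskerRight, Category.assoc,
          hom_inv_whiskerRight_assoc]
        rw [reassoc_of% h₁]
        simp only [← comp_whiskerRight_assoc, e]
        simp)
    refine ⟨ω, h'.hom_ext ?_ ?_, e₂⟩
    · rw [← cancel_mono (α_ t' q q').hom, ← cancel_epi (α_ t q q').inv, ← e₁]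
      simp
    · rw [← cancel_mono (sqAct S t').hom, sqAct_naturality, e, e₂]
  · intro T t t' ω ω' h₁ h₂
    refine h.hom_ext ?_ h₂
    simp [h₁]

/-- Invariance of 2-Cartesian squares under isomorphisms of their edges. -/
theorem IsTwoCartesian.of_iso {P Z Y W : C} {q q' : P ⟶ Z} {i i' : Z ⟶ W} {j j' : P ⟶ Y}
    {p p' : Y ⟶ W} {α : q ≫ i ≅ j ≫ p} {α' : q' ≫ i' ≅ j' ≫ p'} (h : IsTwoCartesian α)
    (κ : q ≅ q') (ι : i ≅ i') (β : j ≅ j') (π : p ≅ p')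
    (e : α.hom ≫ β.hom ▷ p ≫ j' ◁ π.hom = κ.hom ▷ i ≫ q' ◁ ι.hom ≫ α'.hom) :
    IsTwoCartesian α' := by
  -- The comparison of the two squares, evaluated at `t`; the remaining steps transport lifts along
  -- the isomorphisms of edges.
  have e' : ∀ {T : C} (t : T ⟶ P), (sqAct α t).hom ≫ (t ◁ β.hom) ▷ p ≫ (t ≫ j') ◁ π.hom =
      (t ◁ κ.hom) ▷ i ≫ (t ≫ q') ◁ ι.hom ≫ (sqAct α' t).hom := by
    intro T t
    have := congrArg (fun k => (α_ t q i).hom ≫ t ◁ k ≫ (α_ t j' p').inv) e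
    simpa [sqAct] using this
  refine .mk' ?_ ?_ ?_
  · intro T u v θ
    obtain ⟨t, σ, τ, h₁⟩ := h.exists_lift u v (whiskerLeftIso u ι ≪≫ θ ≪≫
      (whiskerLeftIso v π).symm)
    refine ⟨t, (whiskerLeftIso t κ).symm ≪≫ σ, (whiskerLeftIso t β).symm ≪≫ τ, ?_⟩
    rw [← cancel_epi ((t ◁ κ.hom) ▷ i ≫ (t ≫ q') ◁ ι.hom), Category.assoc, Category.assoc]
    rw [← reassoc_of% (e' t)]
    simp only [Iso.trans_hom, Iso.symm_hom, whiskerLeftIso_hom, whiskerLeftIso_inv,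
      comp_whiskerRight] at h₁ ⊢
    rw [← cancel_mono (v ◁ π.hom)] at h₁
    simp only [Category.assoc, whiskerLeft_inv_hom, Category.comp_id] at h₁
    rw [Category.assoc, whisker_exchange_assoc, ← comp_whiskerRight_assoc, whiskerLeft_hom_inv,
      id_whiskerRight, Category.id_comp, whisker_exchange_assoc, h₁, whisker_exchange_assoc,
      ← comp_whiskerRight_assoc (t ◁ β.hom), whiskerLeft_hom_inv, id_whiskerRight,
      Category.id_comp, whisker_exchange]
  · intro T t t' σ τ h₁
    obtain ⟨ω, h₂, h₃⟩ := h.exists_cell (t ◁ κ.hom ≫ σ ≫ t' ◁ κ.inv)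
      (t ◁ β.hom ≫ τ ≫ t' ◁ β.inv) (by
        rw [← cancel_mono ((t' ◁ β.hom) ▷ p ≫ (t' ≫ j') ◁ π.hom)]
        simp only [Category.assoc, comp_whiskerRight]
        rw [e']
        simp only [← comp_whiskerRight_assoc, whiskerLeft_inv_hom,
          Category.comp_id]
        simp only [comp_whiskerRight_assoc]
        rw [← whisker_exchange_assoc, h₁, ← reassoc_of% (e' t), ← whisker_exchange])
    refine ⟨ω, ?_, ?_⟩
    · rw [← cancel_epi (t ◁ κ.hom), whisker_exchange, h₂]
      simp
    · rw [← cancel_epi (t ◁ β.hom), whisker_exchange, h₃]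
      simp
  · intro T t t' ω ω' h₁ h₂
    refine h.hom_ext ?_ ?_
    · rw [← cancel_mono (t' ◁ κ.hom), ← whisker_exchange, ← whisker_exchange, h₁]
    · rw [← cancel_mono (t' ◁ β.hom), ← whisker_exchange, ← whisker_exchange, h₂]

/-- Fiber product along an identity: a cone is determined by its component `u`, which serves as its
own lift. -/
theorem isTwoCartesian_vId {X Y : C} {a b : X ⟶ Y} (σ : a ≅ b) :
    IsTwoCartesian (λ_ a ≪≫ σ ≪≫ (ρ_ b).symm) := by
  have e : ∀ {T : C} (t : T ⟶ X), (sqAct (λ_ a ≪≫ σ ≪≫ (ρ_ b).symm) t).hom =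
      (ρ_ t).hom ▷ a ≫ t ◁ σ.hom ≫ (ρ_ (t ≫ b)).inv := by
    intro T t
    simp [sqAct]
  refine .mk' ?_ ?_ ?_
  · intro T u v θ
    refine ⟨u, ρ_ u, (whiskerLeftIso u σ).symm ≪≫ θ ≪≫ ρ_ v, ?_⟩
    rw [e]
    simp
  · intro T t t' τ₁ τ h
    refine ⟨(ρ_ t).inv ≫ τ₁ ≫ (ρ_ t').hom, by simp, ?_⟩
    rw [e, e] at h
    have h' := congrArg (fun k => k ≫ (ρ_ _).hom) h
    simp only [Category.assoc, Iso.inv_hom_id, Iso.inv_hom_id_assoc, Category.comp_id,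
      whiskerRight_id] at h'
    rw [← cancel_epi ((ρ_ t).hom ▷ a ≫ t ◁ σ.hom)]
    simp only [Category.assoc, comp_whiskerRight]
    rw [← h', whisker_exchange_assoc, hom_inv_whiskerRight_assoc, whisker_exchange_assoc,
      whisker_exchange]
  · intro T t t' ω ω' h₁ h₂
    simpa using h₁

theorem isTwoCartesian_hId {X Y : C} {q p : X ⟶ Y} (σ : q ≅ p) :
    IsTwoCartesian (ρ_ q ≪≫ σ ≪≫ (λ_ p).symm) := by
  have := (isTwoCartesian_vId σ.symm).symm
  convert this using 1
  ext; simp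

theorem sqAct_id {Z Y W P : C} {q : P ⟶ Z} {i : Z ⟶ W} {j : P ⟶ Y}
    {p : Y ⟶ W} (α : q ≫ i ≅ j ≫ p) :
    (λ_ q).inv ▷ i ≫ (sqAct α (𝟙 P)).hom = α.hom ≫ (λ_ j).inv ▷ p := by
  simp [sqAct]

/-- A morphism of cones stays one after precomposition. This is what allows the composite of two
comparison morphisms to be compared with an identity. -/
theorem sqAct_comp {P P' Z Y W T : C} {q : P ⟶ Z}
    {q' : P' ⟶ Z} {i : Z ⟶ W} {j : P ⟶ Y} {j' : P' ⟶ Y}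
    {p : Y ⟶ W} {α : q ≫ i ≅ j ≫ p} {α' : q' ≫ i ≅ j' ≫ p} {t' : P' ⟶ P} {σ : t' ≫ q ⟶ q'}
    {τ : t' ≫ j ⟶ j'} (e : σ ▷ i ≫ α'.hom = (sqAct α t').hom ≫ τ ▷ p) (t : T ⟶ P') :
    (t ◁ σ) ▷ i ≫ (sqAct α' t).hom =
      (α_ t t' q).inv ▷ i ≫ (sqAct α (t ≫ t')).hom ≫ (α_ t t' j).hom ▷ p ≫ (t ◁ τ) ▷ p := by
  have := congrArg (fun k => (α_ t (t' ≫ q) i).hom ≫ t ◁ k ≫ (α_ t j' p).inv) e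
  simpa [sqAct] using this

/-- Two 2-Cartesian squares over the same cospan are equivalent. -/
theorem IsTwoCartesian.exists_equivalence [IsLocallyGroupoid C] {P P' Z Y W : C} {q : P ⟶ Z}
    {q' : P' ⟶ Z} {i : Z ⟶ W} {j : P ⟶ Y} {j' : P' ⟶ Y}
    {p : Y ⟶ W} {α : q ≫ i ≅ j ≫ p} {α' : q' ≫ i ≅ j' ≫ p} (h : IsTwoCartesian α)
    (h' : IsTwoCartesian α') : ∃ (e : Bicategory.Equivalence P P') (σ : e.hom ≫ q' ≅ q)
      (τ : e.hom ≫ j' ≅ j),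
      σ.hom ▷ i ≫ α.hom = (sqAct α' e.hom).hom ≫ τ.hom ▷ p := by
  obtain ⟨t, σ, τ, e⟩ := h'.exists_lift q j α
  obtain ⟨t', σ', τ', e'⟩ := h.exists_lift q' j' α'
  -- `t ≫ t'` and `𝟙 P` induce isomorphic cones over the cospan, so full faithfulness supplies a
  -- 2-cell between them; only its existence is needed, as it is automatically invertible.
  have h₁ : ∃ ω : t ≫ t' ⟶ 𝟙 P, True := by
    obtain ⟨ω, -⟩ := h.exists_cell (t := t ≫ t') (t' := 𝟙 P)
      ((α_ _ _ _).hom ≫ t ◁ σ'.hom ≫ σ.hom ≫ (λ_ q).inv)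
      ((α_ _ _ _).hom ≫ t ◁ τ'.hom ≫ τ.hom ≫ (λ_ j).inv) (by
        simp only [comp_whiskerRight, Category.assoc, sqAct_id]
        rw [reassoc_of% e, reassoc_of% (sqAct_comp e' t)]
        simp)
    exact ⟨ω, trivial⟩
  have h₂ : ∃ ω : t' ≫ t ⟶ 𝟙 P', True := by
    obtain ⟨ω, -⟩ := h'.exists_cell (t := t' ≫ t) (t' := 𝟙 P')
      ((α_ _ _ _).hom ≫ t' ◁ σ.hom ≫ σ'.hom ≫ (λ_ q').inv)
      ((α_ _ _ _).hom ≫ t' ◁ τ.hom ≫ τ'.hom ≫ (λ_ j').inv) (by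
        simp only [comp_whiskerRight, Category.assoc, sqAct_id]
        rw [reassoc_of% e', reassoc_of% (sqAct_comp e t')]
        simp)
    exact ⟨ω, trivial⟩
  obtain ⟨ω₁, -⟩ := h₁
  obtain ⟨ω₂, -⟩ := h₂
  exact ⟨Bicategory.Equivalence.mkOfAdjointifyCounit (asIso ω₁).symm (asIso ω₂), σ, τ, e⟩

end TwoCartesian

/-! ### Actions of arrowy 2-subcategories and gluing data between them -/

section Act

variable {C : Type u₁} [Bicategory.{w₁, v₁} C]

namespace ArrowySub

theorem Hom.eq_of_hom_eq {A : ArrowySub C} {X Y : C} {f g : A.Hom X Y} (h : f.hom = g.hom) :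
    f = g := by
  cases f; cases g; cases h; rfl

/-- The identities, in a form that unfolds reducibly. -/
abbrev Hom.one (A : ArrowySub C) (X : C) : A.Hom X X := ⟨𝟙 X, A.id_mem X⟩

/-- Composition, in a form that unfolds reducibly. -/
abbrev Hom.then {A : ArrowySub C} {X Y Z : C} (f : A.Hom X Y) (g : A.Hom Y Z) : A.Hom X Z :=
  ⟨f.hom ≫ g.hom, A.comp_mem f.mem g.mem⟩

end ArrowySub

namespace Square

variable {A B : ArrowySub C}

/-- Horizontal composition of squares. -/
abbrev hthen {X₁ X₂ X₃ Y₁ Y₂ Y₃ : C} {j : A.Hom X₁ X₂} {j' : A.Hom X₂ X₃} {i : A.Hom Y₁ Y₂}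
    {i' : A.Hom Y₂ Y₃} {p₁ : B.Hom X₁ Y₁} {p₂ : B.Hom X₂ Y₂} {p₃ : B.Hom X₃ Y₃}
    (S : Square j p₁ i p₂) (S' : Square j' p₂ i' p₃) : Square (j.then j') p₁ (i.then i') p₃ :=
  ⟨hpaste S.cell S'.cell⟩

/-- Vertical composition of squares. -/
abbrev vthen {X₁ X₂ X₃ Y₁ Y₂ Y₃ : C} {i₁ : A.Hom X₁ Y₁} {i₂ : A.Hom X₂ Y₂} {i₃ : A.Hom X₃ Y₃}
    {q : B.Hom X₁ X₂} {q' : B.Hom X₂ X₃} {p : B.Hom Y₁ Y₂} {p' : B.Hom Y₂ Y₃}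
    (S : Square i₁ q i₂ p) (S' : Square i₂ q' i₃ p') : Square i₁ (q.then q') i₃ (p.then p') :=
  ⟨vpaste S.cell S'.cell⟩

/-- The transposed square. -/
abbrev tr {X Y Z W : C} {b : A.Hom X Y} {q : B.Hom X Z} {a : A.Hom Z W} {p : B.Hom Y W}
    (S : Square b q a p) : Square q b p a :=
  ⟨S.cell.symm⟩

/-- The square with identities as vertical morphisms. -/
abbrev vOne (B : ArrowySub C) {X Y : C} {a b : A.Hom X Y} (σ : a.hom ≅ b.hom) :
    Square b (.one B X) a (.one B Y) :=
  ⟨λ_ a.hom ≪≫ σ ≪≫ (ρ_ b.hom).symm⟩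

/-- The square with identities as horizontal morphisms. -/
abbrev hOne (A : ArrowySub C) {X Y : C} {q p : B.Hom X Y} (σ : q.hom ≅ p.hom) :
    Square (.one A X) q (.one A Y) p :=
  ⟨ρ_ q.hom ≪≫ σ ≪≫ (λ_ p.hom).symm⟩

end Square

/-- A (pseudo-)action of the arrowy 2-subcategory `A` on a family of categories indexed by the
objects of `C`. -/
structure Act (A : ArrowySub C) (E : C → Type u₃) [∀ X, Category.{v₃} (E X)] where
  fn {X Y : C} (f : A.Hom X Y) : E X ⥤ E Y
  cell {X Y : C} {f g : A.Hom X Y} (η : f.hom ≅ g.hom) (x : E X) : (fn f).obj x ≅ (fn g).obj x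
  unit (X : C) (x : E X) : (fn (.one A X)).obj x ≅ x
  comp {X Y Z : C} (f : A.Hom X Y) (g : A.Hom Y Z) (x : E X) :
    (fn (f.then g)).obj x ≅ (fn g).obj ((fn f).obj x)
  cell_naturality {X Y : C} {f g : A.Hom X Y} (η : f.hom ≅ g.hom) {x y : E X} (u : x ⟶ y) :
    (fn f).map u ≫ (cell η y).hom = (cell η x).hom ≫ (fn g).map u
  unit_naturality {X : C} {x y : E X} (u : x ⟶ y) :
    (fn (.one A X)).map u ≫ (unit X y).hom = (unit X x).hom ≫ u
  comp_naturality {X Y Z : C} (f : A.Hom X Y) (g : A.Hom Y Z) {x y : E X} (u : x ⟶ y) :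
    (fn (f.then g)).map u ≫ (comp f g y).hom = (comp f g x).hom ≫ (fn g).map ((fn f).map u)
  cell_refl {X Y : C} (f : A.Hom X Y) (x : E X) : (cell (g := f) (Iso.refl f.hom) x).hom = 𝟙 _
  cell_trans {X Y : C} {f g h : A.Hom X Y} (η : f.hom ≅ g.hom) (θ : g.hom ≅ h.hom) (x : E X) :
    (cell (g := h) (η ≪≫ θ) x).hom = (cell (g := g) η x).hom ≫ (cell θ x).hom
  cell_whiskerLeft {X Y Z : C} (f : A.Hom X Y) {g h : A.Hom Y Z} (η : g.hom ≅ h.hom) (x : E X) :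
    (cell (f := f.then g) (g := f.then h) (whiskerLeftIso f.hom η) x).hom ≫ (comp f h x).hom =
      (comp f g x).hom ≫ (cell η ((fn f).obj x)).hom
  cell_whiskerRight {X Y Z : C} {f g : A.Hom X Y} (η : f.hom ≅ g.hom) (h : A.Hom Y Z) (x : E X) :
    (cell (f := f.then h) (g := g.then h) (whiskerRightIso η h.hom) x).hom ≫ (comp g h x).hom =
      (comp f h x).hom ≫ (fn h).map (cell η x).hom
  cell_associator {X Y Z W : C} (f : A.Hom X Y) (g : A.Hom Y Z) (h : A.Hom Z W) (x : E X) :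
    (cell (f := (f.then g).then h) (g := f.then (g.then h)) (α_ f.hom g.hom h.hom) x).hom ≫
        (comp f (g.then h) x).hom ≫ (comp g h _).hom =
      (comp (f.then g) h x).hom ≫ (fn h).map (comp f g x).hom
  cell_leftUnitor {X Y : C} (f : A.Hom X Y) (x : E X) :
    (cell (f := (ArrowySub.Hom.one A X).then f) (g := f) (λ_ f.hom) x).hom =
      (comp (.one A X) f x).hom ≫ (fn f).map (unit X x).hom
  cell_rightUnitor {X Y : C} (f : A.Hom X Y) (x : E X) :
    (cell (f := f.then (.one A Y)) (g := f) (ρ_ f.hom) x).hom =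
      (comp f (.one A Y) x).hom ≫ (unit Y _).hom

namespace Act

variable {A : ArrowySub C} {E : C → Type u₃} [∀ X, Category.{v₃} (E X)] (P : Act A E)

/-- A 2-cell with values in a composite, as a 2-cell of `A`. -/
abbrev toComp {X Y Z : C} {h : A.Hom X Z} {f : A.Hom X Y} {g : A.Hom Y Z}
    (γ : h.hom ≅ f.hom ≫ g.hom) : h.hom ≅ (f.then g).hom := γ

/-- For a 2-cell `γ : h ≅ f ≫ g`, the isomorphism between the actions of `h` and of `f`, `g`. -/
def split {X Y Z : C} {h : A.Hom X Z} {f : A.Hom X Y} {g : A.Hom Y Z}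
    (γ : h.hom ≅ f.hom ≫ g.hom) (x : E X) : (P.fn h).obj x ≅ (P.fn g).obj ((P.fn f).obj x) :=
  P.cell (toComp γ) x ≪≫ P.comp f g x

theorem split_naturality {X Y Z : C} {h : A.Hom X Z} {f : A.Hom X Y} {g : A.Hom Y Z}
    (γ : h.hom ≅ f.hom ≫ g.hom) {x y : E X} (u : x ⟶ y) :
    (P.fn h).map u ≫ (P.split γ y).hom = (P.split γ x).hom ≫ (P.fn g).map ((P.fn f).map u) := by
  simp only [split, Iso.trans_hom, Category.assoc]
  rw [← P.comp_naturality, reassoc_of% P.cell_naturality]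

theorem split_refl {X Y Z : C} (f : A.Hom X Y) (g : A.Hom Y Z) (x : E X) :
    (P.split (h := f.then g) (Iso.refl (f.hom ≫ g.hom)) x).hom = (P.comp f g x).hom := by
  have : (P.cell (toComp (h := f.then g) (Iso.refl (f.hom ≫ g.hom))) x).hom = 𝟙 _ :=
    P.cell_refl (f.then g) x
  simp only [split, Iso.trans_hom]
  rw [this, Category.id_comp]

/-- The resulting 2-cell is a variable `γ'` constrained by an equation, so that the lemma applies to
any expression for it. The same device is used in the lemmas below. -/
theorem split_map_cell {X Y Z : C} {h : A.Hom X Z} {f f' : A.Hom X Y} {g : A.Hom Y Z}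
    (γ : h.hom ≅ f.hom ≫ g.hom) (θ : f.hom ≅ f'.hom) {γ' : h.hom ≅ f'.hom ≫ g.hom}
    (e : γ.hom ≫ θ.hom ▷ g.hom = γ'.hom) (x : E X) :
    (P.split γ x).hom ≫ (P.fn g).map (P.cell θ x).hom = (P.split γ' x).hom := by
  obtain rfl : γ ≪≫ whiskerRightIso θ g.hom = γ' := Iso.ext e
  have : (P.cell (toComp (γ ≪≫ whiskerRightIso θ g.hom)) x).hom = _ :=
    P.cell_trans (g := f.then g) (h := f'.then g) (toComp γ) (whiskerRightIso θ g.hom) x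
  simp only [split, Iso.trans_hom, Category.assoc]
  rw [this, Category.assoc, P.cell_whiskerRight]

theorem split_cell {X Y Z : C} {h : A.Hom X Z} {f : A.Hom X Y} {g g' : A.Hom Y Z}
    (γ : h.hom ≅ f.hom ≫ g.hom) (θ : g.hom ≅ g'.hom) {γ' : h.hom ≅ f.hom ≫ g'.hom}
    (e : γ.hom ≫ f.hom ◁ θ.hom = γ'.hom) (x : E X) :
    (P.split γ x).hom ≫ (P.cell θ ((P.fn f).obj x)).hom = (P.split γ' x).hom := by
  obtain rfl : γ ≪≫ whiskerLeftIso f.hom θ = γ' := Iso.ext e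
  have : (P.cell (toComp (γ ≪≫ whiskerLeftIso f.hom θ)) x).hom = _ :=
    P.cell_trans (g := f.then g) (h := f.then g') (toComp γ) (whiskerLeftIso f.hom θ) x
  simp only [split, Iso.trans_hom, Category.assoc]
  rw [this, Category.assoc, P.cell_whiskerLeft]

/-- Associativity of the action, for a morphism factored into three: once the two 2-cells to the
triple composite agree, the claim reduces to `cell_associator`. -/
theorem split_split {X Y Z W : C} {h : A.Hom X W} {f : A.Hom X Z} {g : A.Hom Z W}
    {f₁ : A.Hom X Y} {f₂ : A.Hom Y Z} {k : A.Hom Y W} (γ : h.hom ≅ f.hom ≫ g.hom)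
    (γ' : f.hom ≅ f₁.hom ≫ f₂.hom) (σ : h.hom ≅ f₁.hom ≫ k.hom) (σ' : k.hom ≅ f₂.hom ≫ g.hom)
    (e : γ.hom ≫ γ'.hom ▷ g.hom ≫ (α_ _ _ _).hom = σ.hom ≫ f₁.hom ◁ σ'.hom) (x : E X) :
    (P.split γ x).hom ≫ (P.fn g).map (P.split γ' x).hom =
      (P.split σ x).hom ≫ (P.split σ' ((P.fn f₁).obj x)).hom := by
  have e₁ := P.split_map_cell (f' := f₁.then f₂) γ (toComp γ')
    (γ' := γ ≪≫ whiskerRightIso γ' g.hom) rfl x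
  have e₂ := P.split_cell (g' := f₂.then g) σ (toComp σ')
    (γ' := σ ≪≫ whiskerLeftIso f₁.hom σ') rfl x
  have e₃ : (P.cell (toComp (f := f₁) (g := f₂.then g) (σ ≪≫ whiskerLeftIso f₁.hom σ')) x).hom =
      (P.cell (toComp (f := f₁.then f₂) (g := g) (γ ≪≫ whiskerRightIso γ' g.hom)) x).hom ≫
        (P.cell (f := (f₁.then f₂).then g) (g := f₁.then (f₂.then g)) (α_ _ _ _) x).hom := by
    refine Eq.trans ?_ (P.cell_trans (g := (f₁.then f₂).then g) (h := f₁.then (f₂.then g)) _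
      (α_ f₁.hom f₂.hom g.hom) x)
    congr 2
    refine Iso.ext ?_
    change σ.hom ≫ f₁.hom ◁ σ'.hom = (γ.hom ≫ γ'.hom ▷ g.hom) ≫ (α_ f₁.hom f₂.hom g.hom).hom
    rw [Category.assoc, e]
  simp only [split, Iso.trans_hom, Functor.map_comp, Category.assoc] at e₁ e₂ ⊢
  rw [reassoc_of% e₁, reassoc_of% e₂, ← P.cell_associator, e₃, Category.assoc]

theorem split_map_unit {X Y : C} {h g : A.Hom X Y} (γ : h.hom ≅ 𝟙 X ≫ g.hom) {θ : h.hom ≅ g.hom}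
    (e : γ.hom ≫ (λ_ g.hom).hom = θ.hom) (x : E X) :
    (P.split (f := .one A X) γ x).hom ≫ (P.fn g).map (P.unit X x).hom = (P.cell θ x).hom := by
  obtain rfl : γ ≪≫ λ_ g.hom = θ := Iso.ext e
  have : (P.cell (γ ≪≫ λ_ g.hom) x).hom = _ :=
    P.cell_trans (g := (ArrowySub.Hom.one A X).then g) γ (λ_ g.hom) x
  rw [this, P.cell_leftUnitor]
  exact Category.assoc _ _ _

theorem split_unit {X Y : C} {h f : A.Hom X Y} (γ : h.hom ≅ f.hom ≫ 𝟙 Y) {θ : h.hom ≅ f.hom}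
    (e : γ.hom ≫ (ρ_ f.hom).hom = θ.hom) (x : E X) :
    (P.split (g := .one A Y) γ x).hom ≫ (P.unit Y _).hom = (P.cell θ x).hom := by
  obtain rfl : γ ≪≫ ρ_ f.hom = θ := Iso.ext e
  have : (P.cell (γ ≪≫ ρ_ f.hom) x).hom = _ :=
    P.cell_trans (g := f.then (.one A Y)) γ (ρ_ f.hom) x
  rw [this, P.cell_rightUnitor]
  exact Category.assoc _ _ _

theorem cell_of_eq {X Y : C} {f : A.Hom X Y} {θ : f.hom ≅ f.hom} (e : θ.hom = 𝟙 _) (x : E X) :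
    (P.cell θ x).hom = 𝟙 _ := by
  obtain rfl : θ = Iso.refl _ := Iso.ext e
  exact P.cell_refl f x

theorem cell_cell {X Y : C} {f g h : A.Hom X Y} (η : f.hom ≅ g.hom) (θ : g.hom ≅ h.hom)
    {ζ : f.hom ≅ h.hom} (e : η.hom ≫ θ.hom = ζ.hom) (x : E X) :
    (P.cell η x).hom ≫ (P.cell θ x).hom = (P.cell ζ x).hom := by
  obtain rfl : η ≪≫ θ = ζ := Iso.ext e
  exact (P.cell_trans η θ x).symm

end Act

/-- A class of squares containing the squares with a pair of identity edges and closed under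
pasting and under isomorphisms of the edges. -/
structure SquareClass (A B : ArrowySub C) where
  mem {X Y Z W : C} {b : A.Hom X Y} {q : B.Hom X Z} {a : A.Hom Z W} {p : B.Hom Y W} :
    Square b q a p → Prop
  vId_mem {X Y : C} {a b : A.Hom X Y} (σ : a.hom ≅ b.hom) : mem (Square.vOne B σ)
  hId_mem {X Y : C} {q p : B.Hom X Y} (σ : q.hom ≅ p.hom) : mem (Square.hOne A σ)
  vcomp_mem {X₁ X₂ X₃ Y₁ Y₂ Y₃ : C} {i₁ : A.Hom X₁ Y₁} {i₂ : A.Hom X₂ Y₂} {i₃ : A.Hom X₃ Y₃}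
    {q : B.Hom X₁ X₂} {q' : B.Hom X₂ X₃} {p : B.Hom Y₁ Y₂} {p' : B.Hom Y₂ Y₃}
    {S : Square i₁ q i₂ p} {S' : Square i₂ q' i₃ p'} (h : mem S) (h' : mem S') : mem (S.vthen S')
  hcomp_mem {X₁ X₂ X₃ Y₁ Y₂ Y₃ : C} {j : A.Hom X₁ X₂} {j' : A.Hom X₂ X₃} {i : A.Hom Y₁ Y₂}
    {i' : A.Hom Y₂ Y₃} {p₁ : B.Hom X₁ Y₁} {p₂ : B.Hom X₂ Y₂} {p₃ : B.Hom X₃ Y₃}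
    {S : Square j p₁ i p₂} {S' : Square j' p₂ i' p₃} (h : mem S) (h' : mem S') : mem (S.hthen S')
  iso_mem {X Y Z W : C} {b b' : A.Hom X Y} {q q' : B.Hom X Z} {a a' : A.Hom Z W} {p p' : B.Hom Y W}
    {S : Square b q a p} {S' : Square b' q' a' p'} (h : mem S) (κ : q.hom ≅ q'.hom)
    (ι : a.hom ≅ a'.hom) (β : b.hom ≅ b'.hom) (π : p.hom ≅ p'.hom)
    (e : S.cell.hom ≫ β.hom ▷ p.hom ≫ b'.hom ◁ π.hom =
      κ.hom ▷ a.hom ≫ q'.hom ◁ ι.hom ≫ S'.cell.hom) : mem S'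

namespace Square

variable {A B : ArrowySub C}

theorem eq_of_cell {X Y Z W : C} {b : A.Hom X Y} {q : B.Hom X Z} {a : A.Hom Z W} {p : B.Hom Y W}
    {S S' : Square b q a p} (h : S.cell.hom = S'.cell.hom) : S = S' := by
  cases S; cases S'; exact congrArg _ (Iso.ext h)

theorem tr_vthen {X₁ X₂ X₃ Y₁ Y₂ Y₃ : C} {i₁ : A.Hom X₁ Y₁} {i₂ : A.Hom X₂ Y₂}
    {i₃ : A.Hom X₃ Y₃} {q : B.Hom X₁ X₂} {q' : B.Hom X₂ X₃} {p : B.Hom Y₁ Y₂} {p' : B.Hom Y₂ Y₃}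
    (S : Square i₁ q i₂ p) (S' : Square i₂ q' i₃ p') :
    (S.vthen S').tr = S.tr.hthen S'.tr :=
  congrArg Square.mk (vpaste_symm _ _)

theorem tr_hthen {X₁ X₂ X₃ Y₁ Y₂ Y₃ : C} {j : A.Hom X₁ X₂} {j' : A.Hom X₂ X₃}
    {i : A.Hom Y₁ Y₂} {i' : A.Hom Y₂ Y₃} {p₁ : B.Hom X₁ Y₁} {p₂ : B.Hom X₂ Y₂} {p₃ : B.Hom X₃ Y₃}
    (S : Square j p₁ i p₂) (S' : Square j' p₂ i' p₃) :
    (S.hthen S').tr = S.tr.vthen S'.tr :=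
  congrArg Square.mk (hpaste_symm _ _)

theorem tr_vOne {X Y : C} {a b : A.Hom X Y} (σ : a.hom ≅ b.hom) :
    (vOne B σ).tr = hOne B σ.symm :=
  congrArg Square.mk (show (λ_ a.hom ≪≫ σ ≪≫ (ρ_ b.hom).symm).symm =
    ρ_ b.hom ≪≫ σ.symm ≪≫ (λ_ a.hom).symm by ext; simp)

theorem tr_hOne {X Y : C} {a b : B.Hom X Y} (σ : a.hom ≅ b.hom) :
    (hOne A σ).tr = vOne A σ.symm :=
  congrArg Square.mk (show (ρ_ a.hom ≪≫ σ ≪≫ (λ_ b.hom).symm).symm =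
    λ_ b.hom ≪≫ σ.symm ≪≫ (ρ_ a.hom).symm by ext; simp)

end Square

/-- The class of transposed squares. -/
@[reducible]
def SquareClass.transpose {A B : ArrowySub C} (𝒢 : SquareClass A B) : SquareClass B A where
  mem S := 𝒢.mem S.tr
  vId_mem σ := by rw [Square.tr_vOne]; exact 𝒢.hId_mem _
  hId_mem σ := by rw [Square.tr_hOne]; exact 𝒢.vId_mem _
  vcomp_mem h h' := by rw [Square.tr_vthen]; exact 𝒢.hcomp_mem h h'
  hcomp_mem h h' := by rw [Square.tr_hthen]; exact 𝒢.vcomp_mem h h'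
  iso_mem {_ _ _ _ _ _ _ _ _ _ _ _ S S'} h κ ι β π e := 𝒢.iso_mem h β π κ ι (by
    rw [← cancel_epi S.cell.hom, ← cancel_mono S'.cell.hom] at *
    simpa [Square.tr] using e.symm)

/-- The class of all squares. -/
def SquareClass.all (A B : ArrowySub C) : SquareClass A B where
  mem _ := True
  vId_mem _ := trivial
  hId_mem _ := trivial
  vcomp_mem _ _ := trivial
  hcomp_mem _ _ := trivial
  iso_mem _ _ _ _ _ _ := trivial

/-- The class of 2-Cartesian squares. -/
def SquareClass.cart (A B : ArrowySub C) : SquareClass A B where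
  mem S := S.IsCart
  vId_mem σ := isTwoCartesian_vId σ
  hId_mem σ := isTwoCartesian_hId σ
  vcomp_mem h h' := h.vpaste h'
  hcomp_mem h h' := h.hpaste h'
  iso_mem h κ ι β π e := h.of_iso κ ι β π e

/-- Gluing data for a pair of actions and the squares of the class `𝒢`. -/
structure SqGluing {A B : ArrowySub C} {E : C → Type u₃} [∀ X, Category.{v₃} (E X)] (P : Act A E)
    (Q : Act B E) (𝒢 : SquareClass A B) where
  G {X Y Z W : C} {b : A.Hom X Y} {q : B.Hom X Z} {a : A.Hom Z W} {p : B.Hom Y W}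
    (S : Square b q a p) (h : 𝒢.mem S) (x : E X) :
    (P.fn a).obj ((Q.fn q).obj x) ≅ (Q.fn p).obj ((P.fn b).obj x)
  naturality {X Y Z W : C} {b : A.Hom X Y} {q : B.Hom X Z} {a : A.Hom Z W} {p : B.Hom Y W}
    (S : Square b q a p) (h : 𝒢.mem S) {x y : E X} (u : x ⟶ y) :
    (P.fn a).map ((Q.fn q).map u) ≫ (G S h y).hom = (G S h x).hom ≫ (Q.fn p).map ((P.fn b).map u)
  vId {X Y : C} {a b : A.Hom X Y} (σ : a.hom ≅ b.hom) (h : 𝒢.mem (Square.vOne B σ)) (x : E X) :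
    (G (Square.vOne B σ) h x).hom ≫ (Q.unit Y _).hom =
      (P.fn a).map (Q.unit X x).hom ≫ (P.cell σ x).hom
  hId {X Y : C} {q p : B.Hom X Y} (σ : q.hom ≅ p.hom) (h : 𝒢.mem (Square.hOne A σ)) (x : E X) :
    (G (Square.hOne A σ) h x).hom ≫ (Q.fn p).map (P.unit X x).hom =
      (P.unit Y _).hom ≫ (Q.cell σ x).hom
  vcomp {X₁ X₂ X₃ Y₁ Y₂ Y₃ : C} {i₁ : A.Hom X₁ Y₁} {i₂ : A.Hom X₂ Y₂} {i₃ : A.Hom X₃ Y₃}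
    {q : B.Hom X₁ X₂} {q' : B.Hom X₂ X₃} {p : B.Hom Y₁ Y₂} {p' : B.Hom Y₂ Y₃}
    (S : Square i₁ q i₂ p) (S' : Square i₂ q' i₃ p') (h : 𝒢.mem S) (h' : 𝒢.mem S')
    (h'' : 𝒢.mem (S.vthen S')) (x : E X₁) :
    (G (S.vthen S') h'' x).hom ≫ (Q.comp p p' _).hom =
      (P.fn i₃).map (Q.comp q q' x).hom ≫ (G S' h' _).hom ≫ (Q.fn p').map (G S h x).hom
  hcomp {X₁ X₂ X₃ Y₁ Y₂ Y₃ : C} {j : A.Hom X₁ X₂} {j' : A.Hom X₂ X₃} {i : A.Hom Y₁ Y₂}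
    {i' : A.Hom Y₂ Y₃} {p₁ : B.Hom X₁ Y₁} {p₂ : B.Hom X₂ Y₂} {p₃ : B.Hom X₃ Y₃}
    (S : Square j p₁ i p₂) (S' : Square j' p₂ i' p₃) (h : 𝒢.mem S) (h' : 𝒢.mem S')
    (h'' : 𝒢.mem (S.hthen S')) (x : E X₁) :
    (G (S.hthen S') h'' x).hom ≫ (Q.fn p₃).map (P.comp j j' x).hom =
      (P.comp i i' _).hom ≫ (P.fn i').map (G S h x).hom ≫ (G S' h' _).hom

namespace SqGluing

variable {A B : ArrowySub C} {E : C → Type u₃} [∀ X, Category.{v₃} (E X)] {P : Act A E}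
    {Q : Act B E} {𝒢 : SquareClass A B}

theorem naturality_inv (Γ : SqGluing P Q 𝒢) {X Y Z W : C} {b : A.Hom X Y} {q : B.Hom X Z}
    {a : A.Hom Z W} {p : B.Hom Y W}
    (S : Square b q a p) (h : 𝒢.mem S) {x y : E X} (u : x ⟶ y) :
    (Q.fn p).map ((P.fn b).map u) ≫ (Γ.G S h y).inv =
      (Γ.G S h x).inv ≫ (P.fn a).map ((Q.fn q).map u) := by
  rw [Iso.comp_inv_eq, Category.assoc, Γ.naturality, Iso.inv_hom_id_assoc]

/-- The transposed gluing data. -/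
def transpose (Γ : SqGluing P Q 𝒢) : SqGluing Q P 𝒢.transpose where
  G S h x := (Γ.G S.tr h x).symm
  naturality S h x y u := Γ.naturality_inv S.tr h u
  vId {X Y a b} σ h x := by
    have e := Γ.hId (A := A) σ.symm (𝒢.hId_mem _) x
    simp only [Square.tr_vOne, Iso.symm_hom]
    rw [Iso.inv_comp_eq, reassoc_of% e, Q.cell_cell σ.symm σ (ζ := Iso.refl _) (by simp),
      Q.cell_refl, Category.comp_id]
  hId {X Y q p} σ h x := by
    have e := Γ.vId (B := B) σ.symm (𝒢.vId_mem _) x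
    simp only [Square.tr_hOne, Iso.symm_hom]
    rw [Iso.inv_comp_eq, reassoc_of% e, P.cell_cell σ.symm σ (ζ := Iso.refl _) (by simp),
      P.cell_refl, Category.comp_id]
  vcomp S S' h h' h'' x := by
    have e := Γ.hcomp S.tr S'.tr h h' (𝒢.hcomp_mem h h') x
    simp only [Square.tr_vthen, Iso.symm_hom]
    rw [Iso.inv_comp_eq, reassoc_of% e]
    simp only [← Functor.map_comp, Iso.hom_inv_id_assoc, Iso.hom_inv_id,
      CategoryTheory.Functor.map_id, Category.comp_id]
  hcomp S S' h h' h'' x := by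
    have e := Γ.vcomp S.tr S'.tr h h' (𝒢.vcomp_mem h h') x
    simp only [Square.tr_hthen, Iso.symm_hom]
    rw [Iso.inv_comp_eq, reassoc_of% e]
    simp only [← Functor.map_comp_assoc, Iso.hom_inv_id, CategoryTheory.Functor.map_id,
      Category.comp_id, Category.id_comp]

/-- The 2-cells come from equalities of edges; after substituting these, the two squares coincide
and the 2-cells are identities. -/
theorem G_cast (Γ : SqGluing P Q 𝒢) {X Y Z W : C} {b b' : A.Hom X Y} {q : B.Hom X Z}
    {a a' : A.Hom Z W} {p : B.Hom Y W} {S : Square b q a p} {S' : Square b' q a' p}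
    (h : 𝒢.mem S) (h' : 𝒢.mem S') {β : b.hom ≅ b'.hom} {α : a.hom ≅ a'.hom}
    (hβ : ∃ h, β = eqToIso h) (hα : ∃ h, α = eqToIso h)
    (e : S.cell.hom ≫ β.hom ▷ p.hom = q.hom ◁ α.hom ≫ S'.cell.hom) (x : E X) :
    (Γ.G S h x).hom ≫ (Q.fn p).map (P.cell β x).hom =
      (P.cell α _).hom ≫ (Γ.G S' h' x).hom := by
  obtain ⟨hb, rfl⟩ := hβ
  obtain ⟨ha, rfl⟩ := hα
  obtain rfl := ArrowySub.Hom.eq_of_hom_eq hb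
  obtain rfl := ArrowySub.Hom.eq_of_hom_eq ha
  obtain rfl : S = S' := Square.eq_of_cell (by simpa using e)
  rw [P.cell_of_eq (by simp), P.cell_of_eq (by simp)]
  simp

/-- `S` is the horizontal composite of the square of `κ` with `S'`, except that the horizontal edges
acquire an identity factor. Strictness of `C` makes the unitors equalities, so that `G_cast` removes
this factor. -/
theorem G_congr_left [Strict C] (Γ : SqGluing P Q 𝒢) {X Y Z W : C} {b : A.Hom X Y}
    {q q' : B.Hom X Z} {a : A.Hom Z W} {p : B.Hom Y W} {S : Square b q a p} {S' : Square b q' a p}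
    (h : 𝒢.mem S) (h' : 𝒢.mem S') (κ : q.hom ≅ q'.hom)
    (e : S.cell.hom = κ.hom ▷ a.hom ≫ S'.cell.hom) (x : E X) :
    (Γ.G S h x).hom = (P.fn a).map (Q.cell κ x).hom ≫ (Γ.G S' h' x).hom := by
  have e₁ := Γ.G_cast (𝒢.hcomp_mem (𝒢.hId_mem κ) h') h (β := λ_ b.hom) (α := λ_ a.hom)
    ⟨_, Strict.leftUnitor_eqToIso _⟩ ⟨_, Strict.leftUnitor_eqToIso _⟩ (by
      rw [e]; simp [hpaste]) x
  have e₂ := Γ.hcomp (Square.hOne A κ) S' (𝒢.hId_mem κ) h' (𝒢.hcomp_mem (𝒢.hId_mem κ) h') x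
  have e₃ := Γ.hId κ (𝒢.hId_mem κ) x
  rw [P.cell_leftUnitor, P.cell_leftUnitor, Functor.map_comp, reassoc_of% e₂,
    ← Γ.naturality, ← Functor.map_comp_assoc, e₃] at e₁
  rw [← cancel_epi ((P.fn a).map (P.unit Z ((Q.fn q).obj x)).hom)]
  simpa using e₁.symm

theorem G_congr_right [Strict C] (Γ : SqGluing P Q 𝒢) {X Y Z W : C} {b : A.Hom X Y}
    {q : B.Hom X Z} {a : A.Hom Z W} {p p' : B.Hom Y W} {S : Square b q a p} {S' : Square b q a p'}
    (h : 𝒢.mem S) (h' : 𝒢.mem S') (π : p.hom ≅ p'.hom)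
    (e : S.cell.hom ≫ b.hom ◁ π.hom = S'.cell.hom) (x : E X) :
    (Γ.G S h x).hom ≫ (Q.cell π _).hom = (Γ.G S' h' x).hom := by
  have e₁ := Γ.G_cast (𝒢.hcomp_mem h (𝒢.hId_mem π)) h' (β := ρ_ b.hom) (α := ρ_ a.hom)
    ⟨_, Strict.rightUnitor_eqToIso _⟩ ⟨_, Strict.rightUnitor_eqToIso _⟩ (by
      rw [← e]; simp [hpaste]) x
  have e₂ := Γ.hcomp S (Square.hOne A π) h (𝒢.hId_mem π) (𝒢.hcomp_mem h (𝒢.hId_mem π)) x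
  have e₃ := Γ.hId π (𝒢.hId_mem π) ((P.fn b).obj x)
  rw [P.cell_rightUnitor, P.cell_rightUnitor, Functor.map_comp, reassoc_of% e₂, e₃,
    reassoc_of% P.unit_naturality] at e₁
  simpa using e₁

end SqGluing

end Act

/-! ### Gluing data together with identifications of the two actions on the intersection -/

section MeetGluing

variable {C : Type u₁} [Bicategory.{w₁, v₁} C] {A B : ArrowySub C}
  {E : C → Type u₃} [∀ X, Category.{v₃} (E X)] {P : Act A E} {Q : Act B E} {𝒢 : SquareClass A B}

namespace SqGluing

section

variable [Strict C] (Γ : SqGluing P Q 𝒢)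

/-- The axiom concerns squares whose vertical edges are composites on the nose; here they are only
isomorphic to composites, which is the form in which decompositions provide them. -/
theorem vcomp' {X₁ X₂ X₃ Y₁ Y₂ Y₃ : C} {i₁ : A.Hom X₁ Y₁} {i₂ : A.Hom X₂ Y₂}
    {i₃ : A.Hom X₃ Y₃} {q : B.Hom X₁ X₂} {q' : B.Hom X₂ X₃} {p : B.Hom Y₁ Y₂} {p' : B.Hom Y₂ Y₃}
    {r : B.Hom X₁ X₃} {s : B.Hom Y₁ Y₃}
    {S : Square i₁ q i₂ p} {S' : Square i₂ q' i₃ p'} {T : Square i₁ r i₃ s} (h : 𝒢.mem S)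
    (h' : 𝒢.mem S') (hT : 𝒢.mem T) (γ : r.hom ≅ q.hom ≫ q'.hom) (δ : s.hom ≅ p.hom ≫ p'.hom)
    (e : T.cell.hom ≫ i₁.hom ◁ δ.hom = γ.hom ▷ i₃.hom ≫ (vpaste S.cell S'.cell).hom) (x : E X₁) :
    (Γ.G T hT x).hom ≫ (Q.split δ _).hom =
      (P.fn i₃).map (Q.split γ x).hom ≫ (Γ.G S' h' _).hom ≫ (Q.fn p').map (Γ.G S h x).hom := by
  -- Intermediate square: the left edge is already the composite and the right edge is still `s`, so
  -- that one edge is changed at a time.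
  let T₁ : Square i₁ (q.then q') i₃ s := ⟨whiskerRightIso γ.symm i₃.hom ≪≫ T.cell⟩
  have c₁ : T₁.cell.hom ≫ i₁.hom ◁ δ.hom = (vpaste S.cell S'.cell).hom := by
    simp [T₁, e]
  have c₂ : T.cell.hom = γ.hom ▷ i₃.hom ≫ T₁.cell.hom := by
    simp [T₁]
  have h₁ : 𝒢.mem T₁ := by
    refine 𝒢.iso_mem (𝒢.vcomp_mem h h') (Iso.refl _) (Iso.refl _) (Iso.refl _)
      (Act.toComp δ).symm ?_
    simp [← c₁]
  have e₁ := Γ.G_congr_left hT h₁ (Act.toComp γ) c₂ x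
  have e₂ := Γ.G_congr_right h₁ (𝒢.vcomp_mem h h') (Act.toComp δ) c₁ x
  have e₃ := Γ.vcomp S S' h h' (𝒢.vcomp_mem h h') x
  simp only [Act.split, Iso.trans_hom, Functor.map_comp, Category.assoc]
  rw [← e₃, ← e₂, e₁]
  simp

theorem hcomp' {X₁ X₂ X₃ Y₁ Y₂ Y₃ : C} {j : A.Hom X₁ X₂} {j' : A.Hom X₂ X₃}
    {i : A.Hom Y₁ Y₂} {i' : A.Hom Y₂ Y₃} {p₁ : B.Hom X₁ Y₁} {p₂ : B.Hom X₂ Y₂} {p₃ : B.Hom X₃ Y₃}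
    {k : A.Hom X₁ X₃} {l : A.Hom Y₁ Y₃}
    {S : Square j p₁ i p₂} {S' : Square j' p₂ i' p₃} {T : Square k p₁ l p₃} (h : 𝒢.mem S)
    (h' : 𝒢.mem S') (hT : 𝒢.mem T) (γ : k.hom ≅ j.hom ≫ j'.hom) (δ : l.hom ≅ i.hom ≫ i'.hom)
    (e : T.cell.hom ≫ γ.hom ▷ p₃.hom = p₁.hom ◁ δ.hom ≫ (hpaste S.cell S'.cell).hom) (x : E X₁) :
    (Γ.G T hT x).hom ≫ (Q.fn p₃).map (P.split γ x).hom =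
      (P.split δ _).hom ≫ (P.fn i').map (Γ.G S h x).hom ≫ (Γ.G S' h' _).hom := by
  have := Γ.transpose.vcomp' (S := S.tr) (S' := S'.tr) (T := T.tr) h h' hT
    γ δ (by
      change T.cell.inv ≫ _ = _ ≫ (vpaste S.cell.symm S'.cell.symm).hom
      rw [← hpaste_symm, Iso.inv_comp_eq, Iso.symm_hom, reassoc_of% e]
      simp) x
  change (Γ.G T hT x).inv ≫ _ = _ ≫ (Γ.G S' h' _).inv ≫ (P.fn i').map (Γ.G S h x).inv at this
  rw [Iso.inv_comp_eq] at this
  rw [reassoc_of% this]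
  simp only [← Functor.map_comp_assoc, Iso.inv_hom_id,
    CategoryTheory.Functor.map_id, Category.id_comp, Category.comp_id]

theorem G_congr_top {X Y Z W : C} {b b' : A.Hom X Y}
    {q : B.Hom X Z} {a : A.Hom Z W} {p : B.Hom Y W} {S : Square b q a p} {S' : Square b' q a p}
    (h : 𝒢.mem S) (h' : 𝒢.mem S') (β : b.hom ≅ b'.hom)
    (e : S.cell.hom ≫ β.hom ▷ p.hom = S'.cell.hom) (x : E X) :
    (Γ.G S h x).hom ≫ (Q.fn p).map (P.cell β x).hom = (Γ.G S' h' x).hom := by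
  have := Γ.transpose.G_congr_left (S := S.tr) (S' := S'.tr) h h' β (by
    change S.cell.inv = _ ≫ S'.cell.inv
    rw [Iso.eq_comp_inv, Iso.inv_comp_eq, e]) x
  change (Γ.G S h x).inv = _ ≫ (Γ.G S' h' x).inv at this
  rw [Iso.eq_comp_inv, Iso.inv_comp_eq] at this
  exact this.symm

end

end SqGluing

/-- Gluing data for a pair of actions of `A`, `B` on the squares of the class `𝒢`, together with a
compatible identification of the two actions of the morphisms in `A ∩ B`. -/
structure MeetGluing (P : Act A E) (Q : Act B E) (𝒢 : SquareClass A B) extends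
    SqGluing P Q 𝒢 where
  ρ {X Y : C} (f : X ⟶ Y) (hA : A.mem f) (hB : B.mem f) (x : E X) :
    (Q.fn ⟨f, hB⟩).obj x ≅ (P.fn ⟨f, hA⟩).obj x
  ρ_naturality {X Y : C} (f : X ⟶ Y) (hA : A.mem f) (hB : B.mem f) {x y : E X} (u : x ⟶ y) :
    (Q.fn ⟨f, hB⟩).map u ≫ (ρ f hA hB y).hom = (ρ f hA hB x).hom ≫ (P.fn ⟨f, hA⟩).map u
  ρ_cell {X Y : C} {f g : X ⟶ Y} (hA : A.mem f) (hB : B.mem f) (hA' : A.mem g) (hB' : B.mem g)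
    (η : f ≅ g) (x : E X) :
    (Q.cell (f := ⟨f, hB⟩) (g := ⟨g, hB'⟩) η x).hom ≫ (ρ g hA' hB' x).hom =
      (ρ f hA hB x).hom ≫ (P.cell (f := ⟨f, hA⟩) (g := ⟨g, hA'⟩) η x).hom
  ρ_unit (X : C) (x : E X) :
    (ρ (𝟙 X) (A.id_mem X) (B.id_mem X) x).hom ≫ (P.unit X x).hom = (Q.unit X x).hom
  ρ_comp {X Y Z : C} {f : X ⟶ Y} (hA : A.mem f) (hB : B.mem f)
    {g : Y ⟶ Z} (hA' : A.mem g) (hB' : B.mem g) (x : E X) :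
    (ρ (f ≫ g) (A.comp_mem hA hA') (B.comp_mem hB hB') x).hom ≫
        (P.comp ⟨f, hA⟩ ⟨g, hA'⟩ x).hom =
      (Q.comp ⟨f, hB⟩ ⟨g, hB'⟩ x).hom ≫ (Q.fn ⟨g, hB'⟩).map (ρ f hA hB x).hom ≫
        (ρ g hA' hB' _).hom
  vMeet {X Y Z W : C} {b : A.Hom X Y} {q : X ⟶ Z} (hq : A.mem q) (hq' : B.mem q) {a : A.Hom Z W}
    {p : Y ⟶ W} (hp : A.mem p) (hp' : B.mem p) (S : Square b ⟨q, hq'⟩ a ⟨p, hp'⟩) (h : 𝒢.mem S)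
    {m : A.Hom X W} (μ : m.hom ≅ q ≫ a.hom) (ν : m.hom ≅ b.hom ≫ p)
    (e : ν.hom = μ.hom ≫ S.cell.hom) (x : E X) :
    (G S h x).hom ≫ (ρ p hp hp' _).hom =
      (P.fn a).map (ρ q hq hq' x).hom ≫ (P.split (f := ⟨q, hq⟩) μ x).inv ≫
        (P.split (g := ⟨p, hp⟩) ν x).hom
  hMeet {X Y Z W : C} {b : X ⟶ Y} (hb : A.mem b) (hb' : B.mem b) {q : B.Hom X Z} {a : Z ⟶ W}
    (ha : A.mem a) (ha' : B.mem a) {p : B.Hom Y W} (S : Square ⟨b, hb⟩ q ⟨a, ha⟩ p)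
    (h : 𝒢.mem S) {m : B.Hom X W}
    (μ : m.hom ≅ q.hom ≫ a) (ν : m.hom ≅ b ≫ p.hom)
    (e : ν.hom = μ.hom ≫ S.cell.hom) (x : E X) :
    (ρ a ha ha' _).hom ≫ (G S h x).hom =
      (Q.split (g := ⟨a, ha'⟩) μ x).inv ≫ (Q.split (f := ⟨b, hb'⟩) ν x).hom ≫
        (Q.fn p).map (ρ b hb hb' x).hom

namespace MeetGluing

theorem ρ_split (Γ : MeetGluing P Q 𝒢) {X Y Z : C} {f : X ⟶ Y} {g : Y ⟶ Z} {h : X ⟶ Z}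
    (hf : A.mem f) (hf' : B.mem f) (hg : A.mem g) (hg' : B.mem g) (hh : A.mem h) (hh' : B.mem h)
    (γ : h ≅ f ≫ g) (x : E X) :
    (Γ.ρ h hh hh' x).hom ≫ (P.split (h := ⟨h, hh⟩) (f := ⟨f, hf⟩) (g := ⟨g, hg⟩) γ x).hom =
      (Q.split (h := ⟨h, hh'⟩) (f := ⟨f, hf'⟩) (g := ⟨g, hg'⟩) γ x).hom ≫
        (Q.fn ⟨g, hg'⟩).map (Γ.ρ f hf hf' x).hom ≫ (Γ.ρ g hg hg' _).hom := by
  simp only [Act.split, Iso.trans_hom, Category.assoc]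
  rw [← Γ.ρ_comp, ← reassoc_of% (Γ.ρ_cell hh hh' (A.comp_mem hf hg) (B.comp_mem hf' hg') γ x)]

theorem ρ_naturality_inv (Γ : MeetGluing P Q 𝒢) {X Y : C} (f : X ⟶ Y) (hA : A.mem f)
    (hB : B.mem f) {x y : E X} (u : x ⟶ y) :
    (P.fn ⟨f, hA⟩).map u ≫ (Γ.ρ f hA hB y).inv = (Γ.ρ f hA hB x).inv ≫ (Q.fn ⟨f, hB⟩).map u := by
  rw [Iso.comp_inv_eq, Category.assoc, Γ.ρ_naturality, Iso.inv_hom_id_assoc]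

/-- The transposed data. -/
def transpose (Γ : MeetGluing P Q 𝒢) : MeetGluing Q P 𝒢.transpose where
  toSqGluing := Γ.toSqGluing.transpose
  ρ f hA hB x := (Γ.ρ f hB hA x).symm
  ρ_naturality f hA hB x y u := Γ.ρ_naturality_inv f hB hA u
  ρ_cell {X Y f g} hA hB hA' hB' η x := by
    simp only [Iso.symm_hom]
    rw [Iso.comp_inv_eq, Category.assoc, Iso.eq_inv_comp, Γ.ρ_cell]
  ρ_unit X x := by
    simp only [Iso.symm_hom]
    rw [Iso.inv_comp_eq, Γ.ρ_unit]
  ρ_comp {X Y Z f} hA hB {g} hA' hB' x := by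
    simp only [Iso.symm_hom]
    rw [Iso.inv_comp_eq, reassoc_of% (Γ.ρ_comp hB hA hB' hA' x), ← reassoc_of% Γ.ρ_naturality]
    simp [← Functor.map_comp]
  vMeet {X Y Z W b q} hq hq' {a p} hp hp' S h {m} μ ν e x := by
    have := Γ.hMeet hq' hq hp' hp S.tr h ν μ (by simp [e]) x
    change (Γ.G S.tr h x).inv ≫ (Γ.ρ p hp' hp _).inv = (Q.fn a).map (Γ.ρ q hq' hq x).inv ≫ _
    rw [Iso.inv_comp_eq, ← cancel_epi (Γ.ρ p hp' hp _).hom, reassoc_of% this, Iso.hom_inv_id]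
    simp [← Functor.map_comp_assoc]
  hMeet {X Y Z W b} hb hb' {q a} ha ha' {p} S h {m} μ ν e x := by
    have := Γ.vMeet hb' hb ha' ha S.tr h ν μ (by simp [e]) x
    change (Γ.ρ a ha' ha _).inv ≫ (Γ.G S.tr h x).inv = _ ≫ _ ≫ (P.fn p).map (Γ.ρ b hb' hb x).inv
    rw [Iso.inv_comp_eq, ← cancel_epi (Γ.G S.tr h x).hom, reassoc_of% this, Iso.hom_inv_id]
    simp [← Functor.map_comp]

variable [Strict C] (Γ : MeetGluing P Q 𝒢)

/-- The formula that governs the whole proof. `S` is the vertical composite of `R` and `S'`, and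
since the vertical edges of `R` are `f` and an identity, both in `A ∩ B`, axiom `vMeet` computes its
value from `ρ f`. The only condition is that `R` belongs to the class: automatic for the class of
all squares, and true for 2-Cartesian squares when `f` is a comparison equivalence. -/
theorem form {X X' Y Z W : C} {b : A.Hom X Y} {q : B.Hom X Z} {a : A.Hom Z W} {p : B.Hom Y W}
    {k : A.Hom X' Y} {r : B.Hom X' Z} {f : X ⟶ X'} (hf : A.mem f) (hf' : B.mem f)
    {S : Square b q a p} {S' : Square k r a p} {R : Square b ⟨f, hf'⟩ k (.one B Y)}
    (h : 𝒢.mem S) (h' : 𝒢.mem S') (hR : 𝒢.mem R)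
    (γ : q.hom ≅ f ≫ r.hom) (δ : b.hom ≅ f ≫ k.hom)
    (eR : (ρ_ b.hom).inv = δ.hom ≫ R.cell.hom)
    (e : S.cell.hom ≫ δ.hom ▷ p.hom =
      γ.hom ▷ a.hom ≫ (α_ f r.hom a.hom).hom ≫ f ◁ S'.cell.hom ≫ (α_ _ _ _).inv)
    (x : E X) :
    (Γ.G S h x).hom ≫ (Q.fn p).map (P.split (f := ⟨f, hf⟩) δ x).hom =
      (P.fn a).map (Q.split (f := ⟨f, hf'⟩) γ x).hom ≫ (Γ.G S' h' _).hom ≫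
        (Q.fn p).map ((P.fn k).map (Γ.ρ f hf hf' x).hom) := by
  have e₁ := Γ.vMeet hf hf' (A.id_mem Y) (B.id_mem Y) R hR δ (ρ_ b.hom).symm eR x
  have e₂ := Γ.vcomp' hR h' h γ (λ_ p.hom).symm (by
    have eR' : R.cell.hom = δ.inv ≫ (ρ_ b.hom).inv := by rw [Iso.eq_inv_comp, eR]
    simp only [vpaste, Iso.trans_hom, whiskerLeftIso_hom, whiskerRightIso_hom, Iso.symm_hom]
    rw [← reassoc_of% e, eR']
    simp) x
  have e₃ := Γ.ρ_unit Y ((P.fn b).obj x)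
  have e₄ := P.split_unit (ρ_ b.hom).symm (θ := Iso.refl _) (by simp) x
  have e₅ := Q.split_map_unit (λ_ p.hom).symm (θ := Iso.refl _) (by simp) ((P.fn b).obj x)
  rw [P.cell_refl] at e₄
  rw [Q.cell_refl] at e₅
  -- The value at `R`: the contribution of `ρ (𝟙 Y)` is cancelled by `ρ_unit`.
  have e₆ : (Γ.G R hR x).hom ≫ (Q.unit Y _).hom ≫ (P.split (f := ⟨f, hf⟩) δ x).hom =
      (P.fn k).map (Γ.ρ f hf hf' x).hom := by
    rw [← e₃, Category.assoc, reassoc_of% e₁, reassoc_of% e₄]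
    simp
  rw [← e₆, Functor.map_comp, Functor.map_comp, ← reassoc_of% e₂, reassoc_of% e₅]

end MeetGluing

end MeetGluing

/-! ### The identification on the intersection induced by data on all squares -/

section AllSquares

variable {C : Type u₁} [Bicategory.{w₁, v₁} C] {A B : ArrowySub C}
  {E : C → Type u₃} [∀ X, Category.{v₃} (E X)] {P : Act A E} {Q : Act B E} {𝒢 : SquareClass A B}

/-- The class contains all squares. -/
structure SquareClass.IsAll (𝒢 : SquareClass A B) : Prop where
  mem {X Y Z W : C} {b : A.Hom X Y} {q : B.Hom X Z} {a : A.Hom Z W} {p : B.Hom Y W}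
    (S : Square b q a p) : 𝒢.mem S

theorem SquareClass.IsAll.transpose (h : 𝒢.IsAll) : 𝒢.transpose.IsAll := ⟨fun S => h.mem S.tr⟩

/-- The square with top and left edges `f` and with identities as bottom and right edges. -/
abbrev Square.cornerOf {X Y : C} (f : X ⟶ Y) (hA : A.mem f) (hB : B.mem f) :
    Square (A := A) (B := B) ⟨f, hA⟩ ⟨f, hB⟩ (.one A Y) (.one B Y) :=
  ⟨Iso.refl (f ≫ 𝟙 Y)⟩

theorem Act.split_leftUnitor_symm (P : Act A E) {X Y : C} (g : A.Hom X Y) (x : E X) :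
    (P.split (f := .one A X) (λ_ g.hom).symm x).hom = (P.fn g).map (P.unit X x).inv := by
  have e := P.split_map_unit (λ_ g.hom).symm (θ := Iso.refl _) (by simp) x
  rw [P.cell_refl] at e
  rw [← cancel_mono ((P.fn g).map (P.unit X x).hom), e, ← Functor.map_comp, Iso.inv_hom_id,
    CategoryTheory.Functor.map_id]

theorem Act.split_rightUnitor_symm (P : Act A E) {X Y : C} (f : A.Hom X Y) (x : E X) :
    (P.split (g := .one A Y) (ρ_ f.hom).symm x).hom = (P.unit Y _).inv := by
  have e := P.split_unit (ρ_ f.hom).symm (θ := Iso.refl _) (by simp) x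
  rw [P.cell_refl] at e
  rw [← cancel_mono (P.unit Y _).hom, e, Iso.inv_hom_id]

namespace SqGluing

/-- The identification of the actions of the morphisms of `A ∩ B` induced by `G`. -/
def meet (Γ : SqGluing P Q 𝒢) (h𝒢 : 𝒢.IsAll) {X Y : C} (f : X ⟶ Y) (hA : A.mem f) (hB : B.mem f)
    (x : E X) : (Q.fn ⟨f, hB⟩).obj x ≅ (P.fn ⟨f, hA⟩).obj x :=
  (P.unit Y _).symm ≪≫ Γ.G (Square.cornerOf f hA hB) (h𝒢.mem _) x ≪≫ Q.unit Y _

theorem meet_hom (Γ : SqGluing P Q 𝒢) (h𝒢 : 𝒢.IsAll) {X Y : C} (f : X ⟶ Y) (hA : A.mem f)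
    (hB : B.mem f) (x : E X) : (Γ.meet h𝒢 f hA hB x).hom =
      (P.unit Y _).inv ≫ (Γ.G (Square.cornerOf f hA hB) (h𝒢.mem _) x).hom ≫ (Q.unit Y _).hom := rfl

theorem meet_naturality (Γ : SqGluing P Q 𝒢) (h𝒢 : 𝒢.IsAll) {X Y : C} (f : X ⟶ Y) (hA : A.mem f)
    (hB : B.mem f) {x y : E X} (u : x ⟶ y) :
    (Q.fn ⟨f, hB⟩).map u ≫ (Γ.meet h𝒢 f hA hB y).hom =
      (Γ.meet h𝒢 f hA hB x).hom ≫ (P.fn ⟨f, hA⟩).map u := by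
  rw [meet_hom, meet_hom, ← cancel_epi (P.unit Y _).hom, Category.assoc, Category.assoc,
    Iso.hom_inv_id_assoc, ← Q.unit_naturality, ← reassoc_of% P.unit_naturality,
    Iso.hom_inv_id_assoc, reassoc_of% (Γ.naturality)]

theorem meet_transpose (Γ : SqGluing P Q 𝒢) (h𝒢 : 𝒢.IsAll) {X Y : C} (f : X ⟶ Y) (hA : A.mem f)
    (hB : B.mem f) (x : E X) :
    (Γ.transpose.meet h𝒢.transpose f hB hA x).hom = (Γ.meet h𝒢 f hA hB x).inv :=
  (Category.assoc _ _ _).symm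

variable [Strict C] (Γ : SqGluing P Q 𝒢) (h𝒢 : 𝒢.IsAll)

/-- `R` is the corner of `f` pasted horizontally with the identity square of `k`, so its value is
the value at the corner, transported by `k`. -/
theorem G_unit_split {X X' Y : C} {b : A.Hom X Y} {k : A.Hom X' Y} {f : X ⟶ X'} (hf : A.mem f)
    (hf' : B.mem f) {R : Square b ⟨f, hf'⟩ k (.one B Y)} (hR : 𝒢.mem R) (δ : b.hom ≅ f ≫ k.hom)
    (eR : (ρ_ b.hom).inv = δ.hom ≫ R.cell.hom) (x : E X) :
    (Γ.G R hR x).hom ≫ (Q.unit Y _).hom ≫ (P.split (f := ⟨f, hf⟩) δ x).hom =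
      (P.fn k).map (Γ.meet h𝒢 f hf hf' x).hom := by
  have e₁ := Γ.hcomp' (S := Square.cornerOf f hf hf') (S' := Square.vOne B (Iso.refl k.hom))
    (T := R) (h𝒢.mem _) (h𝒢.mem _) hR δ (λ_ k.hom).symm (by
      have eR' : R.cell.hom = δ.inv ≫ (ρ_ b.hom).inv := by rw [Iso.eq_inv_comp, eR]
      rw [eR']
      simp [hpaste]) x
  have e₂ := Γ.vId (Iso.refl k.hom) (h𝒢.mem _) ((P.fn ⟨f, hf⟩).obj x)
  rw [P.cell_refl, Category.comp_id] at e₂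
  rw [P.split_leftUnitor_symm] at e₁
  rw [← Q.unit_naturality, reassoc_of% e₁, e₂, meet_hom, Functor.map_comp, Functor.map_comp]

/-- Pasting `S` on the right with the corner of `p` gives a square `T` with right edge an identity.
Its value is computed once by the composition axiom and once by `G_unit_split`. -/
theorem meet_vMeet {X Y Z W : C} {b : A.Hom X Y} {q : X ⟶ Z} (hq : A.mem q) (hq' : B.mem q)
    {a : A.Hom Z W} {p : Y ⟶ W} (hp : A.mem p) (hp' : B.mem p)
    (S : Square b ⟨q, hq'⟩ a ⟨p, hp'⟩) (h : 𝒢.mem S)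
    {m : A.Hom X W} (μ : m.hom ≅ q ≫ a.hom) (ν : m.hom ≅ b.hom ≫ p)
    (e : ν.hom = μ.hom ≫ S.cell.hom) (x : E X) :
    (Γ.G S h x).hom ≫ (Γ.meet h𝒢 p hp hp' _).hom =
      (P.fn a).map (Γ.meet h𝒢 q hq hq' x).hom ≫ (P.split (f := ⟨q, hq⟩) μ x).inv ≫
        (P.split (g := ⟨p, hp⟩) ν x).hom := by
  let T : Square m ⟨q, hq'⟩ a (.one B W) := ⟨μ.symm ≪≫ (ρ_ m.hom).symm⟩
  have e₁ := Γ.hcomp' (S := S) (S' := Square.cornerOf p hp hp') (T := T) h (h𝒢.mem _) (h𝒢.mem _) ν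
    (ρ_ a.hom).symm (by
      simp [T, hpaste, e]) x
  have e₂ := Γ.G_unit_split h𝒢 hq hq' (R := T) (h𝒢.mem _) μ (by simp [T]) x
  rw [P.split_rightUnitor_symm] at e₁
  rw [← e₂, Category.assoc, Category.assoc, Iso.hom_inv_id_assoc, ← Q.unit_naturality,
    reassoc_of% e₁, meet_hom, ← cancel_epi (P.unit W _).hom, Iso.hom_inv_id_assoc,
    ← reassoc_of% P.unit_naturality, Iso.hom_inv_id_assoc]

/-- Gluing data on all squares determine the identification of the actions of `A ∩ B`. -/
def toMeetGluing : MeetGluing P Q 𝒢 where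
  toSqGluing := Γ
  ρ := Γ.meet h𝒢
  ρ_naturality := Γ.meet_naturality h𝒢
  ρ_cell {X Y f g} hA hB hA' hB' η x := by
    -- Naturality is checked one edge at a time: the top edge of `S` is still `f`, while its left
    -- edge is already `g`.
    let S : Square (A := A) (B := B) ⟨f, hA⟩ ⟨g, hB'⟩ (.one A Y) (.one B Y) :=
      ⟨whiskerRightIso η.symm _⟩
    have e₁ := Γ.G_congr_left (S := Square.cornerOf f hA hB) (S' := S) (h𝒢.mem _) (h𝒢.mem _) η
      (by simp [S]) x
    have e₂ := Γ.G_congr_top (S := S) (S' := Square.cornerOf g hA' hB') (h𝒢.mem _) (h𝒢.mem _) η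
      (by simp [S]) x
    rw [meet_hom, meet_hom, Category.assoc, Category.assoc, ← Q.unit_naturality, e₁, ← e₂,
      Category.assoc, ← cancel_epi (P.unit Y _).hom, ← reassoc_of% P.unit_naturality]
    simp
  ρ_unit X x := by
    have e := Γ.vId (Iso.refl (𝟙 X)) (a := .one A X) (b := .one A X) (h𝒢.mem _) x
    have e' : Square.vOne B (a := .one A X) (b := .one A X) (Iso.refl (𝟙 X)) =
        Square.cornerOf (𝟙 X) (A.id_mem X) (B.id_mem X) :=
      Square.eq_of_cell (by simp [unitors_equal])
    rw [P.cell_refl, Category.comp_id] at e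
    simp only [e'] at e
    rw [meet_hom, Category.assoc, Category.assoc, reassoc_of% e, P.unit_naturality,
      Iso.inv_hom_id_assoc]
  ρ_comp {X Y Z f} hA hB {g} hA' hB' x := by
    -- The corner of `f ≫ g` is the vertical composite of `R` and the corner of `g`, and
    -- `G_unit_split` computes the value at `R`.
    let R : Square (A := A) (B := B) ⟨f ≫ g, A.comp_mem hA hA'⟩ ⟨f, hB⟩ ⟨g, hA'⟩ (.one B Z) :=
      ⟨(ρ_ (f ≫ g)).symm⟩
    have e₁ := Γ.G_unit_split h𝒢 hA hB (R := R) (h𝒢.mem _) (Iso.refl _) (by simp [R]) x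
    have e₂ := Γ.vcomp' (S := R) (S' := Square.cornerOf g hA' hB')
      (T := Square.cornerOf (f ≫ g) (A.comp_mem hA hA') (B.comp_mem hB hB'))
      (h𝒢.mem _) (h𝒢.mem _) (h𝒢.mem _) (Iso.refl _) (λ_ (𝟙 Z)).symm (by simp [R, vpaste]) x
    have e₃ := Q.split_leftUnitor_symm (.one B Z)
      ((P.fn ⟨f ≫ g, A.comp_mem hA hA'⟩).obj x)
    have e₄ := P.split_refl ⟨f, hA⟩ ⟨g, hA'⟩ x
    have e₅ := Q.split_refl ⟨f, hB⟩ ⟨g, hB'⟩ x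
    rw [e₄] at e₁
    rw [e₃, e₅, ← Functor.mapIso_inv, Iso.comp_inv_eq] at e₂
    rw [Γ.meet_naturality h𝒢, ← e₁, meet_hom, meet_hom, e₂]
    simp only [Category.assoc, Functor.mapIso_hom]
    rw [← reassoc_of% (Q.unit_naturality (Γ.G R _ x).hom), ← cancel_epi (P.unit Z _).hom,
      Iso.hom_inv_id_assoc, ← reassoc_of% P.unit_naturality, Iso.hom_inv_id_assoc,
      reassoc_of% (Q.unit_naturality (Q.unit _ _).hom)]
  vMeet := Γ.meet_vMeet h𝒢
  hMeet {X Y Z W b} hb hb' {q a} ha ha' {p} S h {m} μ ν e x := by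
    have := Γ.transpose.meet_vMeet h𝒢.transpose hb' hb ha' ha S.tr h ν μ (by simp [e]) x
    rw [Γ.meet_transpose h𝒢, Γ.meet_transpose h𝒢] at this
    change (Γ.G S h x).inv ≫ _ = _ at this
    rw [Iso.inv_comp_eq] at this
    rw [← cancel_epi (Γ.meet h𝒢 a ha ha' _).inv, Iso.inv_hom_id_assoc, this]
    simp [← Functor.map_comp]

end SqGluing

end AllSquares

/-! ### Extension to one square by a decomposition, and independence of the decomposition -/

section Extension

variable {C : Type u₁} [Bicategory.{w₁, v₁} C] {A B : ArrowySub C}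
  {E : C → Type u₃} [∀ X, Category.{v₃} (E X)] {P : Act A E} {Q : Act B E} {𝒢 : SquareClass A B}

/-- A natural family of isomorphisms of the shape of the value of gluing data at a square. -/
structure Fill (P : Act A E) (Q : Act B E) {X Y Z W : C} (b : A.Hom X Y) (q : B.Hom X Z)
    (a : A.Hom Z W) (p : B.Hom Y W) where
  app (x : E X) : (P.fn a).obj ((Q.fn q).obj x) ≅ (Q.fn p).obj ((P.fn b).obj x)
  naturality {x y : E X} (u : x ⟶ y) :
    (P.fn a).map ((Q.fn q).map u) ≫ (app y).hom = (app x).hom ≫ (Q.fn p).map ((P.fn b).map u)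

theorem Fill.hom_ext {X Y Z W : C} {b : A.Hom X Y} {q : B.Hom X Z} {a : A.Hom Z W} {p : B.Hom Y W}
    {F F' : Fill P Q b q a p} (h : ∀ x, (F.app x).hom = (F'.app x).hom) : F = F' := by
  obtain ⟨F, _⟩ := F
  obtain ⟨F', _⟩ := F'
  obtain rfl : F = F' := funext fun x => Iso.ext (h x)
  rfl

/-- The value of gluing data at a square. -/
abbrev SqGluing.fill (Γ : SqGluing P Q 𝒢) {X Y Z W : C} {b : A.Hom X Y} {q : B.Hom X Z}
    {a : A.Hom Z W} {p : B.Hom Y W} (S : Square b q a p) (h : 𝒢.mem S) : Fill P Q b q a p :=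
  ⟨Γ.G S h, Γ.naturality S h⟩

namespace MeetGluing

variable (Γ : MeetGluing P Q 𝒢)

/-- Pasting along a morphism of `A ∩ B`. -/
def push {X X' Y Z W : C} {b : A.Hom X Y} {q : B.Hom X Z} {a : A.Hom Z W} {p : B.Hom Y W}
    {k : A.Hom X' Y} {r : B.Hom X' Z} {f : X ⟶ X'} (hf : A.mem f) (hf' : B.mem f)
    (γ : q.hom ≅ f ≫ r.hom) (δ : b.hom ≅ f ≫ k.hom) (F : Fill P Q k r a p) :
    Fill P Q b q a p where
  app x := (P.fn a).mapIso (Q.split (f := ⟨f, hf'⟩) γ x) ≪≫ F.app _ ≪≫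
    (Q.fn p).mapIso ((P.fn k).mapIso (Γ.ρ f hf hf' x)) ≪≫
      (Q.fn p).mapIso (P.split (f := ⟨f, hf⟩) δ x).symm
  naturality {x y} u := by
    have e₁ : (P.split (f := ⟨f, hf⟩) δ x).inv ≫ (P.fn b).map u =
        (P.fn k).map ((P.fn ⟨f, hf⟩).map u) ≫ (P.split (f := ⟨f, hf⟩) δ y).inv := by
      rw [Iso.inv_comp_eq, reassoc_of% (P.split_naturality (f := ⟨f, hf⟩) δ u).symm]
      simp
    simp only [Iso.trans_hom, Functor.mapIso_hom, Iso.symm_hom, Category.assoc]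
    rw [← Functor.map_comp_assoc, Q.split_naturality, Functor.map_comp, Category.assoc,
      reassoc_of% (F.naturality)]
    simp only [← Functor.map_comp]
    rw [e₁]
    simp only [← Functor.map_comp_assoc]
    rw [Γ.ρ_naturality]

theorem push_hom {X X' Y Z W : C} {b : A.Hom X Y} {q : B.Hom X Z} {a : A.Hom Z W} {p : B.Hom Y W}
    {k : A.Hom X' Y} {r : B.Hom X' Z} {f : X ⟶ X'} (hf : A.mem f) (hf' : B.mem f)
    (γ : q.hom ≅ f ≫ r.hom) (δ : b.hom ≅ f ≫ k.hom) (F : Fill P Q k r a p) (x : E X) :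
    ((Γ.push hf hf' γ δ F).app x).hom =
      (P.fn a).map (Q.split (f := ⟨f, hf'⟩) γ x).hom ≫ (F.app _).hom ≫
        (Q.fn p).map ((P.fn k).map (Γ.ρ f hf hf' x).hom) ≫
          (Q.fn p).map (P.split (f := ⟨f, hf⟩) δ x).inv := rfl

theorem push_hom_map {X X' Y Z W : C} {b : A.Hom X Y} {q : B.Hom X Z} {a : A.Hom Z W}
    {p : B.Hom Y W}
    {k : A.Hom X' Y} {r : B.Hom X' Z} {f : X ⟶ X'} (hf : A.mem f) (hf' : B.mem f)
    (γ : q.hom ≅ f ≫ r.hom) (δ : b.hom ≅ f ≫ k.hom) (F : Fill P Q k r a p) (x : E X) :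
    ((Γ.push hf hf' γ δ F).app x).hom ≫ (Q.fn p).map (P.split (f := ⟨f, hf⟩) δ x).hom =
      (P.fn a).map (Q.split (f := ⟨f, hf'⟩) γ x).hom ≫ (F.app _).hom ≫
        (Q.fn p).map ((P.fn k).map (Γ.ρ f hf hf' x).hom) := by
  rw [push_hom]
  simp [← Functor.map_comp]

/-- Transitivity of pasting: since `ρ` respects composition and 2-cells (`ρ_split`), pasting along
`e` and then `f₁` is pasting along any `f₂` isomorphic to `f₁ ≫ e`. -/
theorem push_push {X X₁ X₂ Y Z W : C} {b : A.Hom X Y} {q : B.Hom X Z} {a : A.Hom Z W}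
    {p : B.Hom Y W} {k₁ : A.Hom X₁ Y} {r₁ : B.Hom X₁ Z} {k₂ : A.Hom X₂ Y} {r₂ : B.Hom X₂ Z}
    {f₁ : X ⟶ X₁} {f₂ : X ⟶ X₂} {e : X₁ ⟶ X₂} (h₁ : A.mem f₁) (h₁' : B.mem f₁) (h₂ : A.mem f₂)
    (h₂' : B.mem f₂) (he : A.mem e) (he' : B.mem e)
    (γ₁ : q.hom ≅ f₁ ≫ r₁.hom) (δ₁ : b.hom ≅ f₁ ≫ k₁.hom) (γ₂ : q.hom ≅ f₂ ≫ r₂.hom)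
    (δ₂ : b.hom ≅ f₂ ≫ k₂.hom) (σ : r₁.hom ≅ e ≫ r₂.hom) (τ : k₁.hom ≅ e ≫ k₂.hom)
    (φ : f₂ ≅ f₁ ≫ e) (eγ : γ₂.hom ≫ φ.hom ▷ r₂.hom ≫ (α_ _ _ _).hom = γ₁.hom ≫ f₁ ◁ σ.hom)
    (eδ : δ₂.hom ≫ φ.hom ▷ k₂.hom ≫ (α_ _ _ _).hom = δ₁.hom ≫ f₁ ◁ τ.hom)
    (F : Fill P Q k₂ r₂ a p) :
    Γ.push h₁ h₁' γ₁ δ₁ (Γ.push he he' σ τ F) = Γ.push h₂ h₂' γ₂ δ₂ F := by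
  refine Fill.hom_ext fun x => ?_
  have c₁ := Q.split_split (f := ⟨f₂, h₂'⟩) (f₁ := ⟨f₁, h₁'⟩) (f₂ := ⟨e, he'⟩) γ₂ φ γ₁ σ eγ x
  have c₂ := P.split_split (f := ⟨f₂, h₂⟩) (f₁ := ⟨f₁, h₁⟩) (f₂ := ⟨e, he⟩) δ₂ φ δ₁ τ eδ x
  have c₃ := Γ.ρ_split h₁ h₁' he he' h₂ h₂' φ x
  have c₄ := P.split_naturality (f := ⟨e, he⟩) τ (Γ.ρ f₁ h₁ h₁' x).hom
  have c₅ := F.naturality (Q.split (h := ⟨f₂, h₂'⟩) (f := ⟨f₁, h₁'⟩) (g := ⟨e, he'⟩) φ x).hom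
  have c₆ := Γ.push_hom_map h₁ h₁' γ₁ δ₁ (Γ.push he he' σ τ F) x
  have c₇ := Γ.push_hom_map he he' σ τ F ((Q.fn ⟨f₁, h₁'⟩).obj x)
  have c₈ := Γ.push_hom_map h₂ h₂' γ₂ δ₂ F x
  rw [← cancel_mono ((Q.fn p).map (P.split (f := ⟨f₁, h₁⟩) δ₁ x).hom),
    ← cancel_mono ((Q.fn p).map (P.split (f := ⟨e, he⟩) τ _).hom), c₆, Category.assoc,
    Category.assoc, ← Functor.map_comp, c₄, Category.assoc, ← Functor.map_comp, ← c₂,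
    Functor.map_comp, Functor.map_comp, reassoc_of% c₇, reassoc_of% c₈]
  simp only [← Functor.map_comp, ← Functor.map_comp_assoc]
  rw [← c₁, c₃, ← Γ.ρ_naturality]
  simp only [Functor.map_comp, Category.assoc]
  rw [reassoc_of% c₅]

theorem push_id {X Y Z W : C} {b : A.Hom X Y} {q : B.Hom X Z} {a : A.Hom Z W}
    {p : B.Hom Y W} (F : Fill P Q b q a p) :
    Γ.push (A.id_mem X) (B.id_mem X) (λ_ q.hom).symm (λ_ b.hom).symm F = F := by
  refine Fill.hom_ext fun x => ?_
  have c := Γ.push_hom_map (A.id_mem X) (B.id_mem X) (λ_ q.hom).symm (λ_ b.hom).symm F x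
  rw [P.split_leftUnitor_symm, Q.split_leftUnitor_symm] at c
  have c₁ := F.naturality (Q.unit X x).inv
  have c₂ : (Q.unit X x).inv ≫ (Γ.ρ (𝟙 X) (A.id_mem X) (B.id_mem X) x).hom = (P.unit X x).inv := by
    rw [Iso.inv_comp_eq, Iso.eq_comp_inv, Γ.ρ_unit]
  rw [reassoc_of% c₁, ← Functor.map_comp, ← Functor.map_comp, c₂] at c
  rwa [cancel_mono] at c

end MeetGluing

/-- A decomposition of a square through a 2-Cartesian square. -/
structure Decomp {X Y Z W : C} {b : A.Hom X Y} {q : B.Hom X Z} {a : A.Hom Z W} {p : B.Hom Y W}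
    (S : Square b q a p) where
  pt : C
  k : A.Hom pt Y
  r : B.Hom pt Z
  sq : Square k r a p
  cart : sq.IsCart
  f : X ⟶ pt
  hf : A.mem f
  hf' : B.mem f
  γ : q.hom ≅ f ≫ r.hom
  δ : b.hom ≅ f ≫ k.hom
  e : S.cell.hom ≫ δ.hom ▷ p.hom = γ.hom ▷ a.hom ≫ (sqAct sq.cell f).hom

theorem IsSquaring.exists_decomp (h : IsSquaring A B) {X Y Z W : C} {b : A.Hom X Y} {q : B.Hom X Z}
    {a : A.Hom Z W} {p : B.Hom Y W} (S : Square b q a p) : Nonempty (Decomp S) := by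
  obtain ⟨X', k, r, S', f, γ, δ, hS', e⟩ := h S
  exact ⟨⟨X', k, r, S', hS', f.hom, f.mem.1, f.mem.2, γ, δ.symm, by
    rw [show S.cell.hom = _ from e]
    simp [sqAct]⟩⟩

/-- The transposed decomposition. -/
@[reducible]
def Decomp.tr {X Y Z W : C} {b : A.Hom X Y} {q : B.Hom X Z} {a : A.Hom Z W} {p : B.Hom Y W}
    {S : Square b q a p} (d : Decomp S) : Decomp S.tr where
  pt := d.pt
  k := d.r
  r := d.k
  sq := d.sq.tr
  cart := IsTwoCartesian.symm d.cart
  f := d.f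
  hf := d.hf'
  hf' := d.hf
  γ := d.δ
  δ := d.γ
  e := by
    have := d.e
    simp only [sqAct_symm, Iso.symm_hom]
    rw [Iso.inv_comp_eq, reassoc_of% this]
    simp

/-- The class consists of the 2-Cartesian squares. -/
structure SquareClass.IsCart (𝒢 : SquareClass A B) : Prop where
  mem {X Y Z W : C} {b : A.Hom X Y} {q : B.Hom X Z} {a : A.Hom Z W} {p : B.Hom Y W}
    {S : Square b q a p} (h : S.IsCart) : 𝒢.mem S

theorem SquareClass.IsCart.transpose (h : 𝒢.IsCart) : 𝒢.transpose.IsCart :=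
  ⟨fun hS => h.mem (Square.IsCart.transpose hS)⟩

namespace MeetGluing

variable (Γ : MeetGluing P Q 𝒢) (h𝒢 : 𝒢.IsCart)

/-- The value on an arbitrary square, computed by means of a decomposition. -/
def ext {X Y Z W : C} {b : A.Hom X Y} {q : B.Hom X Z} {a : A.Hom Z W} {p : B.Hom Y W}
    {S : Square b q a p} (d : Decomp S) : Fill P Q b q a p :=
  Γ.push d.hf d.hf' d.γ d.δ (Γ.fill d.sq (h𝒢.mem d.cart))

/-- Transposing a decomposition exchanges `γ` and `δ` and inverts `ρ`. On one side `ρ` is applied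
before the value at the 2-Cartesian square and on the other side after it; naturality reconciles the
two. -/
theorem ext_transpose {X Y Z W : C} {b : A.Hom X Y} {q : B.Hom X Z} {a : A.Hom Z W} {p : B.Hom Y W}
    {S : Square b q a p} (d : Decomp S) (x : E X) :
    ((Γ.transpose.ext h𝒢.transpose d.tr).app x).hom = ((Γ.ext h𝒢 d).app x).inv := by
  have c₁ := Γ.transpose.push_hom_map d.hf' d.hf d.δ d.γ
    (Γ.transpose.fill d.sq.tr (h𝒢.transpose.mem d.tr.cart)) x
  have c₂ := Γ.push_hom d.hf d.hf' d.γ d.δ (Γ.fill d.sq (h𝒢.mem d.cart)) x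
  change _ = _ ≫ (Γ.G d.sq (h𝒢.mem d.cart) _).inv ≫ (P.fn a).map ((Q.fn d.r).map
    (Γ.ρ d.f d.hf d.hf' x).inv) at c₁
  have c₃ := Γ.naturality_inv d.sq (h𝒢.mem d.cart) (Γ.ρ d.f d.hf d.hf' x).inv
  rw [← c₃] at c₁
  change (((Γ.transpose.push d.hf' d.hf d.δ d.γ
    (Γ.transpose.fill d.sq.tr (h𝒢.transpose.mem d.tr.cart))).app x).hom) =
    (((Γ.push d.hf d.hf' d.γ d.δ (Γ.fill d.sq (h𝒢.mem d.cart))).app x)).inv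
  rw [← cancel_mono ((P.fn a).map (Q.split (f := ⟨d.f, d.hf'⟩) d.γ x).hom), c₁, Iso.eq_inv_comp,
    c₂]
  simp [← Functor.map_comp, ← Functor.map_comp_assoc]

/-- The trivial decomposition of a 2-Cartesian square. -/
@[reducible]
def _root_.GluingData.Square.IsCart.decomp {X Y Z W : C} {b : A.Hom X Y} {q : B.Hom X Z}
    {a : A.Hom Z W} {p : B.Hom Y W} {S : Square b q a p} (h : S.IsCart) : Decomp S where
  pt := X
  k := b
  r := q
  sq := S
  cart := h
  f := 𝟙 X
  hf := A.id_mem X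
  hf' := B.id_mem X
  γ := (λ_ q.hom).symm
  δ := (λ_ b.hom).symm
  e := by simp [sqAct]

theorem ext_decomp_of_cart {X Y Z W : C} {b : A.Hom X Y} {q : B.Hom X Z}
    {a : A.Hom Z W} {p : B.Hom Y W} {S : Square b q a p} (h : S.IsCart) :
    Γ.ext h𝒢 h.decomp = Γ.fill S (h𝒢.mem h) :=
  Γ.push_id _

variable [Strict C] [IsLocallyGroupoid C]

/-- Both decompositions pass through 2-fiber products of the same cospan. Pasting along the
comparison equivalence turns the value at one 2-Cartesian square into the value at the other, and
transitivity of pasting concludes. -/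
theorem ext_eq_ext (hA : ∀ ⦃X Y : C⦄ (e : Bicategory.Equivalence X Y), A.mem e.hom)
    (hB : ∀ ⦃X Y : C⦄ (e : Bicategory.Equivalence X Y), B.mem e.hom) {X Y Z W : C} {b : A.Hom X Y}
    {q : B.Hom X Z} {a : A.Hom Z W} {p : B.Hom Y W}
    {S : Square b q a p} (d d' : Decomp S) : Γ.ext h𝒢 d = Γ.ext h𝒢 d' := by
  obtain ⟨e, σ, τ, h⟩ := IsTwoCartesian.exists_equivalence d.cart d'.cart
  -- The square of the equivalence. It is 2-Cartesian by cancellation, because pasting it with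
  -- `d'.sq` gives `d.sq` up to isomorphism; therefore `form` is available for data on 2-Cartesian
  -- squares only.
  let R : Square d.k ⟨e.hom, hB e⟩ d'.k (.one B Y) := ⟨τ ≪≫ (ρ_ d.k.hom).symm⟩
  have hR : R.IsCart := by
    refine IsTwoCartesian.of_vpaste (S := R.cell) d'.cart ?_
    refine IsTwoCartesian.of_iso d.cart σ.symm (Iso.refl _) (Iso.refl _) (λ_ p.hom).symm ?_
    rw [← cancel_epi (σ.hom ▷ a.hom), reassoc_of% h]
    simp [vpaste, R, sqAct]
  have h₁ : Γ.fill d.sq (h𝒢.mem d.cart) =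
      Γ.push (hA e) (hB e) σ.symm τ.symm (Γ.fill d'.sq (h𝒢.mem d'.cart)) := by
    refine Fill.hom_ext fun x => ?_
    have c := Γ.form (hA e) (hB e) (h𝒢.mem d.cart) (h𝒢.mem d'.cart) (h𝒢.mem hR) σ.symm τ.symm
      (by simp [R]) (by
        rw [← cancel_epi (σ.hom ▷ a.hom), reassoc_of% h]
        simp [sqAct]) x
    have c' := Γ.push_hom_map (hA e) (hB e) σ.symm τ.symm (Γ.fill d'.sq (h𝒢.mem d'.cart)) x
    rw [← c'] at c
    rwa [cancel_mono] at c
  -- The two morphisms from `X` to the second fiber product induce isomorphic cones, hence there is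
  -- a 2-cell between them.
  obtain ⟨φ, φ₁, φ₂⟩ := IsTwoCartesian.exists_cell d'.cart (t := d.f ≫ e.hom) (t' := d'.f)
    ((α_ _ _ _).hom ≫ d.f ◁ σ.hom ≫ d.γ.inv ≫ d'.γ.hom)
    ((α_ _ _ _).hom ≫ d.f ◁ τ.hom ≫ d.δ.inv ≫ d'.δ.hom) (by
      have h₂ := sqAct_comp h d.f
      have h₃ := d'.e
      have h₄ : d.γ.inv ▷ a.hom ≫ S.cell.hom = (sqAct d.sq.cell d.f).hom ≫ d.δ.inv ▷ p.hom := by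
        rw [← cancel_epi (d.γ.hom ▷ a.hom), ← cancel_mono (d.δ.hom ▷ p.hom)]
        simp [d.e]
      simp only [comp_whiskerRight, Category.assoc]
      rw [← h₃, reassoc_of% h₄, reassoc_of% h₂]
      simp)
  rw [ext, h₁]
  refine Γ.push_push _ _ _ _ _ _ _ _ _ _ _ _ (asIso φ).symm ?_ ?_ _
  · have : d'.γ.hom = d.γ.hom ≫ d.f ◁ σ.inv ≫ (α_ _ _ _).inv ≫ φ ▷ d'.r.hom := by
      rw [φ₁]; simp
    rw [this]
    simp
  · have : d'.δ.hom = d.δ.hom ≫ d.f ◁ τ.inv ≫ (α_ _ _ _).inv ≫ φ ▷ d'.k.hom := by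
      rw [φ₂]; simp
    rw [this]
    simp

end MeetGluing

end Extension

/-! ### Pasting identities for absorbing a morphism into the left edge -/

section CellAbsorb

variable {C : Type u₁} [Bicategory.{w₁, v₁} C]

theorem cell_absorb_left {X₁ X₂ X' X'' V : C} {q : X₁ ⟶ X₂} {f : X₂ ⟶ X'} {g' : X₁ ⟶ X''}
    {r : X'' ⟶ X'} {s : V ⟶ X₂} {h : X₁ ⟶ V} {g : V ⟶ X''} {γ' : q ≫ f ≅ g' ≫ r} {β : q ≅ h ≫ s}
    {γ : g' ≅ h ≫ g} {U : g ≫ r ≅ s ≫ f}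
    (eU : γ'.inv ≫ β.hom ▷ f = γ.hom ▷ r ≫ (sqAct U h).hom) :
    γ'.hom ≫ γ.hom ▷ r ≫ (α_ h g r).hom =
      (whiskerRightIso β f ≪≫ α_ h s f).hom ≫ h ◁ U.symm.hom := by
  have : γ'.hom ≫ γ.hom ▷ r = β.hom ▷ f ≫ (sqAct U h).inv := by
    rw [Iso.eq_comp_inv, Category.assoc, ← eU, Iso.hom_inv_id_assoc]
  rw [reassoc_of% this]
  simp [sqAct]

/-- The pasting equation needed in `ext_absorb`: the transpose of `U` followed by `T` is a
decomposition of `S` along `h`. -/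
theorem cell_absorb {X₁ X₂ X' X'' V Y₁ Y₂ : C} {q : X₁ ⟶ X₂} {f : X₂ ⟶ X'} {g' : X₁ ⟶ X''}
    {r : X'' ⟶ X'} {s : V ⟶ X₂} {h : X₁ ⟶ V} {g : V ⟶ X''} {i₁ : X₁ ⟶ Y₁} {i₂ : X₂ ⟶ Y₂}
    {p : Y₁ ⟶ Y₂} {k : X' ⟶ Y₂} {t : X'' ⟶ Y₁} {S : q ≫ i₂ ≅ i₁ ≫ p} {S' : (q ≫ f) ≫ k ≅ i₁ ≫ p}
    {T : r ≫ k ≅ t ≫ p} {δ : i₂ ≅ f ≫ k} {β' : i₁ ≅ g' ≫ t}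
    {γ' : q ≫ f ≅ g' ≫ r} {β : q ≅ h ≫ s} {γ : g' ≅ h ≫ g} {U : g ≫ r ≅ s ≫ f}
    (e : q ◁ δ.hom ≫ (α_ _ _ _).inv ≫ S'.hom = S.hom)
    (eT : S'.hom ≫ β'.hom ▷ p = γ'.hom ▷ k ≫ (sqAct T g').hom)
    (eU : γ'.inv ≫ β.hom ▷ f = γ.hom ▷ r ≫ (sqAct U h).hom) :
    S.hom ≫ (β' ≪≫ whiskerRightIso γ t ≪≫ α_ h g t).hom ▷ p =
      β.hom ▷ i₂ ≫ (sqAct (whiskerLeftIso s δ ≪≫ hpaste U.symm T) h).hom := by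
  have e₁ : γ'.hom ≫ γ.hom ▷ r = β.hom ▷ f ≫ (sqAct U h).inv := by
    rw [Iso.eq_comp_inv, Category.assoc, ← eU, Iso.hom_inv_id_assoc]
  have e₂ : (sqAct (whiskerLeftIso s δ ≪≫ hpaste U.symm T) h).hom =
      (h ≫ s) ◁ δ.hom ≫ (α_ (h ≫ s) f k).inv ≫
        (sqAct U h).inv ▷ k ≫ (sqAct T (h ≫ g)).hom ≫ (α_ h g t).hom ▷ p := by
    have := sqAct_hpaste U.symm T h
    simp only [sqAct_symm, Iso.symm_hom] at this
    rw [← this]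
    simp [sqAct]
  have e₃ := sqAct_naturality T γ.hom
  rw [e₂, ← whisker_exchange_assoc, ← e]
  simp only [Iso.trans_hom, whiskerRightIso_hom, comp_whiskerRight, Category.assoc]
  rw [reassoc_of% eT, ← reassoc_of% e₃, ← comp_whiskerRight_assoc, e₁]
  simp

end CellAbsorb

/-! ### Pasting identity for the decomposition of a vertical composite -/

section CellVcomp

variable {C : Type u₁} [Bicategory.{w₁, v₁} C]

theorem cell_push_vpaste {X₁ X₂ X₃ X' X'' Y₁ Y₂ Y₃ : C} {q : X₁ ⟶ X₂} {q' : X₂ ⟶ X₃}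
    {f : X₂ ⟶ X'} {g : X₁ ⟶ X''} {r : X'' ⟶ X'} {r' : X' ⟶ X₃} {i₁ : X₁ ⟶ Y₁} {i₂ : X₂ ⟶ Y₂}
    {i₃ : X₃ ⟶ Y₃} {p : Y₁ ⟶ Y₂} {p' : Y₂ ⟶ Y₃} {k : X' ⟶ Y₂} {t : X'' ⟶ Y₁}
    {S : q ≫ i₂ ≅ i₁ ≫ p} {S' : q' ≫ i₃ ≅ i₂ ≫ p'} {S'' : (q ≫ f) ≫ k ≅ i₁ ≫ p}
    {T : r ≫ k ≅ t ≫ p} {T' : r' ≫ i₃ ≅ k ≫ p'} {δ' : i₂ ≅ f ≫ k} {γ' : q' ≅ f ≫ r'}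
    {β : i₁ ≅ g ≫ t} {γ : q ≫ f ≅ g ≫ r}
    (e : q ◁ δ'.hom ≫ (α_ _ _ _).inv ≫ S''.hom = S.hom)
    (eT : S''.hom ≫ β.hom ▷ p = γ.hom ▷ k ≫ (sqAct T g).hom)
    (eT' : S'.hom ≫ δ'.hom ▷ p' = γ'.hom ▷ i₃ ≫ (sqAct T' f).hom) :
    (vpaste S S').hom ≫ β.hom ▷ (p ≫ p') =
      (whiskerLeftIso q γ' ≪≫ (α_ q f r').symm ≪≫ whiskerRightIso γ r' ≪≫ α_ g r r').hom ▷ i₃ ≫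
        (sqAct (vpaste T T') g).hom := by
  have e₁ := sqAct_naturality T' γ.hom
  calc
    _ = 𝟙 _ ⊗≫ q ◁ (S'.hom ≫ δ'.hom ▷ p') ⊗≫ (S''.hom ≫ β.hom ▷ p) ▷ p' ⊗≫ 𝟙 _ := by
      simp only [vpaste, Iso.trans_hom, Iso.symm_hom, whiskerLeftIso_hom, whiskerRightIso_hom, ← e]
      bicategory
    _ = 𝟙 _ ⊗≫ (q ◁ γ'.hom) ▷ i₃ ⊗≫ ((sqAct T' (q ≫ f)).hom ≫ γ.hom ▷ k ▷ p') ⊗≫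
        (sqAct T g).hom ▷ p' ⊗≫ 𝟙 _ := by
      simp only [eT, eT', sqAct, Iso.trans_hom, Iso.symm_hom, whiskerLeftIso_hom]
      bicategory
    _ = _ := by
      rw [← e₁, sqAct_vpaste]
      simp only [Iso.trans_hom, Iso.symm_hom, whiskerLeftIso_hom, whiskerRightIso_hom]
      bicategory

end CellVcomp

/-! ### Compatibility of the extension with vertical composition -/

section ExtensionComp

variable {C : Type u₁} [Bicategory.{w₁, v₁} C] [Strict C] [IsLocallyGroupoid C]
  {A B : ArrowySub C}
  {E : C → Type u₃} [∀ X, Category.{v₃} (E X)] {P : Act A E} {Q : Act B E} {𝒢 : SquareClass A B}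

namespace MeetGluing

variable (Γ : MeetGluing P Q 𝒢) (h𝒢 : 𝒢.IsCart)

/-- The bottom edge of `S` factors as `f ≫ k` with `f` in `A ∩ B`, and `S'` is the same 2-cell with
`f` moved to the left edge. A decomposition of `S'` is refined to one of `S` over the 2-Cartesian
square obtained by pasting a pullback along `f` with the one for `S'`. Comparing the two uses
`hMeet`, since the horizontal edges `f` and `g` of the added square lie in `A ∩ B`. -/
theorem ext_absorb (hA : ∀ ⦃X Y : C⦄ (e : Bicategory.Equivalence X Y), A.mem e.hom)
    (hB : ∀ ⦃X Y : C⦄ (e : Bicategory.Equivalence X Y), B.mem e.hom)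
    (hBA : IsSquaring B (B.inter A)) {X₁ X₂ X' Y₁ Y₂ : C} {i₁ : A.Hom X₁ Y₁} {i₂ : A.Hom X₂ Y₂}
    {q : B.Hom X₁ X₂} {p : B.Hom Y₁ Y₂} {S : Square i₁ q i₂ p} (d : Decomp S)
    {f : X₂ ⟶ X'} (hf : A.mem f) (hf' : B.mem f) {k : A.Hom X' Y₂} (δ : i₂.hom ≅ f ≫ k.hom)
    {S' : Square i₁ (q.then ⟨f, hf'⟩) k p} (d' : Decomp S')
    (e : q.hom ◁ δ.hom ≫ (α_ _ _ _).inv ≫ S'.cell.hom = S.cell.hom) (x : E X₁) :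
    (P.fn k).map (Γ.ρ f hf hf' ((Q.fn q).obj x)).hom ≫ (P.split (f := ⟨f, hf⟩) δ _).inv ≫
      ((Γ.ext h𝒢 d).app x).hom =
    (P.fn k).map (Q.comp q ⟨f, hf'⟩ x).inv ≫ ((Γ.ext h𝒢 d').app x).hom := by
  obtain ⟨X'', t, r, T, hT, g', hgA, hgB, γ', β', eT⟩ := d'
  -- The decomposition of `S'` provides `γ' : q ≫ f ≅ g' ≫ r`, a square with horizontal edges `q`,
  -- `r` in `B` and vertical edges `g'`, `f` in `B ∩ A`. The squaring condition factors it through a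
  -- 2-Cartesian square `U`.
  obtain ⟨u⟩ := hBA.exists_decomp (b := q) (q := ⟨g', hgB, hgA⟩) (a := r) (p := ⟨f, hf', hf⟩)
    ⟨γ'.symm⟩
  obtain ⟨V, s, ⟨g, hg', hg⟩, ⟨U⟩, hU, h, hh', ⟨-, hh⟩, γ, β, eU⟩ := u
  dsimp only at γ U hU eU
  rw [Iso.symm_hom] at eU
  let U' : Square (A := A) (B := B) ⟨g, hg⟩ s ⟨f, hf⟩ r := ⟨U.symm⟩
  have hU' : U'.IsCart := IsTwoCartesian.symm hU
  let S₁ : Square (A := A) (B := B) (ArrowySub.Hom.then ⟨g, hg⟩ t) s i₂ p :=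
    ⟨whiskerLeftIso s.hom δ ≪≫ hpaste U'.cell T.cell⟩
  have hS₁ : S₁.IsCart := by
    refine IsTwoCartesian.of_iso (IsTwoCartesian.hpaste hU' hT) (Iso.refl _) δ.symm (Iso.refl _)
      (Iso.refl _) ?_
    simp [S₁]
  let d₀ : Decomp S := 
    { pt := V
      k := ArrowySub.Hom.then ⟨g, hg⟩ t
      r := s
      sq := S₁
      cart := hS₁
      f := h
      hf := hh
      hf' := hh'
      γ := β
      δ := β' ≪≫ whiskerRightIso γ t.hom ≪≫ α_ _ _ _
      e := cell_absorb e eT eU }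
  rw [Γ.ext_eq_ext h𝒢 hA hB d d₀]
  have c₁ := Γ.push_hom_map hh hh' β d₀.δ (Γ.fill S₁ (h𝒢.mem hS₁)) x
  have c₂ := Γ.push_hom_map (q := q.then ⟨f, hf'⟩) hgA hgB γ' β' (Γ.fill T (h𝒢.mem hT)) x
  have c₃ := Γ.hcomp' (T := S₁) (h𝒢.mem hU') (h𝒢.mem hT) (h𝒢.mem hS₁) (Iso.refl _) δ
    (by simp [S₁]) ((Q.fn ⟨h, hh'⟩).obj x)
  have c₄ := Γ.hMeet hg hg' hf hf' U' (h𝒢.mem hU') (m := s.then ⟨f, hf'⟩) (Iso.refl _) U.symm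
    (by simp [U']) ((Q.fn ⟨h, hh'⟩).obj x)
  have c₅ := Γ.ρ_split hh hh' hg hg' hgA hgB γ x
  have c₆ := P.split_split (g := t) (f := ⟨g', hgA⟩) (f₁ := ⟨h, hh⟩) (f₂ := ⟨g, hg⟩)
    (k := ArrowySub.Hom.then ⟨g, hg⟩ t) β' γ d₀.δ (Iso.refl _) (by simp [d₀]) x
  have c₇ := Q.split_split (h := q.then ⟨f, hf'⟩) (f := q) (g := ⟨f, hf'⟩) (f₁ := ⟨h, hh'⟩)
    (f₂ := s) (k := s.then ⟨f, hf'⟩) (Iso.refl _) β (whiskerRightIso β f ≪≫ α_ _ _ _) (Iso.refl _)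
    (by simp) x
  have c₈ := Q.split_split (h := q.then ⟨f, hf'⟩) (f := ⟨g', hgB⟩) (g := r) (f₁ := ⟨h, hh'⟩)
    (f₂ := ⟨g, hg'⟩) (k := s.then ⟨f, hf'⟩) γ' γ (whiskerRightIso β f ≪≫ α_ _ _ _) U.symm
    (cell_absorb_left eU) x
  rw [Q.split_refl] at c₇
  -- The two descriptions of the action of `q ≫ f`, one through `q` and one through `g'`, compared
  -- after splitting off `h`.
  have c₉ : (Q.fn ⟨f, hf'⟩).map (Q.split (f := ⟨h, hh'⟩) (g := s) β x).hom ≫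
      (Q.split (h := s.then ⟨f, hf'⟩) (f := s) (g := ⟨f, hf'⟩) (Iso.refl _) _).inv ≫
        (Q.split (f := ⟨g, hg'⟩) (g := r) U.symm _).hom =
      (Q.comp q ⟨f, hf'⟩ x).inv ≫
        (Q.split (h := q.then ⟨f, hf'⟩) (f := ⟨g', hgB⟩) (g := r) γ' x).hom ≫
        (Q.fn r).map (Q.split (h := ⟨g', hgB⟩) (f := ⟨h, hh'⟩) (g := ⟨g, hg'⟩) γ x).hom := by
    rw [Iso.eq_inv_comp, c₈, reassoc_of% c₇, Iso.hom_inv_id_assoc]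
  have n₁ := P.split_naturality (h := ArrowySub.Hom.then ⟨g, hg⟩ t) (f := ⟨g, hg⟩) (g := t)
    (Iso.refl _) (Γ.ρ h hh hh' x).hom
  have n₂ := P.split_naturality (f := ⟨f, hf⟩) δ (Q.split (f := ⟨h, hh'⟩) β x).hom
  have n₃ := Γ.ρ_naturality f hf hf' (Q.split (f := ⟨h, hh'⟩) β x).hom
  have n₄ := Γ.naturality T (h𝒢.mem hT)
    ((Q.split (h := ⟨g', hgB⟩) (f := ⟨h, hh'⟩) (g := ⟨g, hg'⟩) γ x).hom ≫ (Γ.ρ g hg hg' _).hom)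
  have n₅ := Γ.ρ_naturality g hg hg' (Γ.ρ h hh hh' x).hom
  change _ ≫ _ ≫ ((Γ.push hh hh' β d₀.δ (Γ.fill S₁ (h𝒢.mem hS₁))).app x).hom =
    _ ≫ ((Γ.push (q := q.then ⟨f, hf'⟩) hgA hgB γ' β' (Γ.fill T (h𝒢.mem hT))).app x).hom
  rw [← cancel_mono ((Q.fn p).map (P.split (f := ⟨g', hgA⟩) β' x).hom),
    ← cancel_mono ((Q.fn p).map ((P.fn t).map
      (P.split (h := ⟨g', hgA⟩) (f := ⟨h, hh⟩) (g := ⟨g, hg⟩) γ x).hom))]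
  -- Both sides equal the value at `T`, preceded by `γ'`, `γ` and `ρ g` and followed by `ρ h`. On
  -- the left this comes from pasting `U'` with `T`, on the right from `ρ g'` being `ρ h` followed
  -- by `ρ g`.
  calc
    _ = (P.fn k).map (Γ.ρ f hf hf' ((Q.fn q).obj x)).hom ≫ (P.split (f := ⟨f, hf⟩) δ _).inv ≫
        (P.fn i₂).map (Q.split (f := ⟨h, hh'⟩) β x).hom ≫ (P.split (f := ⟨f, hf⟩) δ _).hom ≫
          (P.fn k).map (Γ.G U' (h𝒢.mem hU') _).hom ≫ (Γ.G T (h𝒢.mem hT) _).hom ≫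
            (Q.fn p).map ((P.fn t).map ((P.fn ⟨g, hg⟩).map (Γ.ρ h hh hh' x).hom)) := by
      simp only [Category.assoc, ← Functor.map_comp]
      rw [c₆, Functor.map_comp, reassoc_of% c₁, ← Functor.map_comp, n₁, Functor.map_comp,
        reassoc_of% c₃]
    _ = (P.fn k).map ((Q.comp q ⟨f, hf'⟩ x).inv ≫
          (Q.split (h := q.then ⟨f, hf'⟩) (f := ⟨g', hgB⟩) (g := r) γ' x).hom) ≫
        (P.fn k).map ((Q.fn r).map (
          (Q.split (h := ⟨g', hgB⟩) (f := ⟨h, hh'⟩) (g := ⟨g, hg'⟩) γ x).hom ≫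
          (Γ.ρ g hg hg' _).hom)) ≫ (Γ.G T (h𝒢.mem hT) _).hom ≫
            (Q.fn p).map ((P.fn t).map ((P.fn ⟨g, hg⟩).map (Γ.ρ h hh hh' x).hom)) := by
      rw [reassoc_of% n₂, Iso.inv_hom_id_assoc]
      simp only [← Functor.map_comp_assoc]
      rw [← reassoc_of% n₃, c₄, reassoc_of% c₉]
      simp
    _ = _ := by
      rw [reassoc_of% n₄]
      simp only [Category.assoc, ← Functor.map_comp]
      rw [← n₅, ← c₅]
      simp only [Functor.map_comp, Category.assoc]
      rw [reassoc_of% c₂]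

/-- With the lower square decomposed through `T'` along `f`, the morphism `f` is absorbed into the
left edge of the upper square. The result is decomposed through `T` along `g`; then `T` over `T'` is
2-Cartesian and decomposes the composite along `g`, so the axiom for 2-Cartesian squares applies. -/
theorem ext_vcomp (hA : ∀ ⦃X Y : C⦄ (e : Bicategory.Equivalence X Y), A.mem e.hom)
    (hB : ∀ ⦃X Y : C⦄ (e : Bicategory.Equivalence X Y), B.mem e.hom) (hAB : IsSquaring A B)
    (hBA : IsSquaring B (B.inter A)) {X₁ X₂ X₃ Y₁ Y₂ Y₃ : C} {i₁ : A.Hom X₁ Y₁} {i₂ : A.Hom X₂ Y₂}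
    {i₃ : A.Hom X₃ Y₃} {q : B.Hom X₁ X₂} {q' : B.Hom X₂ X₃} {p : B.Hom Y₁ Y₂} {p' : B.Hom Y₂ Y₃}
    {S : Square i₁ q i₂ p} {S' : Square i₂ q' i₃ p'} (d : Decomp S) (d' : Decomp S')
    (d'' : Decomp (S.vthen S')) (x : E X₁) :
    ((Γ.ext h𝒢 d'').app x).hom ≫ (Q.comp p p' _).hom =
      (P.fn i₃).map (Q.comp q q' x).hom ≫ ((Γ.ext h𝒢 d').app _).hom ≫
        (Q.fn p').map ((Γ.ext h𝒢 d).app x).hom := by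
  obtain ⟨X', k, r', T', hT', f, hf, hf', γ', δ', eT'⟩ := d'
  -- The upper square with `f` absorbed; its bottom edge `k` is the top edge of `T'`.
  let S₁ : Square i₁ (q.then ⟨f, hf'⟩) k p :=
    ⟨α_ q.hom f k.hom ≪≫ whiskerLeftIso q.hom δ'.symm ≪≫ S.cell⟩
  have e : q.hom ◁ δ'.hom ≫ (α_ _ _ _).inv ≫ S₁.cell.hom = S.cell.hom := by simp [S₁]
  obtain ⟨d₁⟩ := hAB.exists_decomp S₁
  have c₁ := Γ.ext_absorb h𝒢 hA hB hBA d hf hf' δ' d₁ e x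
  obtain ⟨X'', t, r, T, hT, g, hg, hg', γ, β, eT⟩ := d₁
  let d₀ : Decomp (S.vthen S') :=
    { pt := X''
      k := t
      r := r.then r'
      sq := T.vthen T'
      cart := IsTwoCartesian.vpaste hT hT'
      f := g
      hf := hg
      hf' := hg'
      γ := whiskerLeftIso q.hom γ' ≪≫ (α_ q.hom f r'.hom).symm ≪≫ whiskerRightIso γ r'.hom ≪≫
        α_ g r.hom r'.hom
      δ := β
      e := cell_push_vpaste e eT eT' }
  rw [Γ.ext_eq_ext h𝒢 hA hB d'' d₀]
  have c₂ := Γ.push_hom_map hg hg' d₀.γ β (Γ.fill (T.vthen T') (h𝒢.mem d₀.cart)) x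
  have c₃ := Γ.push_hom_map (q := q.then ⟨f, hf'⟩) hg hg' γ β (Γ.fill T (h𝒢.mem hT)) x
  have c₄ := Γ.push_hom hf hf' γ' δ' (Γ.fill T' (h𝒢.mem hT')) ((Q.fn q).obj x)
  have c₅ := Γ.vcomp T T' (h𝒢.mem hT) (h𝒢.mem hT') (h𝒢.mem d₀.cart) ((Q.fn ⟨g, hg'⟩).obj x)
  have c₆ := Q.split_split (h := q.then q') (f := q.then ⟨f, hf'⟩) (g := r') (f₁ := q)
    (f₂ := ⟨f, hf'⟩) (k := q') (whiskerLeftIso q.hom γ' ≪≫ (α_ q.hom f r'.hom).symm) (Iso.refl _)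
    (Iso.refl _) γ' (by simp) x
  have c₇ := Q.split_split (h := q.then q') (f := q.then ⟨f, hf'⟩) (g := r') (f₁ := ⟨g, hg'⟩)
    (f₂ := r) (k := r.then r') (whiskerLeftIso q.hom γ' ≪≫ (α_ q.hom f r'.hom).symm) γ
    d₀.γ (Iso.refl _) (by simp [d₀]) x
  rw [Q.split_refl, Q.split_refl] at c₆
  rw [Q.split_refl] at c₇
  have n₁ := Q.comp_naturality p p' (P.split (f := ⟨g, hg⟩) (g := t) β x).hom
  have n₂ := Q.comp_naturality p p' ((P.fn t).map (Γ.ρ g hg hg' x).hom)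
  have n₃ := Γ.naturality T' (h𝒢.mem hT') ((Q.comp q ⟨f, hf'⟩ x).inv ≫
    (Q.split (h := q.then ⟨f, hf'⟩) (f := ⟨g, hg'⟩) (g := r) γ x).hom)
  change ((Γ.push hg hg' d₀.γ β (Γ.fill (T.vthen T') (h𝒢.mem d₀.cart))).app x).hom ≫ _ = _ ≫
    ((Γ.push hf hf' γ' δ' (Γ.fill T' (h𝒢.mem hT'))).app ((Q.fn q).obj x)).hom ≫ _
  change _ = (P.fn k).map _ ≫
    ((Γ.push (q := q.then ⟨f, hf'⟩) hg hg' γ β (Γ.fill T (h𝒢.mem hT))).app x).hom at c₁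
  rw [← cancel_mono ((Q.fn p').map ((Q.fn p).map (P.split (f := ⟨g, hg⟩) (g := t) β x).hom)), c₄]
  calc
    _ = (P.fn i₃).map ((Q.split (h := q.then q') (f := ⟨g, hg'⟩) (g := r.then r') d₀.γ x).hom ≫
          (Q.comp r r' _).hom) ≫ (Γ.G T' (h𝒢.mem hT') _).hom ≫ 
        (Q.fn p').map (Γ.G T (h𝒢.mem hT) _).hom ≫
          (Q.fn p').map ((Q.fn p).map ((P.fn t).map (Γ.ρ g hg hg' x).hom)) := by
      rw [Category.assoc, ← n₁, reassoc_of% c₂, n₂, reassoc_of% c₅]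
      simp
    _ = _ := by
      simp only [Category.assoc, ← Functor.map_comp]
      rw [reassoc_of% c₁, c₃, ← c₇]
      simp only [Functor.map_comp, Category.assoc] at n₃ ⊢
      rw [← reassoc_of% n₃]
      have c₈ : (Q.split (h := q.then q') (f := q.then ⟨f, hf'⟩) (g := r')
          (whiskerLeftIso q.hom γ' ≪≫ (α_ q.hom f r'.hom).symm) x).hom =
          (Q.comp q q' x).hom ≫ (Q.split (f := ⟨f, hf'⟩) (g := r') γ' _).hom ≫
            (Q.fn r').map (Q.comp q ⟨f, hf'⟩ x).inv := by
        rw [← reassoc_of% c₆, ← Functor.map_comp, Iso.hom_inv_id, CategoryTheory.Functor.map_id,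
          Category.comp_id]
      rw [c₈]
      simp only [Functor.map_comp, Category.assoc]

end MeetGluing

end ExtensionComp

/-! ### The extended gluing data for a pair -/

section Extend

variable {C : Type u₁} [Bicategory.{w₁, v₁} C] {A B : ArrowySub C}
  {E : C → Type u₃} [∀ X, Category.{v₃} (E X)] {P : Act A E} {Q : Act B E} {𝒢 : SquareClass A B}

/-- The hypotheses on a pair of arrowy 2-subcategories that allow to extend gluing data from
2-Cartesian squares to all squares. -/
structure SquaringPair (A B : ArrowySub C) : Prop where
  equiv_left ⦃X Y : C⦄ (e : Bicategory.Equivalence X Y) : A.mem e.hom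
  equiv_right ⦃X Y : C⦄ (e : Bicategory.Equivalence X Y) : B.mem e.hom
  squaring : IsSquaring A B
  squaring_symm : IsSquaring B A
  squaring_left : IsSquaring A (A.inter B)
  squaring_right : IsSquaring B (B.inter A)

theorem SquaringPair.symm (h : SquaringPair A B) : SquaringPair B A :=
  ⟨h.2, h.1, h.4, h.3, h.6, h.5⟩

theorem SquareClass.all_isAll : (SquareClass.all A B).IsAll := ⟨fun _ => trivial⟩

variable [Strict C] [IsLocallyGroupoid C]

namespace MeetGluing

variable (Γ : MeetGluing P Q 𝒢) (h𝒢 : 𝒢.IsCart)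

theorem ext_eq_ext_of_eq (hAB : SquaringPair A B) {X Y Z W : C} {b : A.Hom X Y}
    {q : B.Hom X Z} {a : A.Hom Z W} {p : B.Hom Y W} {S S' : Square b q a p} (h : S = S')
    (d : Decomp S) (d' : Decomp S') : Γ.ext h𝒢 d = Γ.ext h𝒢 d' := by
  subst h
  exact Γ.ext_eq_ext h𝒢 hAB.equiv_left hAB.equiv_right d d'

theorem ext_of_cart (hAB : SquaringPair A B) {X Y Z W : C} {b : A.Hom X Y}
    {q : B.Hom X Z} {a : A.Hom Z W} {p : B.Hom Y W} {S : Square b q a p} (h : S.IsCart)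
    (d : Decomp S) : Γ.ext h𝒢 d = Γ.fill S (h𝒢.mem h) := by
  rw [Γ.ext_eq_ext h𝒢 hAB.equiv_left hAB.equiv_right d h.decomp, Γ.ext_decomp_of_cart]

/-- The transpose of `ext_vcomp`, applied to the transposed decompositions. -/
theorem ext_hcomp (hAB : SquaringPair A B) {X₁ X₂ X₃ Y₁ Y₂ Y₃ : C} {j : A.Hom X₁ X₂}
    {j' : A.Hom X₂ X₃} {i : A.Hom Y₁ Y₂} {i' : A.Hom Y₂ Y₃} {p₁ : B.Hom X₁ Y₁} {p₂ : B.Hom X₂ Y₂}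
    {p₃ : B.Hom X₃ Y₃} {S : Square j p₁ i p₂} {S' : Square j' p₂ i' p₃} (d : Decomp S)
    (d' : Decomp S') (d'' : Decomp (S.hthen S')) (x : E X₁) :
    ((Γ.ext h𝒢 d'').app x).hom ≫ (Q.fn p₃).map (P.comp j j' x).hom =
      (P.comp i i' _).hom ≫ (P.fn i').map ((Γ.ext h𝒢 d).app x).hom ≫
        ((Γ.ext h𝒢 d').app _).hom := by
  obtain ⟨d₀⟩ := hAB.squaring_symm.exists_decomp (S.tr.vthen S'.tr)
  have c := Γ.transpose.ext_vcomp h𝒢.transpose hAB.equiv_right hAB.equiv_left hAB.squaring_symm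
    hAB.squaring_left d.tr d'.tr d₀ x
  rw [← Γ.transpose.ext_eq_ext_of_eq h𝒢.transpose hAB.symm (Square.tr_hthen S S') d''.tr d₀,
    Γ.ext_transpose h𝒢, Γ.ext_transpose h𝒢, Γ.ext_transpose h𝒢, Iso.inv_comp_eq] at c
  rw [reassoc_of% c]
  simp only [← Functor.map_comp_assoc, Iso.inv_hom_id, CategoryTheory.Functor.map_id,
    Category.id_comp, Category.comp_id]

/-- The extension of gluing data to all squares, for a choice of decompositions. -/
def extend (hAB : SquaringPair A B) (dec : ∀ {X Y Z W : C} {b : A.Hom X Y} {q : B.Hom X Z}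
    {a : A.Hom Z W} {p : B.Hom Y W} (S : Square b q a p), Decomp S) :
    SqGluing P Q (.all A B) where
  G S _ x := (Γ.ext h𝒢 (dec S)).app x
  naturality S _ _ _ u := (Γ.ext h𝒢 (dec S)).naturality u
  vId σ _ x := by
    rw [Γ.ext_of_cart h𝒢 hAB (S := Square.vOne B σ) (isTwoCartesian_vId σ)]
    exact Γ.vId σ _ x
  hId σ _ x := by
    rw [Γ.ext_of_cart h𝒢 hAB (S := Square.hOne A σ) (isTwoCartesian_hId σ)]
    exact Γ.hId σ _ x
  vcomp S S' _ _ _ x := Γ.ext_vcomp h𝒢 hAB.equiv_left hAB.equiv_right hAB.squaring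
    hAB.squaring_right (dec S) (dec S') (dec _) x
  hcomp S S' _ _ _ x := Γ.ext_hcomp h𝒢 hAB (dec S) (dec S') (dec _) x

/-- The corner of `f` decomposes along `f` itself through the identity square of `Y`, which is
2-Cartesian and has trivial value; only `ρ f` remains. -/
theorem extend_meet (hAB : SquaringPair A B) (dec : ∀ {X Y Z W : C} {b : A.Hom X Y} {q : B.Hom X Z}
    {a : A.Hom Z W} {p : B.Hom Y W} (S : Square b q a p), Decomp S) {X Y : C} (f : X ⟶ Y)
    (hf : A.mem f) (hf' : B.mem f) (x : E X) :
    ((Γ.extend h𝒢 hAB dec).meet SquareClass.all_isAll f hf hf' x).hom = (Γ.ρ f hf hf' x).hom := by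
  have hS : (Square.vOne B (a := .one A Y) (b := .one A Y) (Iso.refl (𝟙 Y))).IsCart :=
    isTwoCartesian_vId _
  let d : Decomp (Square.cornerOf f hf hf') :=
    { pt := Y
      k := .one A Y
      r := .one B Y
      sq := Square.vOne B (Iso.refl (𝟙 Y))
      cart := hS
      f := f
      hf := hf
      hf' := hf'
      γ := (ρ_ f).symm
      δ := (ρ_ f).symm
      e := by simp [sqAct, unitors_equal] }
  have c₁ := Γ.vId (a := .one A Y) (b := .one A Y) (Iso.refl (𝟙 Y)) (h𝒢.mem hS)
    ((Q.fn ⟨f, hf'⟩).obj x)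
  have c₂ := Γ.push_hom (b := ⟨f, hf⟩) (q := ⟨f, hf'⟩) (k := .one A Y) (r := .one B Y) hf hf'
    (ρ_ f).symm (ρ_ f).symm
    (Γ.fill (Square.vOne B (a := .one A Y) (b := .one A Y) (Iso.refl (𝟙 Y))) (h𝒢.mem hS)) x
  have c₃ := P.split_rightUnitor_symm ⟨f, hf⟩ x
  have c₄ := Q.split_rightUnitor_symm ⟨f, hf'⟩ x
  have c₅ : (P.split (f := ⟨f, hf⟩) (g := .one A Y) (ρ_ f).symm x).inv = (P.unit Y _).hom :=
    congrArg Iso.inv (Iso.ext c₃ : _ = (P.unit Y _).symm)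
  rw [P.cell_refl, Category.comp_id] at c₁
  rw [c₄, c₅, ← Functor.map_comp, P.unit_naturality] at c₂
  rw [SqGluing.meet_hom]
  change _ ≫ ((Γ.ext h𝒢 (dec _)).app x).hom ≫ _ = _
  rw [Γ.ext_eq_ext h𝒢 hAB.equiv_left hAB.equiv_right _ d]
  change _ ≫ ((Γ.push (b := ⟨f, hf⟩) (q := ⟨f, hf'⟩) (k := .one A Y) (r := .one B Y) hf hf'
    (ρ_ f).symm (ρ_ f).symm (Γ.fill (Square.vOne B (a := .one A Y) (b := .one A Y)
      (Iso.refl (𝟙 Y))) (h𝒢.mem hS))).app x).hom ≫ _ = _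
  rw [c₂, Category.assoc, Category.assoc, Q.unit_naturality, reassoc_of% c₁,
    ← Functor.map_comp_assoc, Iso.inv_hom_id, CategoryTheory.Functor.map_id, Category.id_comp,
    Iso.inv_hom_id_assoc]

end MeetGluing

end Extend

/-! ### The hexagon and pasting along morphisms of the intersection -/

section Hexagon

variable {C : Type u₁} [Bicategory.{w₁, v₁} C] {A B A' : ArrowySub C}
  {E : C → Type u₃} [∀ X, Category.{v₃} (E X)] {P : Act A E} {Q : Act B E} {R : Act A' E}
  {𝒢 : SquareClass A B} {𝒢' : SquareClass A A'} {𝒢'' : SquareClass B A'}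

/-- The transposed family. -/
@[reducible]
def Fill.tr {X Y Z W : C} {b : A.Hom X Y} {q : B.Hom X Z} {a : A.Hom Z W} {p : B.Hom Y W}
    (F : Fill P Q b q a p) : Fill Q P q b p a where
  app x := (F.app x).symm
  naturality u := by
    rw [Iso.symm_hom, Iso.symm_hom, Iso.comp_inv_eq, Category.assoc, F.naturality,
      Iso.inv_hom_id_assoc]

section

variable {X Y Z W X' Y' Z' W' : C}
    {b : A.Hom X Y} {q : B.Hom X Z} {a : A.Hom Z W} {p : B.Hom Y W}
    {b' : A.Hom X' Y'} {q' : B.Hom X' Z'} {a' : A.Hom Z' W'} {p' : B.Hom Y' W'}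
    {x : A'.Hom X' X} {y : A'.Hom Y' Y} {z : A'.Hom Z' Z} {w : A'.Hom W' W}

/-- The hexagon of a cube of families. -/
def Hex (K : Fill P Q b q a p) (K' : Fill P Q b' q' a' p') (J : Fill P R a' z a w)
    (J' : Fill P R b' x b y) (I : Fill Q R p' y p w) (I' : Fill Q R q' x q z) : Prop :=
  ∀ t : E X', (P.fn a).map (I'.app t).hom ≫ (J.app ((Q.fn q').obj t)).hom ≫
      (R.fn w).map (K'.app t).hom =
    (K.app ((R.fn x).obj t)).hom ≫ (Q.fn p).map (J'.app t).hom ≫ (I.app ((P.fn b').obj t)).hom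

variable {K : Fill P Q b q a p} {K' : Fill P Q b' q' a' p'} {J : Fill P R a' z a w}
    {J' : Fill P R b' x b y} {I : Fill Q R p' y p w} {I' : Fill Q R q' x q z}

theorem Hex.swap_fst_snd (h : Hex K K' J J' I I') : Hex K.tr K'.tr I I' J J' := by
  intro t
  have := h t
  simp only [Iso.symm_hom]
  rw [← cancel_epi (K.app ((R.fn x).obj t)).hom, Iso.hom_inv_id_assoc,
    ← reassoc_of% this, ← Functor.map_comp, Iso.hom_inv_id, CategoryTheory.Functor.map_id,
    Category.comp_id]

theorem Hex.swap_snd_trd (h : Hex K K' J J' I I') : Hex J J' K K' I.tr I'.tr := by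
  intro t
  have := h t
  simp only [Iso.symm_hom]
  rw [← cancel_epi ((P.fn a).map (I'.app t).hom), reassoc_of% this, Iso.hom_inv_id,
    Category.comp_id, ← Functor.map_comp_assoc, Iso.hom_inv_id, CategoryTheory.Functor.map_id,
    Category.id_comp]

end

/-- On all squares the auxiliary square of `form` is always admissible, so the pasting formula holds
for every decomposition. This is the uniqueness of the extension. -/
theorem MeetGluing.fill_eq_push [Strict C] (Γ : MeetGluing P Q 𝒢) (h𝒢 : 𝒢.IsAll)
    {X X' Y Z W : C} {b : A.Hom X Y} {q : B.Hom X Z} {a : A.Hom Z W} {p : B.Hom Y W}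
    {k : A.Hom X' Y} {r : B.Hom X' Z} {f : X ⟶ X'} (hf : A.mem f) (hf' : B.mem f)
    {S : Square b q a p} {S' : Square k r a p} (h : 𝒢.mem S) (h' : 𝒢.mem S')
    (γ : q.hom ≅ f ≫ r.hom) (δ : b.hom ≅ f ≫ k.hom)
    (e : S.cell.hom ≫ δ.hom ▷ p.hom = γ.hom ▷ a.hom ≫ (sqAct S'.cell f).hom) :
    Γ.fill S h = Γ.push hf hf' γ δ (Γ.fill S' h') := by
  refine Fill.hom_ext fun x => ?_
  have c₁ := Γ.form hf hf' (R := ⟨δ.symm ≪≫ (ρ_ b.hom).symm⟩) h h' (h𝒢.mem _) γ δ (by simp)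
    (by rw [e]; simp [sqAct]) x
  have c₂ := Γ.push_hom_map hf hf' γ δ (Γ.fill S' h') x
  rw [← c₂] at c₁
  rwa [cancel_mono] at c₁

/-- The outer cube is the inner one with a prism over `M` attached: its left and back faces are `M`
pasted with `I₁` and with `J₁`. In the first `M` is read as a `(B, A')`-square, in the second as an
`(A, A')`-square, and `eM` says that `ρ` intertwines the two values. -/
theorem hex_push [Strict C] (Γ : MeetGluing P Q 𝒢) (Λ : SqGluing P R 𝒢') (Θ : SqGluing Q R 𝒢'')
    (h𝒢' : 𝒢'.IsAll) (h𝒢'' : 𝒢''.IsAll) {X Y Z W X' Y' Z' W' V V' : C}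
    {b : A.Hom X Y} {q : B.Hom X Z} {a : A.Hom Z W} {p : B.Hom Y W}
    {b' : A.Hom X' Y'} {q' : B.Hom X' Z'} {a' : A.Hom Z' W'} {p' : B.Hom Y' W'}
    {x : A'.Hom X' X} {y : A'.Hom Y' Y} {z : A'.Hom Z' Z} {w : A'.Hom W' W}
    {J : Fill P R a' z a w} {J' : Square b' x b y} {I : Fill Q R p' y p w} {I' : Square q' x q z}
    {c : A.Hom V Y} {r : B.Hom V Z} {c' : A.Hom V' Y'} {r' : B.Hom V' Z'} {v : A'.Hom V' V}
    {f : X ⟶ V} {hf : A.mem f} {hf' : B.mem f} {f' : X' ⟶ V'} {hg : A.mem f'} {hg' : B.mem f'}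
    {L : Fill P Q c r a p} {L' : Fill P Q c' r' a' p'} {J₁ : Square c' v c y}
    {I₁ : Square r' v r z} {M : x.hom ≫ f ≅ f' ≫ v.hom}
    {γ : q.hom ≅ f ≫ r.hom} {δ : b.hom ≅ f ≫ c.hom} {γ' : q'.hom ≅ f' ≫ r'.hom}
    {δ' : b'.hom ≅ f' ≫ c'.hom}
    (eI : I'.cell.hom ≫ γ'.hom ▷ z.hom = x.hom ◁ γ.hom ≫ (hpaste M I₁.cell).hom)
    (eJ : J'.cell.hom ≫ δ'.hom ▷ y.hom = x.hom ◁ δ.hom ≫ (hpaste M J₁.cell).hom)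
    (eM : ∀ t, (Γ.ρ f hf hf' ((R.fn x).obj t)).hom ≫
        (Λ.G (b := ⟨f', hg⟩) (a := ⟨f, hf⟩) ⟨M⟩ (h𝒢'.mem _) t).hom =
      (Θ.G (b := ⟨f', hg'⟩) (a := ⟨f, hf'⟩) ⟨M⟩ (h𝒢''.mem _) t).hom ≫
        (R.fn v).map (Γ.ρ f' hg hg' t).hom)
    (h : Hex L L' J (Λ.fill J₁ (h𝒢'.mem _)) I (Θ.fill I₁ (h𝒢''.mem _))) :
    Hex (Γ.push hf hf' γ δ L) (Γ.push hg hg' γ' δ' L') J (Λ.fill J' (h𝒢'.mem _)) I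
      (Θ.fill I' (h𝒢''.mem _)) := by
  intro t
  have c₁ := Γ.push_hom_map hf hf' γ δ L ((R.fn x).obj t)
  have c₂ := Γ.push_hom_map hg hg' γ' δ' L' t
  have c₃ := Θ.hcomp' (S := ⟨M⟩) (j := ⟨f', hg'⟩) (i := ⟨f, hf'⟩) (S' := I₁) (T := I')
    (h𝒢''.mem _) (h𝒢''.mem _) (h𝒢''.mem _) γ' γ eI t
  have c₄ := Λ.hcomp' (S := ⟨M⟩) (j := ⟨f', hg⟩) (i := ⟨f, hf⟩) (S' := J₁) (T := J')
    (h𝒢'.mem _) (h𝒢'.mem _) (h𝒢'.mem _) δ' δ eJ t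
  have c₅ := h ((Q.fn ⟨f', hg'⟩).obj t)
  have n₁ := J.naturality (Q.split (f := ⟨f', hg'⟩) γ' t).hom
  have n₂ := I.naturality ((P.fn c').map (Γ.ρ f' hg hg' t).hom)
  have n₃ := Λ.naturality J₁ (h𝒢'.mem _) (Γ.ρ f' hg hg' t).hom
  have n₄ := L.naturality (Θ.G (b := ⟨f', hg'⟩) (a := ⟨f, hf'⟩) (p := v) ⟨M⟩ (h𝒢''.mem _) t).hom
  have n₅ := I.naturality (P.split (f := ⟨f', hg⟩) δ' t).hom
  rw [← cancel_mono ((R.fn w).map ((Q.fn p').map (P.split (f := ⟨f', hg⟩) δ' t).hom))]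
  calc
    -- The inner hexagon is applied here; `ρ f'` then has to be carried across the remaining faces.
    _ = (P.fn a).map (Q.split (f := ⟨f, hf'⟩) γ _).hom ≫
        (P.fn a).map ((Q.fn r).map (Θ.G (b := ⟨f', hg'⟩) (a := ⟨f, hf'⟩) (p := v) ⟨M⟩
          (h𝒢''.mem _) t).hom) ≫ (L.app _).hom ≫
          (Q.fn p).map (Λ.G J₁ (h𝒢'.mem _) _).hom ≫ (I.app _).hom ≫
            (R.fn w).map ((Q.fn p').map ((P.fn c').map (Γ.ρ f' hg hg' t).hom)) := by
      have c₆ := congrArg (P.fn a).map c₃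
      simp only [Functor.map_comp] at c₆
      rw [← reassoc_of% c₅, ← reassoc_of% c₆, reassoc_of% n₁, Category.assoc, Category.assoc]
      simp only [← Functor.map_comp]
      rw [c₂]
    _ = _ := by
      rw [← n₂, reassoc_of% n₄]
      simp only [Category.assoc]
      rw [← n₅]
      simp only [← Functor.map_comp_assoc]
      rw [c₄, Functor.map_comp (Q.fn p) (P.split (f := ⟨f, hf⟩) δ _).hom, Category.assoc,
        reassoc_of% c₁]
      simp only [← Functor.map_comp_assoc]
      rw [← n₃]
      have c₆ := congrArg (P.fn c).map (eM t)
      simp only [Functor.map_comp] at c₆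
      simp only [Functor.map_comp, Category.assoc]
      rw [← Functor.map_comp_assoc (Q.fn p), ← c₆]
      simp only [Functor.map_comp, Category.assoc]

end Hexagon

/-! ### 2-Cartesian faces of commutative cubes -/

section CartesianCubes

variable {C : Type u₁} [Bicategory.{w₁, v₁} C] [IsLocallyGroupoid C]
  {X Y Z W X' Y' Z' W' : C}
  {a : Z ⟶ W} {b : X ⟶ Y} {a' : Z' ⟶ W'} {b' : X' ⟶ Y'}
  {p : Y ⟶ W} {q : X ⟶ Z} {p' : Y' ⟶ W'} {q' : X' ⟶ Z'}
  {x : X' ⟶ X} {y : Y' ⟶ Y} {z : Z' ⟶ Z} {w : W' ⟶ W}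
  {K : q ≫ a ≅ b ≫ p} {K' : q' ≫ a' ≅ b' ≫ p'}
  {J : z ≫ a ≅ a' ≫ w} {J' : x ≫ b ≅ b' ≫ y}
  {I : y ≫ p ≅ p' ≫ w} {I' : x ≫ q ≅ q' ≫ z}

/-- The hexagon identifies the pasting of `J'` and `K`, which is 2-Cartesian, with that of `K'` and
`J`; cancelling `J` leaves `K'`. -/
theorem CubeComm.isTwoCartesian_top (h : CubeComm K K' J J' I I') (hK : IsTwoCartesian K)
    (hJ : IsTwoCartesian J) (hJ' : IsTwoCartesian J') : IsTwoCartesian K' := by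
  refine IsTwoCartesian.of_vpaste (S' := J) hJ ?_
  refine IsTwoCartesian.of_iso (hJ'.vpaste hK) I' (Iso.refl _) (Iso.refl _) I ?_
  simp only [CubeComm] at h
  simp only [vpaste, Iso.trans_hom, whiskerLeftIso_hom, whiskerRightIso_hom, Iso.symm_hom,
    Category.assoc, Iso.refl_hom, id_whiskerRight, whiskerLeft_id, Category.id_comp]
  rw [← h]
  simp

theorem CubeComm.isTwoCartesian_back (h : CubeComm K K' J J' I I') (hK : IsTwoCartesian K)
    (hJ : IsTwoCartesian J) (hK' : IsTwoCartesian K') : IsTwoCartesian J' :=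
  h.swap_snd_trd.isTwoCartesian_top hJ hK hK'

end CartesianCubes

/-! ### Three subcategories: compatibility with `ρ`, and reduction of the hexagon to 2-Cartesian
cubes -/

section Triples

variable {C : Type u₁} [Bicategory.{w₁, v₁} C] {A B A' : ArrowySub C}
  {E : C → Type u₃} [∀ X, Category.{v₃} (E X)] {P : Act A E} {Q : Act B E} {R : Act A' E}
  {𝒢 : SquareClass A B} {𝒢' : SquareClass A A'} {𝒢'' : SquareClass B A'}

/-- Compatibility of the identification of the actions of `A ∩ B` with gluing data. -/
structure MeetCompat (Γ : MeetGluing P Q 𝒢) (Λ : SqGluing P R 𝒢') (Θ : SqGluing Q R 𝒢'') :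
    Prop where
  eq {X X' V V' : C} {f : X ⟶ V} (hf : A.mem f) (hf' : B.mem f) {f' : X' ⟶ V'} (hg : A.mem f')
    (hg' : B.mem f') {x : A'.Hom X' X} {v : A'.Hom V' V} (M : x.hom ≫ f ≅ f' ≫ v.hom)
    (h : 𝒢'.mem (b := ⟨f', hg⟩) (a := ⟨f, hf⟩) ⟨M⟩)
    (h' : 𝒢''.mem (b := ⟨f', hg'⟩) (a := ⟨f, hf'⟩) ⟨M⟩) (t : E X') :
    (Γ.ρ f hf hf' ((R.fn x).obj t)).hom ≫
        (Λ.G (b := ⟨f', hg⟩) (a := ⟨f, hf⟩) ⟨M⟩ h t).hom =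
      (Θ.G (b := ⟨f', hg'⟩) (a := ⟨f, hf'⟩) ⟨M⟩ h' t).hom ≫
        (R.fn v).map (Γ.ρ f' hg hg' t).hom

/-- The hexagon condition for the commutative cubes with faces in the given classes. -/
structure HexAll (Γ : SqGluing P Q 𝒢) (Λ : SqGluing P R 𝒢') (Θ : SqGluing Q R 𝒢'') : Prop where
  hex {X Y Z W X' Y' Z' W' : C}
    {b : A.Hom X Y} {q : B.Hom X Z} {a : A.Hom Z W} {p : B.Hom Y W}
    {b' : A.Hom X' Y'} {q' : B.Hom X' Z'} {a' : A.Hom Z' W'} {p' : B.Hom Y' W'}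
    {x : A'.Hom X' X} {y : A'.Hom Y' Y} {z : A'.Hom Z' Z} {w : A'.Hom W' W}
    {K : Square b q a p} {K' : Square b' q' a' p'} {J : Square a' z a w}
    {J' : Square b' x b y} {I : Square p' y p w} {I' : Square q' x q z}
    (hK : 𝒢.mem K) (hK' : 𝒢.mem K') (hJ : 𝒢'.mem J) (hJ' : 𝒢'.mem J') (hI : 𝒢''.mem I)
    (hI' : 𝒢''.mem I') (comm : CubeComm K.cell K'.cell J.cell J'.cell I.cell I'.cell) :
    Hex (Γ.fill K hK) (Γ.fill K' hK') (Λ.fill J hJ) (Λ.fill J' hJ') (Θ.fill I hI) (Θ.fill I' hI')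

namespace HexAll

variable {Γ : SqGluing P Q 𝒢} {Λ : SqGluing P R 𝒢'} {Θ : SqGluing Q R 𝒢''}

theorem swap_fst_snd (h : HexAll Γ Λ Θ) : HexAll Γ.transpose Θ Λ where
  hex hK hK' hJ hJ' hI hI' comm := (h.hex hK hK' hI hI' hJ hJ' comm.swap_fst_snd).swap_fst_snd

theorem swap_snd_trd (h : HexAll Γ Λ Θ) : HexAll Λ Γ Θ.transpose where
  hex hK hK' hJ hJ' hI hI' comm := (h.hex hJ hJ' hK hK' hI hI' comm.swap_snd_trd).swap_snd_trd

/-- Condition (E) is the hexagon of the degenerate cube with the corners of `f` and `f'` as bottom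
and top, identity squares of `v` as front and right faces, and `M` as both back and left face. -/
theorem meetCompat [Strict C] (h : HexAll Γ Λ Θ) (h𝒢 : 𝒢.IsAll) :
    MeetCompat (Γ.toMeetGluing h𝒢) Λ Θ where
  eq {X X' V V' f} hf hf' {f'} hg hg' {x v} M hM hM' t := by
    have c := h.hex (K := Square.cornerOf f hf hf') (K' := Square.cornerOf f' hg hg')
      (J := Square.hOne A (Iso.refl v.hom)) (J' := ⟨M⟩) (I := Square.hOne B (Iso.refl v.hom))
      (I' := ⟨M⟩) (h𝒢.mem _) (h𝒢.mem _) (𝒢'.hId_mem _) hM (𝒢''.hId_mem _) hM'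
      (by simp [CubeComm]) t
    have c₁ := Λ.hId (Iso.refl v.hom) (𝒢'.hId_mem _) ((Q.fn ⟨f', hg'⟩).obj t)
    have c₂ := Θ.hId (Iso.refl v.hom) (𝒢''.hId_mem _) ((P.fn ⟨f', hg⟩).obj t)
    rw [R.cell_refl, Category.comp_id] at c₁ c₂
    have c₃ := P.unit_naturality
      (Θ.G (b := ⟨f', hg'⟩) (a := ⟨f, hf'⟩) ⟨M⟩ hM' t).hom
    have c₄ := Q.unit_naturality
      (Λ.G (b := ⟨f', hg⟩) (a := ⟨f, hf⟩) ⟨M⟩ hM t).hom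
    change (Γ.meet h𝒢 f hf hf' _).hom ≫ _ = _ ≫ (R.fn v).map (Γ.meet h𝒢 f' hg hg' t).hom
    rw [SqGluing.meet_hom, SqGluing.meet_hom, ← cancel_epi (P.unit V _).hom]
    simp only [Functor.map_comp, Category.assoc, Iso.hom_inv_id_assoc]
    rw [← c₄, ← c₂, ← reassoc_of% c, ← reassoc_of% c₃, ← reassoc_of% c₁]
    rw [← Functor.map_comp_assoc _ (P.unit V' _).hom (P.unit V' _).inv, Iso.hom_inv_id,
      CategoryTheory.Functor.map_id, Category.id_comp]

end HexAll

/-- The corner of `f` can be read both as an `(A, A')`-square and as a `(B, A')`-square;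
compatibility with `ρ` there, where the bottom edge is an identity, is the cocycle condition. -/
theorem MeetCompat.cocycle [Strict C] {Γ : MeetGluing P Q 𝒢} {Λ : SqGluing P R 𝒢'}
    {Θ : SqGluing Q R 𝒢''} (h : MeetCompat Γ Λ Θ) (h𝒢' : 𝒢'.IsAll) (h𝒢'' : 𝒢''.IsAll)
    {X Y : C} (f : X ⟶ Y) (hf : A.mem f) (hf' : B.mem f) (hf'' : A'.mem f) (t : E X) :
    (Λ.meet h𝒢' f hf hf'' t).hom =
      (Θ.meet h𝒢'' f hf' hf'' t).hom ≫ (Γ.ρ f hf hf' t).hom := by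
  have c := h.eq (A.id_mem Y) (B.id_mem Y) hf hf' (x := ⟨f, hf''⟩) (v := .one A' Y)
    (Iso.refl (f ≫ 𝟙 Y)) (h𝒢'.mem _) (h𝒢''.mem _) t
  have c₁ := Γ.ρ_unit Y ((R.fn ⟨f, hf''⟩).obj t)
  have c₂ := R.unit_naturality (Γ.ρ f hf hf' t).hom
  rw [SqGluing.meet_hom, SqGluing.meet_hom, ← cancel_epi (Q.unit Y _).hom, ← c₁]
  simp only [Category.assoc, Iso.hom_inv_id_assoc]
  rw [← c₂, reassoc_of% c₁, Iso.hom_inv_id_assoc, reassoc_of% c]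

/-- A square between `A ∩ B` and `A'` factors through a 2-Cartesian one along a morphism `g` of the
triple intersection. The pasting formula computes the values of `Λ` and `Θ`; what remains is the
hypothesis on the 2-Cartesian square and the cocycle condition at `g`. -/
theorem MeetCompat.of_cart [Strict C] {Γ : MeetGluing P Q 𝒢} {Λ : MeetGluing P R 𝒢'}
    {Θ : MeetGluing Q R 𝒢''} (h𝒢' : 𝒢'.IsAll) (h𝒢'' : 𝒢''.IsAll)
    (hsq : IsSquaring (A.inter B) A')
    (hc : ∀ {X Y : C} (f : X ⟶ Y) (hf : A.mem f) (hf' : B.mem f) (hf'' : A'.mem f) (t : E X),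
      (Λ.ρ f hf hf'' t).hom = (Θ.ρ f hf' hf'' t).hom ≫ (Γ.ρ f hf hf' t).hom)
    (hM : ∀ {X X' V V' : C} {f : X ⟶ V} (hf : A.mem f) (hf' : B.mem f) {f' : X' ⟶ V'}
      (hg : A.mem f') (hg' : B.mem f') {x : A'.Hom X' X} {v : A'.Hom V' V}
      (M : x.hom ≫ f ≅ f' ≫ v.hom) (_ : IsTwoCartesian M) (t : E X'),
      (Γ.ρ f hf hf' ((R.fn x).obj t)).hom ≫
        (Λ.G (b := ⟨f', hg⟩) (a := ⟨f, hf⟩) ⟨M⟩ (h𝒢'.mem _) t).hom =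
      (Θ.G (b := ⟨f', hg'⟩) (a := ⟨f, hf'⟩) ⟨M⟩ (h𝒢''.mem _) t).hom ≫
        (R.fn v).map (Γ.ρ f' hg hg' t).hom) :
    MeetCompat Γ Λ.toSqGluing Θ.toSqGluing where
  eq {X X' V V' f} hf hf' {f'} hg hg' {x v} M _ _ t := by
    obtain ⟨pt, ⟨k, hk, hk'⟩, r, ⟨N⟩, cart, g, ⟨h₁, h₂⟩, h₃, γ, δ, e⟩ := hsq.exists_decomp
      (A := A.inter B) (b := ⟨f', hg, hg'⟩) (q := x) (a := ⟨f, hf, hf'⟩) (p := v) ⟨M⟩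
    dsimp only at N e γ δ
    have c₁ := Λ.push_hom_map (b := ⟨f', hg⟩) (a := ⟨f, hf⟩) (k := ⟨k, hk⟩) h₁ h₃ γ δ
      (Λ.fill ⟨N⟩ (h𝒢'.mem _)) t
    rw [← Λ.fill_eq_push (b := ⟨f', hg⟩) (a := ⟨f, hf⟩) (k := ⟨k, hk⟩) (S := ⟨M⟩) h𝒢' h₁ h₃
      (h𝒢'.mem _) (h𝒢'.mem _) γ δ e] at c₁
    have c₂ := Θ.push_hom_map (b := ⟨f', hg'⟩) (a := ⟨f, hf'⟩) (k := ⟨k, hk'⟩) h₂ h₃ γ δ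
      (Θ.fill ⟨N⟩ (h𝒢''.mem _)) t
    rw [← Θ.fill_eq_push (b := ⟨f', hg'⟩) (a := ⟨f, hf'⟩) (k := ⟨k, hk'⟩) (S := ⟨M⟩) h𝒢'' h₂ h₃
      (h𝒢''.mem _) (h𝒢''.mem _) γ δ e] at c₂
    have c₃ := hM hf hf' hk hk' N cart ((R.fn ⟨g, h₃⟩).obj t)
    have c₄ := Γ.ρ_split h₁ h₂ hk hk' hg hg' δ t
    have c₅ := Γ.ρ_naturality f hf hf' (R.split (f := ⟨g, h₃⟩) γ t).hom
    have c₆ := Γ.ρ_naturality k hk hk' (Λ.ρ g h₁ h₃ t).hom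
    have c₇ := Γ.ρ_naturality k hk hk' (Γ.ρ g h₁ h₂ t).hom
    rw [← cancel_mono ((R.fn v).map (P.split (h := ⟨f', hg⟩) (f := ⟨g, h₁⟩) (g := ⟨k, hk⟩) δ
      t).hom), Category.assoc, Category.assoc, ← Functor.map_comp, c₄, c₁, ← reassoc_of% c₅,
      reassoc_of% c₃]
    simp only [Functor.map_comp] at c₂ ⊢
    -- The cocycle condition at `g` splits the identification used by `Λ` into those used by `Θ` and
    -- `Γ`.
    rw [reassoc_of% c₂, ← Functor.map_comp, ← c₆, hc g h₁ h₂ h₃]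
    simp only [Functor.map_comp, Category.assoc]

section

variable [Strict C] {Γ : MeetGluing P Q 𝒢} {Λ : MeetGluing P R 𝒢'} {Θ : MeetGluing Q R 𝒢''}
  (h𝒢 : 𝒢.IsAll) (h𝒢' : 𝒢'.IsAll) (h𝒢'' : 𝒢''.IsAll)

/-- It suffices to check the hexagon condition on cubes with 2-Cartesian bottom and top. -/
theorem hex_of_inner (hM : MeetCompat Γ Λ.toSqGluing Θ.toSqGluing) (hsq : IsCubeSquaring A B A')
    {X Y Z W X' Y' Z' W' : C}
    {b : A.Hom X Y} {q : B.Hom X Z} {a : A.Hom Z W} {p : B.Hom Y W}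
    {b' : A.Hom X' Y'} {q' : B.Hom X' Z'} {a' : A.Hom Z' W'} {p' : B.Hom Y' W'}
    {x : A'.Hom X' X} {y : A'.Hom Y' Y} {z : A'.Hom Z' Z} {w : A'.Hom W' W}
    {K : Square b q a p} {K' : Square b' q' a' p'} {J : Square a' z a w}
    {J' : Square b' x b y} {I : Square p' y p w} {I' : Square q' x q z}
    (comm : CubeComm K.cell K'.cell J.cell J'.cell I.cell I'.cell)
    (H : ∀ {V V' : C} {c : A.Hom V Y} {r : B.Hom V Z} {c' : A.Hom V' Y'} {r' : B.Hom V' Z'}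
      {v : A'.Hom V' V} (L : Square c r a p) (L' : Square c' r' a' p') (J₁ : Square c' v c y)
      (I₁ : Square r' v r z), L.IsCart → L'.IsCart →
      CubeComm L.cell L'.cell J.cell J₁.cell I.cell I₁.cell →
      Hex (Γ.fill L (h𝒢.mem _)) (Γ.fill L' (h𝒢.mem _)) (Λ.fill J (h𝒢'.mem _))
        (Λ.fill J₁ (h𝒢'.mem _)) (Θ.fill I (h𝒢''.mem _)) (Θ.fill I₁ (h𝒢''.mem _))) :
    Hex (Γ.fill K (h𝒢.mem _)) (Γ.fill K' (h𝒢.mem _)) (Λ.fill J (h𝒢'.mem _))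
      (Λ.fill J' (h𝒢'.mem _)) (Θ.fill I (h𝒢''.mem _)) (Θ.fill I' (h𝒢''.mem _)) := by
  obtain ⟨V, V', c, r, c', r', v, ⟨f, hf, hf'⟩, ⟨f', hg, hg'⟩, L, L', J₁, I₁, ⟨M⟩, γ, δ, γ', δ',
    hL, hL', hin, eK, eK', eI, eJ⟩ := hsq K K' J J' I I' comm
  dsimp only [Square.DecomposesAs] at M γ δ γ' δ' eK eK' eI eJ
  rw [Γ.fill_eq_push (S' := L) h𝒢 hf hf' (h𝒢.mem K) (h𝒢.mem L) γ δ.symm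
      (by rw [eK]; simp [sqAct]),
    Γ.fill_eq_push (S' := L') h𝒢 hg hg' (h𝒢.mem K') (h𝒢.mem L') γ' δ'.symm
      (by rw [eK']; simp [sqAct])]
  exact hex_push (M := M) (J₁ := J₁) (I₁ := I₁) Γ Λ.toSqGluing Θ.toSqGluing h𝒢' h𝒢''
    (by rw [eI]; simp [hpaste]) (by rw [eJ]; simp [hpaste])
    (fun t => hM.eq hf hf' hg hg' M _ _ t) (H L L' J₁ I₁ hL hL' hin)

/-- The hexagon condition for all cubes follows from the case of cubes with 2-Cartesian faces. -/
theorem HexAll.of_cart [IsLocallyGroupoid C] (hM : MeetCompat Γ Λ.toSqGluing Θ.toSqGluing)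
    (hM' : MeetCompat Λ Γ.toSqGluing Θ.transpose.toSqGluing)
    (hM'' : MeetCompat Θ Γ.transpose.toSqGluing Λ.transpose.toSqGluing)
    (hsq : IsCubeSquaring A B A') (hsq' : IsCubeSquaring A A' B) (hsq'' : IsCubeSquaring B A' A)
    (H : ∀ {X Y Z W X' Y' Z' W' : C}
      {b : A.Hom X Y} {q : B.Hom X Z} {a : A.Hom Z W} {p : B.Hom Y W}
      {b' : A.Hom X' Y'} {q' : B.Hom X' Z'} {a' : A.Hom Z' W'} {p' : B.Hom Y' W'}
      {x : A'.Hom X' X} {y : A'.Hom Y' Y} {z : A'.Hom Z' Z} {w : A'.Hom W' W}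
      (K : Square b q a p) (K' : Square b' q' a' p') (J : Square a' z a w)
      (J' : Square b' x b y) (I : Square p' y p w) (I' : Square q' x q z)
      (_ : K.IsCart) (_ : K'.IsCart) (_ : J.IsCart) (_ : J'.IsCart) (_ : I.IsCart)
      (_ : I'.IsCart) (_ : CubeComm K.cell K'.cell J.cell J'.cell I.cell I'.cell),
      Hex (Γ.fill K (h𝒢.mem _)) (Γ.fill K' (h𝒢.mem _)) (Λ.fill J (h𝒢'.mem _))
        (Λ.fill J' (h𝒢'.mem _)) (Θ.fill I (h𝒢''.mem _)) (Θ.fill I' (h𝒢''.mem _))) :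
    HexAll Γ.toSqGluing Λ.toSqGluing Θ.toSqGluing where
  hex _ _ _ _ _ _ comm := by
    -- A reduction replaces the bottom and top by 2-Cartesian squares and changes the back and left
    -- faces, but keeps the front and right ones. After the three directions have taken their turn,
    -- all three faces at the terminal vertex are therefore 2-Cartesian.
    refine hex_of_inner h𝒢 h𝒢' h𝒢'' hM hsq comm fun L L' J₁ I₁ hL hL' c₁ => ?_
    refine (hex_of_inner (Θ := Θ.transpose) h𝒢' h𝒢 h𝒢''.transpose hM' hsq' c₁.swap_snd_trd
      (K := _) (K' := _) (J := _) (J' := _) (I := Square.tr _) (I' := Square.tr _)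
      fun J J₁ K' I₁ hJ hJ₁ c₂ => ?_).swap_snd_trd
    refine (hex_of_inner (Γ := Θ) (Λ := Γ.transpose) (Θ := Λ.transpose) h𝒢'' h𝒢.transpose
      h𝒢'.transpose hM'' hsq'' c₂.swap_snd_trd.swap_fst_snd.swap_snd_trd
      (J := Square.tr _) (J' := Square.tr _) (I := Square.tr _) (I' := Square.tr _)
      fun I I₁ K' J₁ hI hI₁ c₃ => ?_).swap_snd_trd.swap_fst_snd.swap_snd_trd
    -- The cube in its original orientation. Bottom, front, right and left faces are 2-Cartesian;
    -- the top follows from bottom, right and left, and the back from bottom, front and top.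
    have c₄ := c₃.swap_snd_trd.swap_fst_snd
    have h₁ := (c₄.swap_fst_snd.isTwoCartesian_top (IsTwoCartesian.symm hL) hI hI₁).symm
    have h₂ := c₄.isTwoCartesian_back hL hJ h₁
    exact (H L (Square.tr K') J (Square.tr J₁) I I₁ hL h₁ hJ h₂ hI hI₁
      c₄).swap_fst_snd.swap_snd_trd

end

end Triples

/-! ### Construction of data on 2-Cartesian squares -/

section CartMeetGluing

variable {C : Type u₁} [Bicategory.{w₁, v₁} C] {A B : ArrowySub C}
  {E : C → Type u₃} [∀ X, Category.{v₃} (E X)] {P : Act A E} {Q : Act B E} {𝒢 : SquareClass A B}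

theorem Act.split_inv_split (P : Act A E) {X Y Z W : C} {m : A.Hom X W} {q : A.Hom X Z}
    {a : A.Hom Z W} {b : A.Hom X Y} {p : A.Hom Y W} (σ : q.hom ≫ a.hom ≅ b.hom ≫ p.hom)
    (μ : m.hom ≅ q.hom ≫ a.hom) (ν : m.hom ≅ b.hom ≫ p.hom) (e : ν.hom = μ.hom ≫ σ.hom) (x : E X) :
    (P.split μ x).inv ≫ (P.split ν x).hom =
      (P.comp q a x).inv ≫ (P.cell (f := q.then a) (g := b.then p) σ x).hom ≫
        (P.comp b p x).hom := by
  have := P.cell_cell (g := q.then a) (h := b.then p) μ σ (ζ := ν) e.symm x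
  simp only [split, Iso.trans_hom, Iso.trans_inv, Category.assoc, ← this]
  simp

/-- Gluing data on the 2-Cartesian squares. Compatibility with the squares with a pair of identity
edges is automatic. -/
@[reducible]
def MeetGluing.ofCart
    (G : ∀ {X Y Z W : C} {b : A.Hom X Y} {q : B.Hom X Z} {a : A.Hom Z W} {p : B.Hom Y W}
      (S : Square b q a p) (_ : S.IsCart) (x : E X),
      (P.fn a).obj ((Q.fn q).obj x) ≅ (Q.fn p).obj ((P.fn b).obj x))
    (naturality : ∀ {X Y Z W : C} {b : A.Hom X Y} {q : B.Hom X Z} {a : A.Hom Z W} {p : B.Hom Y W}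
      (S : Square b q a p) (h : S.IsCart) {x y : E X} (u : x ⟶ y),
      (P.fn a).map ((Q.fn q).map u) ≫ (G S h y).hom = (G S h x).hom ≫ (Q.fn p).map ((P.fn b).map u))
    (vcomp : ∀ {X₁ X₂ X₃ Y₁ Y₂ Y₃ : C} {i₁ : A.Hom X₁ Y₁} {i₂ : A.Hom X₂ Y₂} {i₃ : A.Hom X₃ Y₃}
      {q : B.Hom X₁ X₂} {q' : B.Hom X₂ X₃} {p : B.Hom Y₁ Y₂} {p' : B.Hom Y₂ Y₃}
      (S : Square i₁ q i₂ p) (S' : Square i₂ q' i₃ p') (h : S.IsCart) (h' : S'.IsCart)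
      (h'' : (S.vthen S').IsCart) (x : E X₁),
      (G (S.vthen S') h'' x).hom ≫ (Q.comp p p' _).hom =
        (P.fn i₃).map (Q.comp q q' x).hom ≫ (G S' h' _).hom ≫ (Q.fn p').map (G S h x).hom)
    (hcomp : ∀ {X₁ X₂ X₃ Y₁ Y₂ Y₃ : C} {j : A.Hom X₁ X₂} {j' : A.Hom X₂ X₃} {i : A.Hom Y₁ Y₂}
      {i' : A.Hom Y₂ Y₃} {p₁ : B.Hom X₁ Y₁} {p₂ : B.Hom X₂ Y₂} {p₃ : B.Hom X₃ Y₃}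
      (S : Square j p₁ i p₂) (S' : Square j' p₂ i' p₃) (h : S.IsCart) (h' : S'.IsCart)
      (h'' : (S.hthen S').IsCart) (x : E X₁),
      (G (S.hthen S') h'' x).hom ≫ (Q.fn p₃).map (P.comp j j' x).hom =
        (P.comp i i' _).hom ≫ (P.fn i').map (G S h x).hom ≫ (G S' h' _).hom)
    (ρ : ∀ {X Y : C} (f : X ⟶ Y) (hA : A.mem f) (hB : B.mem f) (x : E X),
      (Q.fn ⟨f, hB⟩).obj x ≅ (P.fn ⟨f, hA⟩).obj x)
    (ρ_naturality : ∀ {X Y : C} (f : X ⟶ Y) (hA : A.mem f) (hB : B.mem f) {x y : E X} (u : x ⟶ y),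
      (Q.fn ⟨f, hB⟩).map u ≫ (ρ f hA hB y).hom = (ρ f hA hB x).hom ≫ (P.fn ⟨f, hA⟩).map u)
    (ρ_cell : ∀ {X Y : C} {f g : X ⟶ Y} (hA : A.mem f) (hB : B.mem f) (hA' : A.mem g)
      (hB' : B.mem g) (η : f ≅ g) (x : E X),
      (Q.cell (f := ⟨f, hB⟩) (g := ⟨g, hB'⟩) η x).hom ≫ (ρ g hA' hB' x).hom =
        (ρ f hA hB x).hom ≫ (P.cell (f := ⟨f, hA⟩) (g := ⟨g, hA'⟩) η x).hom)
    (ρ_unit : ∀ (X : C) (x : E X),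
      (ρ (𝟙 X) (A.id_mem X) (B.id_mem X) x).hom ≫ (P.unit X x).hom = (Q.unit X x).hom)
    (ρ_comp : ∀ {X Y Z : C} {f : X ⟶ Y} (hA : A.mem f) (hB : B.mem f)
      {g : Y ⟶ Z} (hA' : A.mem g) (hB' : B.mem g) (x : E X),
      (ρ (f ≫ g) (A.comp_mem hA hA') (B.comp_mem hB hB') x).hom ≫
          (P.comp ⟨f, hA⟩ ⟨g, hA'⟩ x).hom =
        (Q.comp ⟨f, hB⟩ ⟨g, hB'⟩ x).hom ≫ (Q.fn ⟨g, hB'⟩).map (ρ f hA hB x).hom ≫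
          (ρ g hA' hB' _).hom)
    (vMeet : ∀ {X Y Z W : C} {b : A.Hom X Y} {q : X ⟶ Z} (hq : A.mem q) (hq' : B.mem q)
      {a : A.Hom Z W} {p : Y ⟶ W} (hp : A.mem p) (hp' : B.mem p)
      (S : Square b ⟨q, hq'⟩ a ⟨p, hp'⟩) (h : S.IsCart) (x : E X),
      (G S h x).hom ≫ (ρ p hp hp' _).hom =
        (P.fn a).map (ρ q hq hq' x).hom ≫ (P.comp ⟨q, hq⟩ a x).inv ≫
          (P.cell (f := .then ⟨q, hq⟩ a) (g := b.then ⟨p, hp⟩) S.cell x).hom ≫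
            (P.comp b ⟨p, hp⟩ x).hom)
    (hMeet : ∀ {X Y Z W : C} {b : X ⟶ Y} (hb : A.mem b) (hb' : B.mem b) {q : B.Hom X Z} {a : Z ⟶ W}
      (ha : A.mem a) (ha' : B.mem a) {p : B.Hom Y W} (S : Square ⟨b, hb⟩ q ⟨a, ha⟩ p)
      (h : S.IsCart) (x : E X),
      (ρ a ha ha' _).hom ≫ (G S h x).hom =
        (Q.comp q ⟨a, ha'⟩ x).inv ≫
          (Q.cell (f := q.then ⟨a, ha'⟩) (g := .then ⟨b, hb'⟩ p) S.cell x).hom ≫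
            (Q.comp ⟨b, hb'⟩ p x).hom ≫ (Q.fn p).map (ρ b hb hb' x).hom) :
    MeetGluing P Q (.cart A B) where
  G S h x := G S h x
  naturality S h _ _ u := naturality S h u
  vId {X Y a b} σ h x := by
    -- Identities lie in `A ∩ B`, so `vMeet` evaluates the square of `σ`; the two identifications at
    -- identities are given by `ρ_unit`.
    have c := vMeet (A.id_mem X) (B.id_mem X) (A.id_mem Y) (B.id_mem Y) (Square.vOne B σ) h x
    rw [← P.split_inv_split (q := .one A X) (p := .one A Y) (m := a) (Square.vOne B σ).cell
      (λ_ a.hom).symm (σ ≪≫ (ρ_ b.hom).symm) (by simp) x] at c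
    have c₁ := P.split_leftUnitor_symm a x
    have c₂ := P.split_unit (h := a) (f := b) (σ ≪≫ (ρ_ b.hom).symm) (θ := σ) (by simp) x
    have c₃ : (P.split (f := .one A X) (λ_ a.hom).symm x).inv = (P.fn a).map (P.unit X x).hom :=
      congrArg Iso.inv (Iso.ext c₁ : _ = (P.fn a).mapIso (P.unit X x).symm)
    rw [c₃] at c
    rw [← ρ_unit, reassoc_of% c, c₂, ← ρ_unit, Functor.map_comp, Category.assoc]
  hId {X Y q p} σ h x := by
    have c := hMeet (A.id_mem X) (B.id_mem X) (A.id_mem Y) (B.id_mem Y) (Square.hOne A σ) h x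
    have c' := Q.split_inv_split (a := .one B Y) (b := .one B X) (m := q) (Square.hOne A σ).cell
      (ρ_ q.hom).symm (σ ≪≫ (λ_ p.hom).symm) (by simp) x
    have c₁ := Q.split_rightUnitor_symm q x
    have c₂ := Q.split_map_unit (h := q) (g := p) (σ ≪≫ (λ_ p.hom).symm) (θ := σ) (by simp) x
    have c₃ : (Q.split (g := .one B Y) (ρ_ q.hom).symm x).inv = (Q.unit Y _).hom :=
      congrArg Iso.inv (Iso.ext c₁ : _ = (Q.unit Y _).symm)
    rw [← reassoc_of% c', c₃] at c
    rw [← cancel_epi (ρ (𝟙 Y) (A.id_mem Y) (B.id_mem Y) _).hom, reassoc_of% c, reassoc_of% ρ_unit,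
      ← Functor.map_comp, ρ_unit, c₂]
  vcomp S S' h h' h'' x := vcomp S S' h h' h'' x
  hcomp S S' h h' h'' x := hcomp S S' h h' h'' x
  ρ := ρ
  ρ_naturality := ρ_naturality
  ρ_cell := ρ_cell
  ρ_unit := ρ_unit
  ρ_comp := ρ_comp
  vMeet {_ _ _ _ _ q} hq hq' {_ p} hp hp' S h {_} μ ν e x := by
    rw [P.split_inv_split (q := ⟨q, hq⟩) (p := ⟨p, hp⟩) S.cell μ ν e]
    exact vMeet hq hq' hp hp' S h x
  hMeet {_ _ _ _ b} hb hb' {_ a} ha ha' {_} S h {_} μ ν e x := by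
    have c := Q.split_inv_split (b := ⟨b, hb'⟩) (a := ⟨a, ha'⟩) S.cell μ ν e x
    rw [reassoc_of% c]
    exact hMeet hb hb' ha ha' S h x

theorem SquareClass.cart_isCart : (SquareClass.cart A B).IsCart := ⟨fun h => h⟩

end CartMeetGluing

/-! ### Equivalence of the axioms in a bicategory with their evaluated forms -/

section CellEquations

variable {B : Type u₁} [Bicategory.{w₁, v₁} B]

theorem whiskerLeft_injective {X Y : B} {f g : X ⟶ Y} {η θ : f ⟶ g}
    (h : ∀ (T : B) (x : T ⟶ X), x ◁ η = x ◁ θ) : η = θ :=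
  eq_iff_whiskerLeft.mpr h

/-- As for the other equivalences of this kind below, whiskering with all `x` detects the equation
and associators fix the bracketing. The right-hand side has the shape of the axiom for actions by
composition, so the axioms can be passed back and forth without further rewriting. -/
theorem comp_whiskerLeft_iff {X₁ X₂ X₃ Y₁ Y₂ Y₃ : B} {i₁ : X₁ ⟶ Y₁} {i₂ : X₂ ⟶ Y₂} {i₃ : X₃ ⟶ Y₃}
    {q : X₁ ⟶ X₂} {q' : X₂ ⟶ X₃} {p : Y₁ ⟶ Y₂} {p' : Y₂ ⟶ Y₃} {q'' : X₁ ⟶ X₃} {p'' : Y₁ ⟶ Y₃}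
    (S : q ≫ i₂ ≅ i₁ ≫ p) (S' : q' ≫ i₃ ≅ i₂ ≫ p') (S'' : q'' ≫ i₃ ≅ i₁ ≫ p'')
    (m : q'' ≅ q ≫ q') (m' : p'' ≅ p ≫ p') :
    S''.hom ≫ i₁ ◁ m'.hom = m.hom ▷ i₃ ≫ (vpaste S S').hom ↔
      ∀ (T : B) (x : T ⟶ X₁), (sqAct S'' x).hom ≫ (x ≫ i₁) ◁ m'.hom ≫ (α_ (x ≫ i₁) p p').inv =
        (x ◁ m.hom ≫ (α_ x q q').inv) ▷ i₃ ≫ (sqAct S' (x ≫ q)).hom ≫ (sqAct S x).hom ▷ p' := by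
  rw [eq_iff_whiskerLeft]
  refine forall₂_congr fun T x => ?_
  rw [← cancel_epi (α_ x q'' i₃).hom, ← cancel_mono ((α_ x i₁ (p ≫ p')).inv ≫
    (α_ (x ≫ i₁) p p').inv)]
  refine Eq.congr ?_ ?_
  · simp [sqAct]
  · simp [sqAct, vpaste]

theorem comp_whiskerRight_iff {X₁ X₂ X₃ Y₁ Y₂ Y₃ : B} {j : X₁ ⟶ X₂} {j' : X₂ ⟶ X₃} {i : Y₁ ⟶ Y₂}
    {i' : Y₂ ⟶ Y₃} {p₁ : X₁ ⟶ Y₁} {p₂ : X₂ ⟶ Y₂} {p₃ : X₃ ⟶ Y₃} {j'' : X₁ ⟶ X₃} {i'' : Y₁ ⟶ Y₃}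
    (S : p₁ ≫ i ≅ j ≫ p₂) (S' : p₂ ≫ i' ≅ j' ≫ p₃) (S'' : p₁ ≫ i'' ≅ j'' ≫ p₃)
    (m : j'' ≅ j ≫ j') (m' : i'' ≅ i ≫ i') :
    S''.hom ≫ m.hom ▷ p₃ = p₁ ◁ m'.hom ≫ (hpaste S S').hom ↔
      ∀ (T : B) (x : T ⟶ X₁), (sqAct S'' x).hom ≫ (x ◁ m.hom ≫ (α_ x j j').inv) ▷ p₃ =
        ((x ≫ p₁) ◁ m'.hom ≫ (α_ (x ≫ p₁) i i').inv) ≫ (sqAct S x).hom ▷ i' ≫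
          (sqAct S' (x ≫ j)).hom := by
  rw [eq_iff_whiskerLeft]
  refine forall₂_congr fun T x => ?_
  rw [← cancel_epi (α_ x p₁ i'').hom, ← cancel_mono ((α_ x (j ≫ j') p₃).inv ≫
    (α_ x j j').inv ▷ p₃)]
  refine Eq.congr ?_ ?_
  · simp [sqAct]
  · simp [sqAct, hpaste]

theorem vMeet_iff {X Y Z W : B} {b : X ⟶ Y} {q q' : X ⟶ Z} {a : Z ⟶ W} {p p' : Y ⟶ W}
    {m n : X ⟶ W} (S : q ≫ a ≅ b ≫ p) (r : q ≅ q') (s : p ≅ p') (k : m ≅ q' ≫ a) (l : n ≅ b ≫ p')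
    (e : m ⟶ n) :
    S.hom ≫ b ◁ s.hom ≫ l.inv = r.hom ▷ a ≫ k.inv ≫ e ↔
      ∀ (T : B) (x : T ⟶ X), (sqAct S x).hom ≫ (x ≫ b) ◁ s.hom =
        (x ◁ r.hom) ▷ a ≫ ((α_ x q' a).hom ≫ x ◁ k.inv) ≫ x ◁ e ≫ x ◁ l.hom ≫
          (α_ x b p').inv := by
  have : S.hom ≫ b ◁ s.hom ≫ l.inv = r.hom ▷ a ≫ k.inv ≫ e ↔
      S.hom ≫ b ◁ s.hom = r.hom ▷ a ≫ k.inv ≫ e ≫ l.hom := by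
    rw [← cancel_mono l.hom]; simp
  rw [this, eq_iff_whiskerLeft]
  refine forall₂_congr fun T x => ?_
  rw [← cancel_epi (α_ x q a).hom, ← cancel_mono (α_ x b p').inv]
  refine Eq.congr ?_ ?_
  · simp [sqAct]
  · simp

theorem hMeet_iff {X Y Z W : B} {b b' : X ⟶ Y} {q : X ⟶ Z} {a a' : Z ⟶ W} {p : Y ⟶ W}
    {m n : X ⟶ W} (S : q ≫ a ≅ b ≫ p) (r : a' ≅ a) (s : b' ≅ b) (k : m ≅ q ≫ a') (l : n ≅ b' ≫ p)
    (e : m ⟶ n) :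
    S.hom ≫ s.inv ▷ p ≫ l.inv = q ◁ r.inv ≫ k.inv ≫ e ↔
      ∀ (T : B) (x : T ⟶ X), (x ≫ q) ◁ r.hom ≫ (sqAct S x).hom =
        ((α_ x q a').hom ≫ x ◁ k.inv) ≫ x ◁ e ≫ (x ◁ l.hom ≫ (α_ x b' p).inv) ≫
          (x ◁ s.hom) ▷ p := by
  have : S.hom ≫ s.inv ▷ p ≫ l.inv = q ◁ r.inv ≫ k.inv ≫ e ↔
      q ◁ r.hom ≫ S.hom = k.inv ≫ e ≫ l.hom ≫ s.hom ▷ p := by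
    rw [← cancel_epi (q ◁ r.hom), ← cancel_mono (l.hom ≫ s.hom ▷ p)]; simp
  rw [this, eq_iff_whiskerLeft]
  refine forall₂_congr fun T x => ?_
  rw [← cancel_epi (α_ x q a').hom, ← cancel_mono (α_ x b p).inv]
  refine Eq.congr ?_ ?_
  · simp [sqAct]
  · simp

theorem vId_iff {X Y : B} {a b : X ⟶ Y} {m : X ⟶ X} {n : Y ⟶ Y} (S : m ≫ a ≅ b ≫ n)
    (k : m ≅ 𝟙 X) (l : n ≅ 𝟙 Y) (e : a ⟶ b) :
    S.hom = k.hom ▷ a ≫ (λ_ a).hom ≫ e ≫ (ρ_ b).inv ≫ b ◁ l.inv ↔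
      ∀ (T : B) (x : T ⟶ X), (sqAct S x).hom ≫ (x ≫ b) ◁ l.hom ≫ (ρ_ (x ≫ b)).hom =
        (x ◁ k.hom ≫ (ρ_ x).hom) ▷ a ≫ x ◁ e := by
  have : S.hom = k.hom ▷ a ≫ (λ_ a).hom ≫ e ≫ (ρ_ b).inv ≫ b ◁ l.inv ↔
      S.hom ≫ b ◁ l.hom ≫ (ρ_ b).hom = k.hom ▷ a ≫ (λ_ a).hom ≫ e := by
    rw [← cancel_mono (b ◁ l.hom ≫ (ρ_ b).hom)]; simp
  rw [this, eq_iff_whiskerLeft]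
  refine forall₂_congr fun T x => ?_
  rw [← cancel_epi (α_ x m a).hom]
  refine Eq.congr ?_ ?_
  · simp [sqAct]
  · simp

theorem hId_iff {X Y : B} {q p : X ⟶ Y} {m : Y ⟶ Y} {n : X ⟶ X} (S : q ≫ m ≅ n ≫ p)
    (k : m ≅ 𝟙 Y) (l : n ≅ 𝟙 X) (e : q ⟶ p) :
    S.hom = q ◁ k.hom ≫ (ρ_ q).hom ≫ e ≫ (λ_ p).inv ≫ l.inv ▷ p ↔
      ∀ (T : B) (x : T ⟶ X), (sqAct S x).hom ≫ (x ◁ l.hom ≫ (ρ_ x).hom) ▷ p =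
        ((x ≫ q) ◁ k.hom ≫ (ρ_ (x ≫ q)).hom) ≫ x ◁ e := by
  have : S.hom = q ◁ k.hom ≫ (ρ_ q).hom ≫ e ≫ (λ_ p).inv ≫ l.inv ▷ p ↔
      S.hom ≫ l.hom ▷ p ≫ (λ_ p).hom = q ◁ k.hom ≫ (ρ_ q).hom ≫ e := by
    rw [← cancel_mono (l.hom ▷ p ≫ (λ_ p).hom)]; simp
  rw [this, eq_iff_whiskerLeft]
  refine forall₂_congr fun T x => ?_
  rw [← cancel_epi (α_ x q m).hom]
  refine Eq.congr ?_ ?_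
  · simp [sqAct]
  · simp

/-- Pasting of a square with 2-cells on its left and top sides. -/
def pushCell {X X' Y Z W : B} {b : X ⟶ Y} {q : X ⟶ Z} {a : Z ⟶ W} {p : Y ⟶ W} {k : X' ⟶ Y}
    {r : X' ⟶ Z} {f f' : X ⟶ X'} (γ : q ≅ f ≫ r) (S : r ≫ a ≅ k ≫ p) (ρ : f ≅ f')
    (δ : b ≅ f' ≫ k) : q ≫ a ≅ b ≫ p :=
  whiskerRightIso γ a ≪≫ sqAct S f ≪≫ whiskerRightIso (whiskerRightIso ρ k) p ≪≫
    whiskerRightIso δ.symm p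

theorem sqAct_pushCell {T X X' Y Z W : B} {b : X ⟶ Y} {q : X ⟶ Z} {a : Z ⟶ W} {p : Y ⟶ W}
    {k : X' ⟶ Y} {r : X' ⟶ Z} {f f' : X ⟶ X'} (γ : q ≅ f ≫ r) (S : r ≫ a ≅ k ≫ p) (ρ : f ≅ f')
    (δ : b ≅ f' ≫ k) (x : T ⟶ X) :
    (sqAct (pushCell γ S ρ δ) x).hom = (x ◁ γ.hom ≫ (α_ x f r).inv) ▷ a ≫ (sqAct S (x ≫ f)).hom ≫
      (x ◁ ρ.hom) ▷ k ▷ p ≫ ((α_ x f' k).hom ≫ x ◁ δ.inv) ▷ p := by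
  simp [sqAct, pushCell]

theorem iconUnit_iff {X : B} {m n : X ⟶ X} (r : m ⟶ n) (k : n ⟶ 𝟙 X) (l : m ⟶ 𝟙 X) :
    r ≫ k = l ↔ ∀ (T : B) (x : T ⟶ X),
      x ◁ r ≫ x ◁ k ≫ (ρ_ x).hom = x ◁ l ≫ (ρ_ x).hom := by
  rw [eq_iff_whiskerLeft]
  refine forall₂_congr fun T x => ?_
  rw [← cancel_mono (ρ_ x).hom]
  simp

theorem iconComp_iff {X Y Z : B} {f f' : X ⟶ Y} {g g' : Y ⟶ Z} {h h' : X ⟶ Z} (r : h ⟶ h')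
    (k : h' ⟶ f' ≫ g') (l : h ⟶ f ≫ g) (s : f ⟶ f') (t : g ⟶ g') :
    r ≫ k = l ≫ s ▷ g ≫ f' ◁ t ↔ ∀ (T : B) (x : T ⟶ X),
      x ◁ r ≫ x ◁ k ≫ (α_ x f' g').inv =
        (x ◁ l ≫ (α_ x f g).inv) ≫ (x ◁ s) ▷ g ≫ (x ≫ f') ◁ t := by
  rw [eq_iff_whiskerLeft]
  refine forall₂_congr fun T x => ?_
  rw [← cancel_mono (α_ x f' g').inv]
  refine Eq.congr ?_ ?_ <;> simp

theorem compatMeet_iff {X Y Z W : B} {b : X ⟶ Y} {a : Z ⟶ W} {q q' : X ⟶ Z} {p p' : Y ⟶ W}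
    (S : q ≫ a ≅ b ≫ p) (S' : q' ≫ a ≅ b ≫ p') (s : q ⟶ q') (t : p ⟶ p') :
    s ▷ a ≫ S'.hom = S.hom ≫ b ◁ t ↔ ∀ (T : B) (x : T ⟶ X),
      (x ≫ b) ◁ t ≫ (sqAct S' x).inv = (sqAct S x).inv ≫ (x ◁ s) ▷ a := by
  rw [eq_iff_whiskerLeft]
  refine forall₂_congr fun T x => ?_
  rw [Iso.comp_inv_eq, Category.assoc, Iso.eq_inv_comp, eq_comm, ← cancel_epi (α_ x q a).hom,
    ← cancel_mono (α_ x b p').inv]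
  refine Eq.congr ?_ ?_ <;> simp [sqAct]

end CellEquations

/-! ### The action attached to a pseudofunctor -/

section ActOfPseudofunctor

variable {C : Type u₁} [Bicategory.{w₁, v₁} C] {D : Type u₂} [Bicategory.{w₂, v₂} D]
  {A B : ArrowySub C} {F₀ : C → D}

/-- The isomorphism attached to an invertible 2-cell. -/
def PsOn.map₂Iso (F : PsOn A F₀) {X Y : C} {f g : A.Hom X Y} (η : f.hom ≅ g.hom) :
    F.map f ≅ F.map g where
  hom := F.map₂ η.hom
  inv := F.map₂ η.inv
  hom_inv_id := by rw [← F.map₂_comp, η.hom_inv_id, F.map₂_id]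
  inv_hom_id := by rw [← F.map₂_comp, η.inv_hom_id, F.map₂_id]

/-- The action of `A` by composition with the values of a pseudofunctor. -/
@[reducible]
def PsOn.act (F : PsOn A F₀) (T : D) : Act A (fun X => T ⟶ F₀ X) where
  fn f := { obj := fun x => x ≫ F.map f, map := fun u => u ▷ F.map f }
  cell η x := whiskerLeftIso x (F.map₂Iso η)
  unit X x := whiskerLeftIso x (F.mapId X) ≪≫ ρ_ x
  comp f g x := whiskerLeftIso x (F.mapComp f g) ≪≫ (α_ x (F.map f) (F.map g)).symm
  cell_naturality η _ _ u := (whisker_exchange u _).symm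
  unit_naturality {X} x y u := by
    change u ▷ F.map (.id A X) ≫ y ◁ (F.mapId X).hom ≫ (ρ_ y).hom =
      (x ◁ (F.mapId X).hom ≫ (ρ_ x).hom) ≫ u
    rw [← whisker_exchange_assoc]
    simp
  comp_naturality {_ _ _} f g {x y} u := by
    change u ▷ F.map (f.comp g) ≫ y ◁ (F.mapComp f g).hom ≫ (α_ _ _ _).inv =
      (x ◁ (F.mapComp f g).hom ≫ (α_ _ _ _).inv) ≫ u ▷ F.map f ▷ F.map g
    rw [← whisker_exchange_assoc]
    simp
  cell_refl f x := by
    change x ◁ F.map₂ (𝟙 f.hom) = 𝟙 (x ≫ F.map f)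
    rw [F.map₂_id, whiskerLeft_id]
  cell_trans η θ x := by
    change x ◁ F.map₂ (η.hom ≫ θ.hom) = x ◁ F.map₂ η.hom ≫ x ◁ F.map₂ θ.hom
    rw [F.map₂_comp, whiskerLeft_comp]
  cell_whiskerLeft {_ _ _} f {g h} η x := by
    change x ◁ F.map₂ (f := f.comp g) (g := f.comp h) (f.hom ◁ η.hom) ≫
      x ◁ (F.mapComp f h).hom ≫ (α_ _ _ _).inv =
        (x ◁ (F.mapComp f g).hom ≫ (α_ _ _ _).inv) ≫ (x ≫ F.map f) ◁ F.map₂ η.hom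
    rw [F.map₂_whiskerLeft]
    simp
  cell_whiskerRight {_ _ _ f g} η h x := by
    change x ◁ F.map₂ (f := f.comp h) (g := g.comp h) (η.hom ▷ h.hom) ≫
      x ◁ (F.mapComp g h).hom ≫ (α_ _ _ _).inv =
        (x ◁ (F.mapComp f h).hom ≫ (α_ _ _ _).inv) ≫ (x ◁ F.map₂ η.hom) ▷ F.map h
    rw [F.map₂_whiskerRight]
    simp
  cell_associator f g h x := by
    change x ◁ F.map₂ (f := (f.comp g).comp h) (g := f.comp (g.comp h))
      (α_ f.hom g.hom h.hom).hom ≫ (x ◁ (F.mapComp f (g.comp h)).hom ≫ (α_ _ _ _).inv) ≫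
        (x ≫ F.map f) ◁ (F.mapComp g h).hom ≫ (α_ _ _ _).inv =
      (x ◁ (F.mapComp (f.comp g) h).hom ≫ (α_ _ _ _).inv) ≫
        (x ◁ (F.mapComp f g).hom ≫ (α_ _ _ _).inv) ▷ F.map h
    rw [F.map₂_associator]
    simp
  cell_leftUnitor {X _} f x := by
    change x ◁ F.map₂ (f := (ArrowySub.Hom.id A X).comp f) (g := f) (λ_ f.hom).hom =
      (x ◁ (F.mapComp _ f).hom ≫ (α_ _ _ _).inv) ≫ (x ◁ (F.mapId X).hom ≫ (ρ_ x).hom) ▷ F.map f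
    rw [F.map₂_leftUnitor]
    simp
  cell_rightUnitor {_ Y} f x := by
    change x ◁ F.map₂ (f := f.comp (.id A Y)) (g := f) (ρ_ f.hom).hom =
      (x ◁ (F.mapComp f _).hom ≫ (α_ _ _ _).inv) ≫ (x ≫ F.map f) ◁ (F.mapId Y).hom ≫
        (ρ_ (x ≫ F.map f)).hom
    rw [F.map₂_rightUnitor]
    simp

variable {FA : PsOn A F₀} {FB : PsOn B F₀}

/-- The gluing data for the actions attached to a gluing datum. -/
@[reducible]
def IsPairGluing.act {G : SquareData FA FB} (h : IsPairGluing G) (T : D) :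
    SqGluing (FA.act T) (FB.act T) (.all A B) where
  G S _ x := sqAct (G S) x
  naturality S _ _ _ u := sqAct_naturality (G S) u
  vId σ _ x := (vId_iff _ _ _ _).mp (h.vId σ) T x
  hId σ _ x := (hId_iff _ _ _ _).mp (h.hId σ) T x
  vcomp S S' _ _ _ x := (comp_whiskerLeft_iff _ _ _ _ _).mp (h.vcomp S S') T x
  hcomp S S' _ _ _ x := (comp_whiskerRight_iff _ _ _ _ _).mp (h.hcomp S S') T x

/-- The actions for all `T` jointly detect the axioms, provided that the data for them are
evaluations of one family of 2-cells independent of `T`. -/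
theorem IsPairGluing.of_act {G : SquareData FA FB}
    (Γ : ∀ T : D, SqGluing (FA.act T) (FB.act T) (.all A B))
    (hG : ∀ (T : D) {X Y Z W : C} {b : A.Hom X Y} {q : B.Hom X Z} {a : A.Hom Z W} {p : B.Hom Y W}
      (S : Square b q a p) (x : T ⟶ F₀ X), ((Γ T).G S trivial x).hom = (sqAct (G S) x).hom) :
    IsPairGluing G where
  vId σ := (vId_iff _ _ _ _).mpr fun T x => by
    have := (Γ T).vId σ trivial x
    rw [hG] at this
    exact this
  hId σ := (hId_iff _ _ _ _).mpr fun T x => by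
    have := (Γ T).hId σ trivial x
    rw [hG] at this
    exact this
  vcomp S S' := (comp_whiskerLeft_iff _ _ _ _ _).mpr fun T x => by
    have := (Γ T).vcomp S S' trivial trivial trivial x
    rw [hG, hG, hG] at this
    exact this
  hcomp S S' := (comp_whiskerRight_iff _ _ _ _ _).mpr fun T x => by
    have := (Γ T).hcomp S S' trivial trivial trivial x
    rw [hG, hG, hG] at this
    exact this

end ActOfPseudofunctor

/-! ### Cartesian gluing data for a pair, in terms of actions -/

section CartesianPairs

variable {C : Type u₁} [Bicategory.{w₁, v₁} C] {D : Type u₂} [Bicategory.{w₂, v₂} D]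
  {A B : ArrowySub C} {F₀ : C → D} {FA : PsOn A F₀} {FB : PsOn B F₀}

/-- The gluing data for the actions attached to a Cartesian gluing datum. -/
@[reducible]
def IsCartPairGluing.act {G : CartSquareData FA FB} {ρ : MeetData FA FB}
    (h : IsCartPairGluing G ρ) (T : D) : MeetGluing (FA.act T) (FB.act T) (.cart A B) :=
  .ofCart (fun S hS x => sqAct (G S hS) x)
    (fun S hS _ _ u => sqAct_naturality (G S hS) u)
    (fun S S' hS hS' hS'' x =>
      (comp_whiskerLeft_iff _ _ _ _ _).mp (h.vcomp S S' hS hS' hS'') T x)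
    (fun S S' hS hS' hS'' x =>
      (comp_whiskerRight_iff _ _ _ _ _).mp (h.hcomp S S' hS hS' hS'') T x)
    (fun f hA hB x => whiskerLeftIso x (ρ ⟨f, hA, hB⟩))
    (fun _ _ _ _ _ u => (whisker_exchange u _).symm)
    (fun {_ _ f g} hA hB hA' hB' η x => by
      have := congrArg (x ◁ ·) (h.icon.nat (f := ⟨f, hA, hB⟩) (g := ⟨g, hA', hB'⟩) η.hom)
      simp only [whiskerLeft_comp] at this
      exact this)
    (fun X x => (iconUnit_iff _ _ _).mp (h.icon.map_id X) T x)
    (fun {_ _ _ f} hA hB {g} hA' hB' x => (iconComp_iff _ _ _ _ _).mp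
      (h.icon.map_comp ⟨f, hA, hB⟩ ⟨g, hA', hB'⟩) T x)
    (fun {_ _ _ _ b q} hq hq' {a p} hp hp' S hS x =>
      ((vMeet_iff _ _ _ _ _ _).mp (h.vMeet (q := ⟨q, hq, hq'⟩) (p := ⟨p, hp, hp'⟩) S hS) T
        x))
    (fun {_ _ _ _ b} hb hb' {q a} ha ha' {p} S hS x =>
      ((hMeet_iff _ _ _ _ _ _).mp (h.hMeet (b := ⟨b, hb, hb'⟩) (a := ⟨a, ha, ha'⟩) S hS) T
        x))

/-- The class is only required to contain the 2-Cartesian squares; this permits restricting data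
given on all squares. -/
theorem IsCartPairGluing.of_act {G : CartSquareData FA FB} {ρ : MeetData FA FB}
    {𝒢 : SquareClass A B} (h𝒢 : 𝒢.IsCart)
    (Γ : ∀ T : D, MeetGluing (FA.act T) (FB.act T) 𝒢)
    (hG : ∀ (T : D) {X Y Z W : C} {b : A.Hom X Y} {q : B.Hom X Z} {a : A.Hom Z W} {p : B.Hom Y W}
      (S : Square b q a p) (h : S.IsCart) (x : T ⟶ F₀ X),
      ((Γ T).G S (h𝒢.mem h) x).hom = (sqAct (G S h) x).hom)
    (hρ : ∀ (T : D) {X Y : C} (f : X ⟶ Y) (hA : A.mem f) (hB : B.mem f) (x : T ⟶ F₀ X),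
      ((Γ T).ρ f hA hB x).hom = x ◁ (ρ ⟨f, hA, hB⟩).hom) [IsLocallyGroupoid C] :
    IsCartPairGluing G ρ where
  icon :=
    { nat := fun {X Y f g} η => whiskerLeft_injective fun T x => by
        -- Actions record invertible 2-cells only, which is no loss because every 2-cell of `C` is
        -- invertible.
        have := (Γ T).ρ_cell f.mem.1 f.mem.2 g.mem.1 g.mem.2 (asIso η) x
        rw [hρ, hρ] at this
        rw [whiskerLeft_comp, whiskerLeft_comp]
        exact this
      map_id := fun X => (iconUnit_iff _ _ _).mpr fun T x => by
        have := (Γ T).ρ_unit X x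
        rw [hρ] at this
        exact this
      map_comp := fun f g => (iconComp_iff _ _ _ _ _).mpr fun T x => by
        have := (Γ T).ρ_comp f.mem.1 f.mem.2 g.mem.1 g.mem.2 x
        rw [hρ, hρ, hρ] at this
        exact this }
  vcomp S S' h h' h'' := (comp_whiskerLeft_iff _ _ _ _ _).mpr fun T x => by
    have := (Γ T).vcomp S S' (h𝒢.mem h) (h𝒢.mem h') (h𝒢.mem h'') x
    rw [hG, hG, hG] at this
    exact this
  hcomp S S' h h' h'' := (comp_whiskerRight_iff _ _ _ _ _).mpr fun T x => by
    have := (Γ T).hcomp S S' (h𝒢.mem h) (h𝒢.mem h') (h𝒢.mem h'') x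
    rw [hG, hG, hG] at this
    exact this
  vMeet {X Y Z W b q a p} S h := (vMeet_iff _ _ _ _ _ _).mpr fun T x => by
    obtain ⟨q, hq, hq'⟩ := q
    obtain ⟨p, hp, hp'⟩ := p
    change Square b ⟨q, hq'⟩ a ⟨p, hp'⟩ at S
    have := (Γ T).vMeet hq hq' hp hp' S (h𝒢.mem h) (m := .then ⟨q, hq⟩ a)
      (Iso.refl _) S.cell (Category.id_comp _).symm x
    rw [Act.split_inv_split (P := FA.act T) (q := ⟨q, hq⟩) (p := ⟨p, hp⟩) S.cell _ _
      (Category.id_comp _).symm, hG, hρ, hρ] at this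
    exact this
  hMeet {X Y Z W b q a p} S h := (hMeet_iff _ _ _ _ _ _).mpr fun T x => by
    obtain ⟨b, hb, hb'⟩ := b
    obtain ⟨a, ha, ha'⟩ := a
    change Square ⟨b, hb⟩ q ⟨a, ha⟩ p at S
    have := (Γ T).hMeet hb hb' ha ha' S (h𝒢.mem h) (m := q.then ⟨a, ha'⟩)
      (Iso.refl _) S.cell (Category.id_comp _).symm x
    have e := Act.split_inv_split (P := FB.act T) (m := q.then ⟨a, ha'⟩) (b := ⟨b, hb'⟩)
      (a := ⟨a, ha'⟩) S.cell (Iso.refl _) S.cell (Category.id_comp _).symm x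
    rw [reassoc_of% e, hG, hρ, hρ] at this
    exact this

/-- The isomorphism attached to a 2-cell with values in a composite. -/
def PsOn.splitIso (F : PsOn A F₀) {X Y Z : C} {h : A.Hom X Z} {f : A.Hom X Y} {g : A.Hom Y Z}
    (γ : h.hom ≅ f.hom ≫ g.hom) : F.map h ≅ F.map f ≫ F.map g :=
  F.map₂Iso (g := f.comp g) γ ≪≫ F.mapComp f g

theorem PsOn.act_split (F : PsOn A F₀) {X Y Z : C} {h : A.Hom X Z} {f : A.Hom X Y} {g : A.Hom Y Z}
    (γ : h.hom ≅ f.hom ≫ g.hom) {T : D} (x : T ⟶ F₀ X) :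
    (F.act T).split γ x = whiskerLeftIso x (F.splitIso γ) ≪≫ (α_ x _ _).symm := by
  ext
  change x ◁ _ ≫ x ◁ _ ≫ (α_ _ _ _).inv = x ◁ (_ ≫ _) ≫ (α_ _ _ _).inv
  rw [whiskerLeft_comp, Category.assoc]
  rfl

/-- The 2-cell at an arbitrary square obtained from a decomposition. -/
def extCell (G : CartSquareData FA FB) (ρ : MeetData FA FB) {X Y Z W : C} {b : A.Hom X Y}
    {q : B.Hom X Z} {a : A.Hom Z W} {p : B.Hom Y W} {S : Square b q a p} (d : Decomp S) :
    FB.map q ≫ FA.map a ≅ FA.map b ≫ FB.map p :=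
  pushCell (FB.splitIso (f := ⟨d.f, d.hf'⟩) d.γ) (G d.sq d.cart) (ρ ⟨d.f, d.hf, d.hf'⟩)
    (FA.splitIso (f := ⟨d.f, d.hf⟩) d.δ)

/-- Links the extension in `D` with those for the actions: for every `T` the latter are evaluations
of the single 2-cell `extCell`. -/
theorem sqAct_extCell {G : CartSquareData FA FB} {ρ : MeetData FA FB} (h : IsCartPairGluing G ρ)
    {X Y Z W : C} {b : A.Hom X Y}
    {q : B.Hom X Z} {a : A.Hom Z W} {p : B.Hom Y W} {S : Square b q a p} (d : Decomp S) {T : D}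
    (x : T ⟶ F₀ X) :
    (sqAct (extCell G ρ d) x).hom =
      (((h.act T).ext SquareClass.cart_isCart d).app x).hom := by
  refine Eq.trans ?_ ((h.act T).push_hom d.hf d.hf' d.γ d.δ _ x).symm
  rw [PsOn.act_split, PsOn.act_split]
  exact sqAct_pushCell _ _ _ _ x

end CartesianPairs

/-! ### Existence and uniqueness of the extension for a pair of pseudofunctors -/

section ExtensionOfPairs

variable {C : Type u₁} [Bicategory.{w₁, v₁} C] {D : Type u₂} [Bicategory.{w₂, v₂} D]
  {A B : ArrowySub C} {F₀ : C → D} {FA : PsOn A F₀} {FB : PsOn B F₀}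

theorem SqGluing.eq_of_G {E : C → Type u₃} [∀ X, Category.{v₃} (E X)] {P : Act A E} {Q : Act B E}
    {𝒢 : SquareClass A B} {Γ Γ' : SqGluing P Q 𝒢}
    (h : ∀ {X Y Z W : C} {b : A.Hom X Y} {q : B.Hom X Z} {a : A.Hom Z W} {p : B.Hom Y W}
      (S : Square b q a p) (hS : 𝒢.mem S) (x : E X), (Γ.G S hS x).hom = (Γ'.G S hS x).hom) :
    Γ = Γ' := by
  have e : @SqGluing.G _ _ _ _ _ _ _ _ _ Γ = @SqGluing.G _ _ _ _ _ _ _ _ _ Γ' := by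
    funext X Y Z W b q a p S hS x
    exact Iso.ext (h S hS x)
  cases Γ
  cases Γ'
  cases e
  rfl

theorem IsPairGluing.act_meet {G : SquareData FA FB} (h : IsPairGluing G) {T : D} {X Y : C}
    (f : X ⟶ Y) (hA : A.mem f) (hB : B.mem f) (x : T ⟶ F₀ X) :
    ((h.act T).meet SquareClass.all_isAll f hA hB x).hom = x ◁ (G.meet ⟨f, hA, hB⟩).hom := by
  have e : ∀ {X Y : D} {f f' : X ⟶ Y} {i j : Y ⟶ Y} (g : f ≫ i ≅ f' ≫ j) (k : i ≅ 𝟙 Y) (l : j ≅ 𝟙 Y)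
      (x : T ⟶ X), ((ρ_ (x ≫ f)).inv ≫ (x ≫ f) ◁ k.inv) ≫ (sqAct g x).hom ≫
        (x ≫ f') ◁ l.hom ≫ (ρ_ (x ≫ f')).hom =
      x ◁ ((ρ_ f).inv ≫ f ◁ k.inv ≫ g.hom ≫ f' ◁ l.hom ≫ (ρ_ f').hom) := by
    intro X Y f f' i j g k l x
    simp [sqAct]
  exact e (G (Square.corner ⟨f, hA, hB⟩)) (FA.mapId Y) (FB.mapId Y) x

variable [Strict C]

/-- Uniqueness: `fill_eq_push` for every `T` shows that the value at a square depends only on the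
Cartesian part of `G` and on the induced `ρ`. -/
theorem IsPairGluing.eq_extCell {G : SquareData FA FB} (h : IsPairGluing G) {X Y Z W : C}
    {b : A.Hom X Y} {q : B.Hom X Z} {a : A.Hom Z W} {p : B.Hom Y W} {S : Square b q a p}
    (d : Decomp S) : G S = extCell G.toCart G.meet d := by
  refine sqAct_injective fun T x => ?_
  have c := ((h.act T).toMeetGluing SquareClass.all_isAll).fill_eq_push (S := S) (S' := d.sq)
    SquareClass.all_isAll d.hf d.hf' trivial trivial d.γ d.δ d.e
  have c₁ := ((h.act T).toMeetGluing SquareClass.all_isAll).push_hom d.hf d.hf' d.γ d.δ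
    (((h.act T).toMeetGluing SquareClass.all_isAll).fill d.sq trivial) x
  rw [← c, PsOn.act_split, PsOn.act_split] at c₁
  refine (c₁.trans ?_).trans (sqAct_pushCell _ _ _ _ x).symm
  change _ ≫ _ ≫ (((h.act T).meet SquareClass.all_isAll d.f d.hf d.hf' x).hom ▷ FA.map d.k) ▷
    FB.map p ≫ _ = _
  rw [h.act_meet]
  rfl

theorem IsPairGluing.eq_of_toCart_eq {G G' : SquareData FA FB} (h : IsPairGluing G)
    (h' : IsPairGluing G') (hsq : IsSquaring A B) (e : G.toCart = G'.toCart)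
    (e' : G.meet = G'.meet) : G = G' := by
  funext X Y Z W b q a p S
  obtain ⟨d⟩ := hsq.exists_decomp S
  rw [h.eq_extCell d, h'.eq_extCell d, e, e']

variable [IsLocallyGroupoid C] {G : CartSquareData FA FB} {ρ : MeetData FA FB}

/-- The extension of a Cartesian gluing datum to all squares, for a choice of decompositions. -/
def squareExt (G : CartSquareData FA FB) (ρ : MeetData FA FB)
    (dec : ∀ {X Y Z W : C} {b : A.Hom X Y} {q : B.Hom X Z} {a : A.Hom Z W} {p : B.Hom Y W}
      (S : Square b q a p), Decomp S) : SquareData FA FB :=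
  fun _ _ _ _ _ _ _ _ S => extCell G ρ (dec S)

namespace IsCartPairGluing

/-- The extension of the gluing data for the actions to all squares. -/
@[reducible]
def extendAct (h : IsCartPairGluing G ρ) (hAB : SquaringPair A B)
    (dec : ∀ {X Y Z W : C} {b : A.Hom X Y} {q : B.Hom X Z} {a : A.Hom Z W} {p : B.Hom Y W}
      (S : Square b q a p), Decomp S)
    (T : D) : SqGluing (FA.act T) (FB.act T) (.all A B) :=
  (h.act T).extend SquareClass.cart_isCart hAB dec

theorem extendAct_G (h : IsCartPairGluing G ρ) (hAB : SquaringPair A B)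
    (dec : ∀ {X Y Z W : C} {b : A.Hom X Y} {q : B.Hom X Z} {a : A.Hom Z W} {p : B.Hom Y W}
      (S : Square b q a p), Decomp S)
    {T : D} {X Y Z W : C} {b : A.Hom X Y} {q : B.Hom X Z} {a : A.Hom Z W}
    {p : B.Hom Y W} (S : Square b q a p) (x : T ⟶ F₀ X) :
    ((h.extendAct hAB dec T).G S trivial x).hom = (sqAct (squareExt G ρ dec S) x).hom :=
  (sqAct_extCell h (dec S) x).symm

theorem extendAct_G_of_cart (h : IsCartPairGluing G ρ) (hAB : SquaringPair A B)
    (dec : ∀ {X Y Z W : C} {b : A.Hom X Y} {q : B.Hom X Z} {a : A.Hom Z W} {p : B.Hom Y W}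
      (S : Square b q a p), Decomp S)
    {T : D} {X Y Z W : C} {b : A.Hom X Y} {q : B.Hom X Z} {a : A.Hom Z W}
    {p : B.Hom Y W} {S : Square b q a p} (hS : S.IsCart) (x : T ⟶ F₀ X) :
    (h.extendAct hAB dec T).G S trivial x = sqAct (G S hS) x :=
  congrArg (fun F : Fill (FA.act T) (FB.act T) b q a p => F.app x)
    ((h.act T).ext_of_cart SquareClass.cart_isCart hAB hS (dec S))

theorem isPairGluing_squareExt (h : IsCartPairGluing G ρ) (hAB : SquaringPair A B)
    (dec : ∀ {X Y Z W : C} {b : A.Hom X Y} {q : B.Hom X Z} {a : A.Hom Z W} {p : B.Hom Y W}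
      (S : Square b q a p), Decomp S) :
    IsPairGluing (squareExt G ρ dec) :=
  .of_act (h.extendAct hAB dec) fun _ => h.extendAct_G hAB dec

theorem toCart_squareExt (h : IsCartPairGluing G ρ) (hAB : SquaringPair A B)
    (dec : ∀ {X Y Z W : C} {b : A.Hom X Y} {q : B.Hom X Z} {a : A.Hom Z W} {p : B.Hom Y W}
      (S : Square b q a p), Decomp S) :
    (squareExt G ρ dec).toCart = G := by
  funext X Y Z W b q a p S hS
  refine sqAct_injective fun T x => ?_
  rw [← h.extendAct_G_of_cart hAB dec hS, h.extendAct_G hAB dec]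
  rfl

theorem act_squareExt (h : IsCartPairGluing G ρ) (hAB : SquaringPair A B)
    (dec : ∀ {X Y Z W : C} {b : A.Hom X Y} {q : B.Hom X Z} {a : A.Hom Z W} {p : B.Hom Y W}
      (S : Square b q a p), Decomp S)
    (T : D) :
    (h.isPairGluing_squareExt hAB dec).act T = h.extendAct hAB dec T :=
  SqGluing.eq_of_G fun S _ x => (h.extendAct_G hAB dec S x).symm

theorem extendAct_meet (h : IsCartPairGluing G ρ) (hAB : SquaringPair A B)
    (dec : ∀ {X Y Z W : C} {b : A.Hom X Y} {q : B.Hom X Z} {a : A.Hom Z W} {p : B.Hom Y W}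
      (S : Square b q a p), Decomp S)
    {T : D} {X Y : C} (f : X ⟶ Y) (hA : A.mem f) (hB : B.mem f)
    (x : T ⟶ F₀ X) :
    ((h.extendAct hAB dec T).meet SquareClass.all_isAll f hA hB x).hom =
      x ◁ (ρ ⟨f, hA, hB⟩).hom :=
  (h.act T).extend_meet SquareClass.cart_isCart hAB dec f hA hB x

/-- With `toCart_squareExt`, this says that extending and then restricting gives back the Cartesian
datum. -/
theorem meet_squareExt (h : IsCartPairGluing G ρ) (hAB : SquaringPair A B)
    (dec : ∀ {X Y Z W : C} {b : A.Hom X Y} {q : B.Hom X Z} {a : A.Hom Z W} {p : B.Hom Y W}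
      (S : Square b q a p), Decomp S) :
    (squareExt G ρ dec).meet = ρ := by
  funext X Y f
  refine Iso.ext (whiskerLeft_injective fun T x => ?_)
  rw [← h.extendAct_meet hAB dec f.hom f.mem.1 f.mem.2, ← h.act_squareExt hAB dec,
    IsPairGluing.act_meet]

end IsCartPairGluing

end ExtensionOfPairs

/-! ### The hexagon for the extended data -/

section CubesOfPseudofunctors

variable {C : Type u₁} [Bicategory.{w₁, v₁} C] {D : Type u₂} [Bicategory.{w₂, v₂} D]
  {A B A' : ArrowySub C} {F₀ : C → D} {FA : PsOn A F₀} {FB : PsOn B F₀} {FE : PsOn A' F₀}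

theorem sqAct_transpose_inv (G : CartSquareData FA FB) {X Y Z W : C} {b : B.Hom X Y}
    {q : A.Hom X Z} {a : B.Hom Z W} {p : A.Hom Y W} (S : Square b q a p) (hS : S.IsCart) {T : D}
    (x : T ⟶ F₀ X) :
    (sqAct (G.transpose S hS) x).inv = (sqAct (G S.transpose hS.transpose) x).hom := by
  change (sqAct (G S.transpose hS.transpose).symm x).inv = _
  rw [sqAct_symm]
  rfl

variable [Strict C] [IsLocallyGroupoid C]
  {G : CartSquareData FA FB} {ρ : MeetData FA FB} {G' : CartSquareData FA FE}
  {ρ' : MeetData FA FE} {G'' : CartSquareData FB FE} {ρ'' : MeetData FB FE}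

/-- Application of `HexAll.of_cart`. It needs `MeetCompat` for each of the three pairs against the
remaining subcategory; `MeetCompat.of_cart` derives each from one instance of (E) on 2-Cartesian
squares and from the cocycle condition. -/
theorem hexAll_extendAct
    (h : IsCartPairGluing G ρ) (h' : IsCartPairGluing G' ρ') (h'' : IsCartPairGluing G'' ρ'')
    (hAB : SquaringPair A B) (hAE : SquaringPair A A') (hBE : SquaringPair B A')
    (dec : ∀ {X Y Z W : C} {b : A.Hom X Y} {q : B.Hom X Z} {a : A.Hom Z W} {p : B.Hom Y W}
      (S : Square b q a p), Decomp S)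
    (dec' : ∀ {X Y Z W : C} {b : A.Hom X Y} {q : A'.Hom X Z} {a : A.Hom Z W} {p : A'.Hom Y W}
      (S : Square b q a p), Decomp S)
    (dec'' : ∀ {X Y Z W : C} {b : B.Hom X Y} {q : A'.Hom X Z} {a : B.Hom Z W} {p : A'.Hom Y W}
      (S : Square b q a p), Decomp S)
    (hm : IsSquaring (A.inter B) A') (hm' : IsSquaring (A.inter A') B)
    (hm'' : IsSquaring (B.inter A') A) (hsq : IsCubeSquaring A B A') (hsq' : IsCubeSquaring A A' B)
    (hsq'' : IsCubeSquaring B A' A)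
    (cube : ∀ {X Y Z W X' Y' Z' W' : C}
      {b : A.Hom X Y} {q : B.Hom X Z} {a : A.Hom Z W} {p : B.Hom Y W}
      {b' : A.Hom X' Y'} {q' : B.Hom X' Z'} {a' : A.Hom Z' W'} {p' : B.Hom Y' W'}
      {x : A'.Hom X' X} {y : A'.Hom Y' Y} {z : A'.Hom Z' Z} {w : A'.Hom W' W}
      (K : Square b q a p) (K' : Square b' q' a' p') (J : Square a' z a w)
      (J' : Square b' x b y) (I : Square p' y p w) (I' : Square q' x q z)
      (hK : K.IsCart) (hK' : K'.IsCart) (hJ : J.IsCart) (hJ' : J'.IsCart) (hI : I.IsCart)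
      (hI' : I'.IsCart) (_ : CubeComm K.cell K'.cell J.cell J'.cell I.cell I'.cell),
      CubeComm (G K hK) (G K' hK') (G' J hJ) (G' J' hJ') (G'' I hI) (G'' I' hI'))
    (meet : ∀ {X Y Z W : C} {b : A'.Hom X Y} {q : (A.inter B).Hom X Z} {a : A'.Hom Z W}
      {p : (A.inter B).Hom Y W} (S : Square b q a p) (hS : S.IsCart),
      (ρ q).hom ▷ FE.map a ≫ (G'.transpose S.toFst hS).hom =
        (G''.transpose S.toSnd hS).hom ≫ FE.map b ◁ (ρ p).hom)
    (meet' : ∀ {X Y Z W : C} {b : B.Hom X Y} {q : (A.inter A').Hom X Z} {a : B.Hom Z W}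
      {p : (A.inter A').Hom Y W} (S : Square b q a p) (hS : S.IsCart),
      (ρ' q).hom ▷ FB.map a ≫ (G.transpose S.toFst hS).hom =
        (G'' S.toSnd hS).hom ≫ FB.map b ◁ (ρ' p).hom)
    (meet'' : ∀ {X Y Z W : C} {b : A.Hom X Y} {q : (B.inter A').Hom X Z} {a : A.Hom Z W}
      {p : (B.inter A').Hom Y W} (S : Square b q a p) (hS : S.IsCart),
      (ρ'' q).hom ▷ FA.map a ≫ (G S.toFst hS).hom =
        (G' S.toSnd hS).hom ≫ FA.map b ◁ (ρ'' p).hom)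
    (cocycle : ∀ {X Y : C} (f : X ⟶ Y) (hA : A.mem f) (hB : B.mem f) (hE : A'.mem f),
      (ρ'' ⟨f, hB, hE⟩).hom ≫ (ρ ⟨f, hA, hB⟩).hom = (ρ' ⟨f, hA, hE⟩).hom) (T : D) :
    HexAll (h.extendAct hAB dec T) (h'.extendAct hAE dec' T) (h''.extendAct hBE dec'' T) := by
  have coc : ∀ {X Y : C} (f : X ⟶ Y) (hA : A.mem f) (hB : B.mem f) (hE : A'.mem f)
      (t : T ⟶ F₀ X),
      ((h'.extendAct hAE dec' T).meet SquareClass.all_isAll f hA hE t).hom =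
        ((h''.extendAct hBE dec'' T).meet SquareClass.all_isAll f hB hE t).hom ≫
          ((h.extendAct hAB dec T).meet SquareClass.all_isAll f hA hB t).hom := by
    intro X Y f hA hB hE t
    rw [h'.extendAct_meet, h''.extendAct_meet, h.extendAct_meet, ← cocycle f hA hB hE]
    exact whiskerLeft_comp _ _ _
  refine HexAll.of_cart (Γ := (h.extendAct hAB dec T).toMeetGluing SquareClass.all_isAll)
    (Λ := (h'.extendAct hAE dec' T).toMeetGluing SquareClass.all_isAll)
    (Θ := (h''.extendAct hBE dec'' T).toMeetGluing SquareClass.all_isAll)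
    SquareClass.all_isAll SquareClass.all_isAll SquareClass.all_isAll
    (.of_cart SquareClass.all_isAll SquareClass.all_isAll hm coc ?_)
    (.of_cart SquareClass.all_isAll SquareClass.all_isAll.transpose hm' ?_ ?_)
    (.of_cart SquareClass.all_isAll.transpose SquareClass.all_isAll.transpose hm'' ?_ ?_)
    hsq hsq' hsq'' ?_
  -- Condition (E) has the intersection in the vertical direction while `MeetCompat` has it in the
  -- horizontal one; hence the transposed square `M.symm`, here and in the two analogous cases.
  · intro X X' V V' f hf hf' f' hg hg' x v M cart t
    have c := (compatMeet_iff _ _ _ _).mp (meet (q := ⟨f', hg, hg'⟩) (p := ⟨f, hf, hf'⟩) (b := x)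
      (a := v) ⟨M.symm⟩ cart.symm) T t
    have e₁ := sqAct_transpose_inv G' (b := x) (q := ⟨f', hg⟩) (a := v) (p := ⟨f, hf⟩) ⟨M.symm⟩
      cart.symm t
    have e₂ := sqAct_transpose_inv G'' (b := x) (q := ⟨f', hg'⟩) (a := v) (p := ⟨f, hf'⟩) ⟨M.symm⟩
      cart.symm t
    change ((h.extendAct hAB dec T).meet SquareClass.all_isAll _ _ _ _).hom ≫
      ((h'.extendAct hAE dec' T).G ⟨M⟩ trivial t).hom =
        ((h''.extendAct hBE dec'' T).G ⟨M⟩ trivial t).hom ≫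
        ((FE.act T).fn v).map ((h.extendAct hAB dec T).meet SquareClass.all_isAll _ _ _ _).hom
    rw [h.extendAct_meet, h.extendAct_meet,
      h'.extendAct_G_of_cart hAE dec' (b := ⟨f', hg⟩) (a := ⟨f, hf⟩) (S := ⟨M⟩) cart,
      h''.extendAct_G_of_cart hBE dec'' (b := ⟨f', hg'⟩) (a := ⟨f, hf'⟩) (S := ⟨M⟩) cart]
    exact (congrArg (_ ≫ ·) e₁.symm).trans (c.trans (congrArg (· ≫ _) e₂))
  -- The cocycle condition with two indices exchanged: solving it for another factor accounts for
  -- the inverse.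
  · intro X Y f hA hE hB t
    change ((h.extendAct hAB dec T).meet SquareClass.all_isAll _ _ _ _).hom =
      ((h''.extendAct hBE dec'' T).meet SquareClass.all_isAll _ _ _ _).inv ≫
        ((h'.extendAct hAE dec' T).meet SquareClass.all_isAll _ _ _ _).hom
    rw [coc f hA hB hE, Iso.inv_hom_id_assoc]
  · intro X X' V V' f hf hf' f' hg hg' x v M cart t
    have c := (compatMeet_iff _ _ _ _).mp (meet' (q := ⟨f', hg, hg'⟩) (p := ⟨f, hf, hf'⟩) (b := x)
      (a := v) ⟨M.symm⟩ cart.symm) T t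
    have e₁ := sqAct_transpose_inv G (b := x) (q := ⟨f', hg⟩) (a := v) (p := ⟨f, hf⟩) ⟨M.symm⟩
      cart.symm t
    change ((h'.extendAct hAE dec' T).meet SquareClass.all_isAll _ _ _ _).hom ≫
      ((h.extendAct hAB dec T).G ⟨M⟩ trivial t).hom =
        ((h''.extendAct hBE dec'' T).G ⟨M.symm⟩ trivial t).inv ≫
        ((FB.act T).fn v).map ((h'.extendAct hAE dec' T).meet SquareClass.all_isAll _ _ _ _).hom
    rw [h'.extendAct_meet, h'.extendAct_meet,
      h.extendAct_G_of_cart hAB dec (b := ⟨f', hg⟩) (a := ⟨f, hf⟩) (S := ⟨M⟩) cart,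
      h''.extendAct_G_of_cart hBE dec'' (q := ⟨f', hg'⟩) (p := ⟨f, hf'⟩) (S := ⟨M.symm⟩) cart.symm]
    exact (congrArg (_ ≫ ·) e₁.symm).trans c
  · intro X Y f hB hE hA t
    change ((h.extendAct hAB dec T).meet SquareClass.all_isAll _ _ _ _).inv =
      ((h'.extendAct hAE dec' T).meet SquareClass.all_isAll _ _ _ _).inv ≫
        ((h''.extendAct hBE dec'' T).meet SquareClass.all_isAll _ _ _ _).hom
    rw [Iso.eq_inv_comp, coc f hA hB hE, Category.assoc, Iso.hom_inv_id, Category.comp_id]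
  · intro X X' V V' f hf hf' f' hg hg' x v M cart t
    have c := (compatMeet_iff _ _ _ _).mp (meet'' (q := ⟨f', hg, hg'⟩) (p := ⟨f, hf, hf'⟩) (b := x)
      (a := v) ⟨M.symm⟩ cart.symm) T t
    change ((h''.extendAct hBE dec'' T).meet SquareClass.all_isAll _ _ _ _).hom ≫
      ((h.extendAct hAB dec T).G ⟨M.symm⟩ trivial t).inv =
        ((h'.extendAct hAE dec' T).G ⟨M.symm⟩ trivial t).inv ≫
        ((FA.act T).fn v).map ((h''.extendAct hBE dec'' T).meet SquareClass.all_isAll _ _ _ _).hom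
    rw [h''.extendAct_meet, h''.extendAct_meet,
      h.extendAct_G_of_cart hAB dec (q := ⟨f', hg⟩) (p := ⟨f, hf⟩) (S := ⟨M.symm⟩) cart.symm,
      h'.extendAct_G_of_cart hAE dec' (q := ⟨f', hg'⟩) (p := ⟨f, hf'⟩) (S := ⟨M.symm⟩) cart.symm]
    exact c
  · intro X Y Z W X' Y' Z' W' b q a p b' q' a' p' x y z w K K' J J' I I' hK hK' hJ hJ' hI hI' comm t
    have c := cubeComm_iff.mp (cube K K' J J' I I' hK hK' hJ hJ' hI hI' comm) T t
    change ((FA.act T).fn a).map ((h''.extendAct hBE dec'' T).G I' trivial t).hom ≫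
      ((h'.extendAct hAE dec' T).G J trivial _).hom ≫
        ((FE.act T).fn w).map ((h.extendAct hAB dec T).G K' trivial t).hom =
      ((h.extendAct hAB dec T).G K trivial _).hom ≫
        ((FB.act T).fn p).map ((h'.extendAct hAE dec' T).G J' trivial t).hom ≫
          ((h''.extendAct hBE dec'' T).G I trivial _).hom
    rw [h.extendAct_G_of_cart hAB dec hK, h.extendAct_G_of_cart hAB dec hK',
      h'.extendAct_G_of_cart hAE dec' hJ, h'.extendAct_G_of_cart hAE dec' hJ',
      h''.extendAct_G_of_cart hBE dec'' hI, h''.extendAct_G_of_cart hBE dec'' hI']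
    exact c

end CubesOfPseudofunctors

/-! ### Morphisms of actions and their compatibility with gluing data -/

section ActHom

variable {C : Type u₁} [Bicategory.{w₁, v₁} C] {A B : ArrowySub C}
  {E : C → Type u₃} [∀ X, Category.{v₃} (E X)] {E' : C → Type u₃} [∀ X, Category.{v₃} (E' X)]

/-- A morphism of actions with the given underlying functors. -/
structure ActHom (P : Act A E) (P' : Act A E') (Φ : ∀ X, E X ⥤ E' X) where
  nat {X Y : C} (f : A.Hom X Y) (x : E X) :
    (Φ Y).obj ((P.fn f).obj x) ≅ (P'.fn f).obj ((Φ X).obj x)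
  naturality {X Y : C} (f : A.Hom X Y) {x y : E X} (u : x ⟶ y) :
    (Φ Y).map ((P.fn f).map u) ≫ (nat f y).hom = (nat f x).hom ≫ (P'.fn f).map ((Φ X).map u)
  cell {X Y : C} {f g : A.Hom X Y} (η : f.hom ≅ g.hom) (x : E X) :
    (nat f x).hom ≫ (P'.cell η _).hom = (Φ Y).map (P.cell η x).hom ≫ (nat g x).hom
  unit {X : C} (x : E X) :
    (nat (.one A X) x).hom ≫ (P'.unit X _).hom = (Φ X).map (P.unit X x).hom
  comp {X Y Z : C} (f : A.Hom X Y) (g : A.Hom Y Z) (x : E X) :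
    (nat (f.then g) x).hom ≫ (P'.comp f g _).hom =
      (Φ Z).map (P.comp f g x).hom ≫ (nat g _).hom ≫ (P'.fn g).map (nat f x).hom

variable {P : Act A E} {P' : Act A E'} {Q : Act B E} {Q' : Act B E'} {Φ : ∀ X, E X ⥤ E' X}

theorem ActHom.split (n : ActHom P P' Φ) {X Y Z : C} {h : A.Hom X Z} {f : A.Hom X Y}
    {g : A.Hom Y Z} (γ : h.hom ≅ f.hom ≫ g.hom) (x : E X) :
    (n.nat h x).hom ≫ (P'.split γ _).hom =
      (Φ Z).map (P.split γ x).hom ≫ (n.nat g _).hom ≫ (P'.fn g).map (n.nat f x).hom := by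
  have c := n.cell (g := f.then g) γ x
  have c' := n.comp f g x
  simp only [Act.split, Iso.trans_hom, Functor.map_comp, Category.assoc]
  rw [← c', reassoc_of% c]

variable (nP : ActHom P P' Φ) (nQ : ActHom Q Q' Φ)

/-- A pair of morphisms of actions is compatible with the families `F` and `F'`. -/
def CompatFill {X Y Z W : C} {b : A.Hom X Y} {q : B.Hom X Z} {a : A.Hom Z W}
    {p : B.Hom Y W} (F : Fill P Q b q a p) (F' : Fill P' Q' b q a p) : Prop :=
  ∀ t, (Φ W).map (F.app t).hom ≫ (nQ.nat p _).hom ≫ (Q'.fn p).map (nP.nat b t).hom =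
    (nP.nat a _).hom ≫ (P'.fn a).map (nQ.nat q t).hom ≫ (F'.app _).hom

variable {nP nQ}

/-- Compatibility passes through the pasting formula: the formula involves only `F`, `ρ f` and
constraints of the actions, and a morphism of actions respects the constraints. -/
theorem CompatFill.push {𝒢 : SquareClass A B} {Γ : MeetGluing P Q 𝒢} {Γ' : MeetGluing P' Q' 𝒢}
    {X X' Y Z W : C} {b : A.Hom X Y} {q : B.Hom X Z} {a : A.Hom Z W} {p : B.Hom Y W}
    {k : A.Hom X' Y} {r : B.Hom X' Z} {f : X ⟶ X'} (hf : A.mem f) (hf' : B.mem f)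
    (γ : q.hom ≅ f ≫ r.hom) (δ : b.hom ≅ f ≫ k.hom) {F : Fill P Q k r a p} {F' : Fill P' Q' k r a p}
    (h : CompatFill nP nQ F F')
    (hρ : ∀ t, (Φ X').map (Γ.ρ f hf hf' t).hom ≫ (nP.nat ⟨f, hf⟩ t).hom =
      (nQ.nat ⟨f, hf'⟩ t).hom ≫ (Γ'.ρ f hf hf' _).hom) :
    CompatFill nP nQ (Γ.push hf hf' γ δ F) (Γ'.push hf hf' γ δ F') := by
  intro t
  have c₁ := congrArg (Φ W).map (Γ.push_hom_map hf hf' γ δ F t)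
  have c₂ := Γ'.push_hom_map hf hf' γ δ F' ((Φ X).obj t)
  have c₃ := nP.split (f := ⟨f, hf⟩) δ t
  have c₄ := nQ.split (f := ⟨f, hf'⟩) γ t
  have n₁ := nQ.naturality p (P.split (f := ⟨f, hf⟩) δ t).hom
  have n₂ := nQ.naturality p ((P.fn k).map (Γ.ρ f hf hf' t).hom)
  have n₃ := nP.naturality k (Γ.ρ f hf hf' t).hom
  have n₄ := nP.naturality a (Q.split (f := ⟨f, hf'⟩) γ t).hom
  have n₅ := F'.naturality (nQ.nat ⟨f, hf'⟩ t).hom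
  have c₅ := h ((Q.fn ⟨f, hf'⟩).obj t)
  simp only [Functor.map_comp] at c₁
  rw [← cancel_mono ((Q'.fn p).map (P'.split (f := ⟨f, hf⟩) δ _).hom)]
  simp only [Category.assoc]
  rw [← Functor.map_comp (Q'.fn p), c₃, c₂]
  simp only [Functor.map_comp]
  rw [← reassoc_of% n₁, reassoc_of% c₁, reassoc_of% n₂]
  simp only [← Functor.map_comp]
  rw [reassoc_of% n₃]
  simp only [← Functor.map_comp, ← Functor.map_comp_assoc]
  rw [hρ, c₄]
  simp only [Functor.map_comp, Category.assoc]
  rw [reassoc_of% n₅, ← reassoc_of% n₄, reassoc_of% c₅]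

/-- The induced `ρ f` is the value at the corner of `f` up to unit constraints, and these are
respected by morphisms of actions. -/
theorem CompatFill.meet {𝒢 : SquareClass A B} (h𝒢 : 𝒢.IsAll) {Γ : SqGluing P Q 𝒢}
    {Γ' : SqGluing P' Q' 𝒢} {X Y : C} {f : X ⟶ Y} (hf : A.mem f) (hf' : B.mem f)
    (h : CompatFill nP nQ (Γ.fill (Square.cornerOf f hf hf') (h𝒢.mem _))
      (Γ'.fill (Square.cornerOf f hf hf') (h𝒢.mem _))) (t : E X) :
    (Φ Y).map (Γ.meet h𝒢 f hf hf' t).hom ≫ (nP.nat ⟨f, hf⟩ t).hom =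
      (nQ.nat ⟨f, hf'⟩ t).hom ≫ (Γ'.meet h𝒢 f hf hf' _).hom := by
  have c := h t
  have n₁ := nQ.unit ((P.fn ⟨f, hf⟩).obj t)
  have n₂ := nP.unit ((Q.fn ⟨f, hf'⟩).obj t)
  have n₃ := Q'.unit_naturality (nP.nat ⟨f, hf⟩ t).hom
  have n₄ := P'.unit_naturality (nQ.nat ⟨f, hf'⟩ t).hom
  rw [SqGluing.meet_hom, SqGluing.meet_hom,
    ← cancel_epi ((Φ Y).map (P.unit Y ((Q.fn ⟨f, hf'⟩).obj t)).hom)]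
  simp only [Functor.map_comp, Category.assoc]
  rw [← n₂, ← n₁]
  simp only [Category.assoc]
  rw [← n₃, ← reassoc_of% n₄, Iso.hom_inv_id_assoc, ← reassoc_of% c, reassoc_of% n₂,
    ← Functor.map_comp_assoc, Iso.hom_inv_id, CategoryTheory.Functor.map_id, Category.id_comp]

end ActHom

/-! ### Pseudonatural transformations compatible with gluing data -/

section Transformations

variable {C : Type u₁} [Bicategory.{w₁, v₁} C] {D : Type u₂} [Bicategory.{w₂, v₂} D]
  {A B : ArrowySub C} {F₀ F₀' : C → D}

/-- The morphism of actions attached to a pseudonatural transformation. -/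
@[reducible]
def StrongOn.act {F : PsOn A F₀} {F' : PsOn A F₀'} {α₀ : ∀ X, F₀ X ⟶ F₀' X}
    (α : StrongOn F F' α₀) (T : D) : ActHom (F.act T) (F'.act T)
      (fun X => { obj := fun x => x ≫ α₀ X, map := fun u => u ▷ α₀ X }) where
  nat f x := sqAct (α.nat f) x
  naturality f _ _ u := sqAct_naturality (α.nat f) u
  cell {X Y f g} η x := by
    have := congrArg (fun k => (α_ x (F.map f) (α₀ Y)).hom ≫ x ◁ k ≫ (α_ x (α₀ X) (F'.map g)).inv)
      (α.nat_map₂ η.hom)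
    change (sqAct (α.nat f) x).hom ≫ (x ≫ α₀ X) ◁ F'.map₂ η.hom =
      (x ◁ F.map₂ η.hom) ▷ α₀ Y ≫ (sqAct (α.nat g) x).hom
    simp [sqAct] at this ⊢
    exact this.symm
  unit {X} x := by
    refine ((vId_iff (α.nat (.id A X)) (F.mapId X) (F'.mapId X) (𝟙 (α₀ X))).mp ?_ T x).trans ?_
    · rw [← cancel_mono (α₀ X ◁ (F'.mapId X).hom), α.nat_id]
      simp
    · rw [whiskerLeft_id, Category.comp_id]
      rfl
  comp f g x := (comp_whiskerLeft_iff _ _ _ _ _).mp (α.nat_comp f g) T x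

variable {FA : PsOn A F₀} {FB : PsOn B F₀} {FA' : PsOn A F₀'} {FB' : PsOn B F₀'}
  {G : SquareData FA FB} {G' : SquareData FA' FB'} {α₀ : ∀ X, F₀ X ⟶ F₀' X}
  (αA : StrongOn FA FA' α₀) (αB : StrongOn FB FB' α₀)

/-- Condition (m) is a commutative cube in `D` with the components of the transformations as third
direction, so its evaluation is that of a hexagon. -/
theorem compatAt_iff (h : IsPairGluing G) (h' : IsPairGluing G') {X Y Z W : C} {b : A.Hom X Y}
    {q : B.Hom X Z} {a : A.Hom Z W} {p : B.Hom Y W} (S : Square b q a p) :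
    CompatAt αA αB (G S) (G' S) ↔ ∀ T, CompatFill (αA.act T) (αB.act T)
      ((h.act T).fill S trivial) ((h'.act T).fill S trivial) :=
  cubeComm_iff

theorem natMeet_iff {X Y X' Y' : D} {f g : X ⟶ Y} {f' g' : X' ⟶ Y'} {u : X ⟶ X'} {v : Y ⟶ Y'}
    (n : f ≫ v ≅ u ≫ f') (m : g ≫ v ≅ u ≫ g') (r : g ⟶ f) (r' : g' ⟶ f') :
    r ▷ v ≫ n.hom = m.hom ≫ u ◁ r' ↔ ∀ (T : D) (t : T ⟶ X),
      (t ◁ r) ▷ v ≫ (sqAct n t).hom = (sqAct m t).hom ≫ (t ≫ u) ◁ r' := by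
  rw [eq_iff_whiskerLeft]
  refine forall₂_congr fun T t => ?_
  rw [← cancel_epi (α_ t g v).hom, ← cancel_mono (α_ t u f').inv]
  refine Eq.congr ?_ ?_ <;> simp [sqAct]

theorem compatMeet_iff_act (h : IsPairGluing G) (h' : IsPairGluing G') {X Y : C} (f : X ⟶ Y)
    (hA : A.mem f) (hB : B.mem f) :
    (G.meet ⟨f, hA, hB⟩).hom ▷ α₀ Y ≫ (αA.nat ⟨f, hA⟩).hom =
        (αB.nat ⟨f, hB⟩).hom ≫ α₀ X ◁ (G'.meet ⟨f, hA, hB⟩).hom ↔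
      ∀ T (t : T ⟶ F₀ X),
        ((h.act T).meet SquareClass.all_isAll f hA hB t).hom ▷ α₀ Y ≫
            ((αA.act T).nat ⟨f, hA⟩ t).hom =
          ((αB.act T).nat ⟨f, hB⟩ t).hom ≫
            ((h'.act T).meet SquareClass.all_isAll f hA hB (t ≫ α₀ X)).hom := by
  refine (natMeet_iff (αA.nat ⟨f, hA⟩) (αB.nat ⟨f, hB⟩) _ _).trans (forall₂_congr fun T t => ?_)
  rw [h.act_meet, h'.act_meet]
  rfl

theorem compatMeet_of_compatAt (h : IsPairGluing G) (h' : IsPairGluing G')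
    (hG : ∀ {X Y Z W : C} {b : A.Hom X Y} {q : B.Hom X Z} {a : A.Hom Z W} {p : B.Hom Y W}
      (S : Square b q a p), CompatAt αA αB (G S) (G' S)) {X Y : C} (f : (A.inter B).Hom X Y) :
    (G.meet f).hom ▷ α₀ Y ≫ (αA.nat f.fst).hom =
      (αB.nat f.snd).hom ≫ α₀ X ◁ (G'.meet f).hom :=
  (compatMeet_iff_act αA αB h h' f.hom f.mem.1 f.mem.2).mpr fun T =>
    CompatFill.meet SquareClass.all_isAll f.mem.1 f.mem.2
      ((compatAt_iff αA αB h h' (Square.cornerOf f.hom f.mem.1 f.mem.2)).mp (hG _) T)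

variable [Strict C]

/-- The source and target data are both given by the pasting formula along the same decomposition of
`S`, so (m) at `S` follows from (m) at the 2-Cartesian square and (n) at `f`. -/
theorem compatAt_of_cart (h : IsPairGluing G) (h' : IsPairGluing G') (hsq : IsSquaring A B)
    (hG : ∀ {X Y Z W : C} {b : A.Hom X Y} {q : B.Hom X Z} {a : A.Hom Z W} {p : B.Hom Y W}
      (S : Square b q a p), S.IsCart → CompatAt αA αB (G S) (G' S))
    (hρ : ∀ {X Y : C} (f : (A.inter B).Hom X Y),
      (G.meet f).hom ▷ α₀ Y ≫ (αA.nat f.fst).hom =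
        (αB.nat f.snd).hom ≫ α₀ X ◁ (G'.meet f).hom) {X Y Z W : C} {b : A.Hom X Y}
    {q : B.Hom X Z} {a : A.Hom Z W} {p : B.Hom Y W} (S : Square b q a p) :
    CompatAt αA αB (G S) (G' S) := by
  obtain ⟨d⟩ := hsq.exists_decomp S
  refine (compatAt_iff αA αB h h' S).mpr fun T => ?_
  have c := ((h.act T).toMeetGluing SquareClass.all_isAll).fill_eq_push (S := S) (S' := d.sq)
    SquareClass.all_isAll d.hf d.hf' trivial trivial d.γ d.δ d.e
  have c' := ((h'.act T).toMeetGluing SquareClass.all_isAll).fill_eq_push (S := S) (S' := d.sq)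
    SquareClass.all_isAll d.hf d.hf' trivial trivial d.γ d.δ d.e
  refine (congrArg₂ (CompatFill (αA.act T) (αB.act T)) c c').mpr ?_
  exact CompatFill.push d.hf d.hf' d.γ d.δ ((compatAt_iff αA αB h h' d.sq).mp (hG d.sq d.cart) T)
    ((compatMeet_iff_act αA αB h h' d.f d.hf d.hf').mp (hρ ⟨d.f, d.hf, d.hf'⟩) T)

end Transformations

/-! ### Restriction of gluing data to 2-Cartesian squares -/

section Restriction

variable {C : Type u₁} [Bicategory.{w₁, v₁} C] {D : Type u₂} [Bicategory.{w₂, v₂} D]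
  {A B A' : ArrowySub C} {F₀ : C → D} {FA : PsOn A F₀} {FB : PsOn B F₀} {FE : PsOn A' F₀}

theorem IsPairGluing.isCartPairGluing_toCart [Strict C] [IsLocallyGroupoid C]
    {G : SquareData FA FB} (h : IsPairGluing G) : IsCartPairGluing G.toCart G.meet :=
  .of_act (𝒢 := .all A B) ⟨fun _ => trivial⟩
    (fun T => (h.act T).toMeetGluing SquareClass.all_isAll) (fun _ _ _ _ _ _ _ _ _ _ _ _ => rfl)
    fun _ _ _ f hA hB x => h.act_meet f hA hB x

section

variable {G : SquareData FA FB} {G' : SquareData FA FE} {G'' : SquareData FB FE}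
  (h : IsPairGluing G) (h' : IsPairGluing G') (h'' : IsPairGluing G'')

theorem hexAll_act
    (cube : ∀ {X Y Z W X' Y' Z' W' : C}
      {b : A.Hom X Y} {q : B.Hom X Z} {a : A.Hom Z W} {p : B.Hom Y W}
      {b' : A.Hom X' Y'} {q' : B.Hom X' Z'} {a' : A.Hom Z' W'} {p' : B.Hom Y' W'}
      {x : A'.Hom X' X} {y : A'.Hom Y' Y} {z : A'.Hom Z' Z} {w : A'.Hom W' W}
      (K : Square b q a p) (K' : Square b' q' a' p') (J : Square a' z a w)
      (J' : Square b' x b y) (I : Square p' y p w) (I' : Square q' x q z)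
      (_ : CubeComm K.cell K'.cell J.cell J'.cell I.cell I'.cell),
      CubeComm (G K) (G K') (G' J) (G' J') (G'' I) (G'' I')) (T : D) :
    HexAll (h.act T) (h'.act T) (h''.act T) where
  hex {_ _ _ _ _ _ _ _ _ _ _ _ _ _ _ _ _ _ _ _ K K' J J' I I'} _ _ _ _ _ _ comm :=
    cubeComm_iff.mp (cube K K' J J' I I' comm) T

theorem cubeComm_of_hexAll (H : ∀ T, HexAll (h.act T) (h'.act T) (h''.act T))
    {X Y Z W X' Y' Z' W' : C}
    {b : A.Hom X Y} {q : B.Hom X Z} {a : A.Hom Z W} {p : B.Hom Y W}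
    {b' : A.Hom X' Y'} {q' : B.Hom X' Z'} {a' : A.Hom Z' W'} {p' : B.Hom Y' W'}
    {x : A'.Hom X' X} {y : A'.Hom Y' Y} {z : A'.Hom Z' Z} {w : A'.Hom W' W}
    (K : Square b q a p) (K' : Square b' q' a' p') (J : Square a' z a w)
    (J' : Square b' x b y) (I : Square p' y p w) (I' : Square q' x q z)
    (comm : CubeComm K.cell K'.cell J.cell J'.cell I.cell I'.cell) :
    CubeComm (G K) (G K') (G' J) (G' J') (G'' I) (G'' I') :=
  cubeComm_iff.mpr fun T => (H T).hex trivial trivial trivial trivial trivial trivial comm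

theorem meet_cocycle [Strict C] (H : ∀ T, HexAll (h.act T) (h'.act T) (h''.act T)) {X Y : C}
    (f : X ⟶ Y) (hA : A.mem f) (hB : B.mem f) (hE : A'.mem f) :
    (G''.meet ⟨f, hB, hE⟩).hom ≫ (G.meet ⟨f, hA, hB⟩).hom = (G'.meet ⟨f, hA, hE⟩).hom :=
  whiskerLeft_injective fun T x => by
    have c := ((H T).meetCompat SquareClass.all_isAll).cocycle SquareClass.all_isAll
      SquareClass.all_isAll f hA hB hE x
    change _ = _ ≫ ((h.act T).meet SquareClass.all_isAll f hA hB x).hom at c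
    rw [h.act_meet, h'.act_meet, h''.act_meet] at c
    exact (whiskerLeft_comp _ _ _).trans c.symm

end

/-- Stated with general families and with `g`, `g'` as inverse evaluations, so that it covers every
position of the third index relative to the pair, with original or transposed data. -/
theorem compatMeet_of_hexAll [Strict C] {ρ : SquareData FA FB} (h : IsPairGluing ρ)
    {𝒢' : SquareClass A A'} {𝒢'' : SquareClass B A'} (h𝒢' : 𝒢'.IsAll) (h𝒢'' : 𝒢''.IsAll)
    (Λ : ∀ T, SqGluing (FA.act T) (FE.act T) 𝒢') (Θ : ∀ T, SqGluing (FB.act T) (FE.act T) 𝒢'')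
    (H : ∀ T, HexAll (h.act T) (Λ T) (Θ T)) {g : CartSquareData FE FA} {g' : CartSquareData FE FB}
    (hg : ∀ T {X Y Z W : C} {b : A'.Hom X Y} {q : A.Hom X Z} {a : A'.Hom Z W} {p : A.Hom Y W}
      (S : Square b q a p) (hS : S.IsCart) (x : T ⟶ F₀ X),
      ((Λ T).G ⟨S.cell.symm⟩ (h𝒢'.mem _) x).hom = (sqAct (g S hS) x).inv)
    (hg' : ∀ T {X Y Z W : C} {b : A'.Hom X Y} {q : B.Hom X Z} {a : A'.Hom Z W} {p : B.Hom Y W}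
      (S : Square b q a p) (hS : S.IsCart) (x : T ⟶ F₀ X),
      ((Θ T).G ⟨S.cell.symm⟩ (h𝒢''.mem _) x).hom = (sqAct (g' S hS) x).inv)
    {X Y Z W : C} {b : A'.Hom X Y} {q : (A.inter B).Hom X Z} {a : A'.Hom Z W}
    {p : (A.inter B).Hom Y W} (S : Square b q a p) (hS : S.IsCart) :
    (ρ.meet q).hom ▷ FE.map a ≫ (g S.toFst hS).hom =
      (g' S.toSnd hS).hom ≫ FE.map b ◁ (ρ.meet p).hom := by
  refine (compatMeet_iff _ _ _ _).mpr fun T x => ?_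
  have c := ((H T).meetCompat SquareClass.all_isAll).eq p.mem.1 p.mem.2 q.mem.1 q.mem.2 S.cell.symm
    (h𝒢'.mem _) (h𝒢''.mem _) x
  change ((h.act T).meet SquareClass.all_isAll p.hom p.mem.1 p.mem.2 _).hom ≫ _ = _ ≫
    ((h.act T).meet SquareClass.all_isAll q.hom q.mem.1 q.mem.2 _).hom ▷ _ at c
  rw [h.act_meet, h.act_meet] at c
  exact (congrArg (_ ≫ ·) (hg T S.toFst hS x)).symm.trans
    (c.trans (congrArg (· ≫ _) (hg' T S.toSnd hS x)))

end Restriction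

/-! ### The comparison 2-functor is well defined -/

section Objects

variable {C : Type u₁} [Bicategory.{w₁, v₁} C]
  {D : Type u₂} [Bicategory.{w₂, v₂} D] {n : ℕ} {A : Fin n → ArrowySub C}

theorem CartData.Gne_of_lt (X : CartData A D) {i j : Fin n} (h : i < j) :
    X.Gne i j h.ne = X.G i j h :=
  dif_pos h

theorem CartData.Gne_of_gt (X : CartData A D) {i j : Fin n} (h : j < i) :
    X.Gne i j h.ne' = (X.G j i h).transpose :=
  dif_neg h.asymm

theorem GD.hexAll (X : GD A D) {i j k : Fin n} (hij : i < j) (hjk : j < k) (T : D) :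
    HexAll ((X.pair i j hij).act T) ((X.pair i k (hij.trans hjk)).act T)
      ((X.pair j k hjk).act T) :=
  hexAll_act _ _ _ (X.cube i j k hij hjk) T

theorem GD.IsMor.toCartData {X Y : GD A D} {α : X.toFam ⟶ Y.toFam} (h : GD.IsMor X Y α) :
    CartData.IsMor X.toCartData Y.toCartData α where
  square i j hij _ _ _ _ _ _ _ _ S _ := h i j hij S
  meet i j hij _ _ f := compatMeet_of_compatAt (α.tr i) (α.tr j) (X.pair i j hij)
    (Y.pair i j hij) (fun S => h i j hij S) f

variable [Strict C]

theorem CartData.IsMor.of_toCartData {X Y : GD A D} {α : X.toFam ⟶ Y.toFam}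
    (hsq : ∀ i j : Fin n, i ≠ j → IsSquaring (A i) (A j))
    (h : CartData.IsMor X.toCartData Y.toCartData α) : GD.IsMor X Y α :=
  fun i j hij _ _ _ _ _ _ _ _ S => compatAt_of_cart (α.tr i) (α.tr j) (X.pair i j hij)
    (Y.pair i j hij) (hsq i j hij.ne) (fun S hS => h.square i j hij S hS)
    (fun f => h.meet i j hij f) S

variable [IsLocallyGroupoid C]

theorem GD.toCartData_isGluing (X : GD A D) : X.toCartData.IsGluing where
  pair i j h := (X.pair i j h).isCartPairGluing_toCart
  cube i j k hij hjk _ _ _ _ _ _ _ _ _ _ _ _ _ _ _ _ _ _ _ _ K K' J J' I I' _ _ _ _ _ _ comm :=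
    X.cube i j k hij hjk K K' J J' I I' comm
  meet i j k hjk hij hik _ _ _ _ _ _ _ _ S hS := by
    -- Three cases, `i < j`, `j < i < k` and `k < i`: in each the hexagon for the sorted triple is
    -- permuted so that the pair `(j, k)` spans the bottom and top faces.
    rcases lt_or_gt_of_ne hij with hij' | hij'
    · rw [X.toCartData.Gne_of_lt hij', X.toCartData.Gne_of_lt (hij'.trans hjk)]
      exact compatMeet_of_hexAll (X.pair j k hjk) SquareClass.all_isAll.transpose
        SquareClass.all_isAll.transpose _ _
        (fun T => (X.hexAll hij' hjk T).swap_fst_snd.swap_snd_trd)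
        (fun T _ _ _ _ _ _ _ _ S hS x => rfl) (fun T _ _ _ _ _ _ _ _ S hS x => rfl) S hS
    · rcases lt_or_gt_of_ne hik with hik' | hik'
      · rw [X.toCartData.Gne_of_gt hij', X.toCartData.Gne_of_lt hik']
        exact compatMeet_of_hexAll (X.pair j k hjk) SquareClass.all_isAll
          SquareClass.all_isAll.transpose _ _
          (fun T => (X.hexAll hij' hik' T).swap_snd_trd)
          (fun T _ _ _ _ _ _ _ _ S hS x =>
            (sqAct_transpose_inv (X.toCartData.G j i hij') S hS x).symm)
          (fun T _ _ _ _ _ _ _ _ S hS x => rfl) S hS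
      · rw [X.toCartData.Gne_of_gt hij', X.toCartData.Gne_of_gt hik']
        exact compatMeet_of_hexAll (X.pair j k hjk) SquareClass.all_isAll
          SquareClass.all_isAll _ _
          (fun T => X.hexAll hjk hik' T)
          (fun T _ _ _ _ _ _ _ _ S hS x =>
            (sqAct_transpose_inv (X.toCartData.G j i hij') S hS x).symm)
          (fun T _ _ _ _ _ _ _ _ S hS x =>
            (sqAct_transpose_inv (X.toCartData.G k i hik') S hS x).symm) S hS
  cocycle i j k hij hjk _ _ f hi hj hk :=
    meet_cocycle _ _ _ (X.hexAll hij hjk) f hi hj hk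

end Objects

/-! ### The comparison 2-functor is an isomorphism -/

section Comparison

variable {C : Type u₁} [Bicategory.{w₁, v₁} C]
  {D : Type u₂} [Bicategory.{w₂, v₂} D] {n : ℕ} {A : Fin n → ArrowySub C}

/-- The constraints of a strict pseudofunctor are the isomorphisms given by equalities, so they
carry no additional data. -/
theorem strictPseudofunctor_ext {F G : StrictPseudofunctor C D}
    (h : F.toPrelaxFunctor = G.toPrelaxFunctor) : F = G := by
  obtain ⟨⟨⟨F, i, c, _, _, _, _, _⟩, _, hi⟩, _, hc⟩ := F
  obtain ⟨⟨⟨G, i', c', _, _, _, _, _⟩, _, hi'⟩, _, hc'⟩ := G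
  obtain rfl : F = G := h
  obtain rfl : i = i' := funext fun X => (hi X).trans (hi' X).symm
  obtain rfl : @c = @c' := by
    funext X Y Z f g
    exact (hc f g).trans (hc' f g).symm
  rfl

/-- The squaring conditions on a family of arrowy 2-subcategories. -/
structure IsSquaringFamily (A : Fin n → ArrowySub C) : Prop where
  equiv_mem (i : Fin n) ⦃X Y : C⦄ (e : Bicategory.Equivalence X Y) : (A i).mem e.hom
  squaring (i j : Fin n) : i ≠ j → IsSquaring (A i) (A j)
  squaring_meet (i j : Fin n) : i ≠ j → IsSquaring (A i) ((A i).inter (A j))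
  cube_squaring (i j k : Fin n) : i ≠ j → i ≠ k → j ≠ k → IsCubeSquaring (A i) (A j) (A k)
  meet_squaring (i j k : Fin n) : i ≠ j → i ≠ k → j ≠ k → IsSquaring ((A i).inter (A j)) (A k)

theorem IsSquaringFamily.squaringPair (hA : IsSquaringFamily A) {i j : Fin n} (h : i ≠ j) :
    SquaringPair (A i) (A j) where
  equiv_left := hA.equiv_mem i
  equiv_right := hA.equiv_mem j
  squaring := hA.squaring i j h
  squaring_symm := hA.squaring j i h.symm
  squaring_left := hA.squaring_meet i j h
  squaring_right := hA.squaring_meet j i h.symm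

/-- A choice of decompositions of squares. -/
noncomputable def IsSquaring.decomp {A B : ArrowySub C} (h : IsSquaring A B) {X Y Z W : C}
    {b : A.Hom X Y} {q : B.Hom X Z} {a : A.Hom Z W} {p : B.Hom Y W} (S : Square b q a p) :
    Decomp S :=
  (h.exists_decomp S).some

variable [Strict C]

theorem GD.eq_of_toCartData_eq (hA : IsSquaringFamily A) {X Y : GD A D}
    (e : X.toCartData = Y.toCartData) : X = Y := by
  obtain ⟨F, G, h, _⟩ := X
  obtain ⟨F', G', h', _⟩ := Y
  simp only [GD.toCartData, CartData.mk.injEq] at e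
  obtain ⟨rfl, e₁, e₂⟩ := e
  obtain rfl : G = G' := by
    funext i j hij
    exact (h i j hij).eq_of_toCart_eq (h' i j hij) (hA.squaring i j hij.ne)
      (congrFun (congrFun (congrFun (eq_of_heq e₁) i) j) hij)
      (congrFun (congrFun (congrFun (eq_of_heq e₂) i) j) hij)
  rfl

variable [IsLocallyGroupoid C]

/-- The gluing datum extending a Cartesian gluing datum. -/
noncomputable def CartData.IsGluing.extend {X : CartData A D} (h : X.IsGluing)
    (hA : IsSquaringFamily A) : GD A D where
  toFam := X.toFam
  G i j hij := squareExt (X.G i j hij) (X.ρ i j hij) (hA.squaring i j hij.ne).decomp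
  pair i j hij := (h.pair i j hij).isPairGluing_squareExt (hA.squaringPair hij.ne) _
  cube i j k hij hjk _ _ _ _ _ _ _ _ _ _ _ _ _ _ _ _ _ _ _ _ K K' J J' I I' comm := by
    have hik := hij.trans hjk
    refine cubeComm_of_hexAll
      ((h.pair i j hij).isPairGluing_squareExt (hA.squaringPair hij.ne) _)
      ((h.pair i k hik).isPairGluing_squareExt (hA.squaringPair hik.ne) _)
      ((h.pair j k hjk).isPairGluing_squareExt (hA.squaringPair hjk.ne) _) (fun T => ?_)
      K K' J J' I I' comm
    rw [IsCartPairGluing.act_squareExt, IsCartPairGluing.act_squareExt,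
      IsCartPairGluing.act_squareExt]
    refine hexAll_extendAct (h.pair i j hij) (h.pair i k hik) (h.pair j k hjk)
      (hA.squaringPair hij.ne) (hA.squaringPair hik.ne) (hA.squaringPair hjk.ne) _ _ _
      (hA.meet_squaring i j k hij.ne hik.ne hjk.ne)
      (hA.meet_squaring i k j hik.ne hij.ne hjk.ne')
      (hA.meet_squaring j k i hjk.ne hij.ne' hik.ne')
      (hA.cube_squaring i j k hij.ne hik.ne hjk.ne)
      (hA.cube_squaring i k j hik.ne hij.ne hjk.ne')
      (hA.cube_squaring j k i hjk.ne hij.ne' hik.ne')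
      (h.cube i j k hij hjk) (fun S hS => ?_) (fun S hS => ?_) (fun S hS => ?_)
      (h.cocycle i j k hij hjk) T
    -- The three instances of (E), in which the index outside the pair is `k`, `j` and `i` in turn;
    -- its position decides which of the two values are transposed.
    · have := h.meet k i j hij hik.ne' hjk.ne' S hS
      rwa [X.Gne_of_gt hik, X.Gne_of_gt hjk] at this
    · have := h.meet j i k hik hij.ne' hjk.ne S hS
      rwa [X.Gne_of_gt hij, X.Gne_of_lt hjk] at this
    · have := h.meet i j k hjk hij.ne hik.ne S hS
      rwa [X.Gne_of_lt hij, X.Gne_of_lt hik] at this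

theorem CartData.IsGluing.toCartData_extend {X : CartData A D} (h : X.IsGluing)
    (hA : IsSquaringFamily A) : (h.extend hA).toCartData = X := by
  have e₁ : (fun i j hij => ((h.extend hA).G i j hij).toCart) = X.G := by
    funext i j hij
    exact (h.pair i j hij).toCart_squareExt (hA.squaringPair hij.ne) _
  have e₂ : (fun i j hij => ((h.extend hA).G i j hij).meet) = X.ρ := by
    funext i j hij
    exact (h.pair i j hij).meet_squareExt (hA.squaringPair hij.ne) _
  exact congrArg₂ (CartData.mk X.toFam) e₁ e₂

/-- Objects are handled by extension and its uniqueness. Underlying families of transformations and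
modifications are unchanged, so for morphisms the only point is that compatibility on 2-Cartesian
squares and with `ρ` implies compatibility on all squares. -/
theorem isIsoOver_toCart [Strict D] (hA : IsSquaringFamily A) :
    IsIsoOver (GD.forget A D) (GDCart.forget A D)
      (GD.toCart GD.toCartData_isGluing fun _ _ _ h => GD.IsMor.toCartData h) where
  comm := strictPseudofunctor_ext rfl
  obj := by
    constructor
    · intro X Y e
      exact GD.eq_of_toCartData_eq hA (congrArg GDCart.toCartData e)
    · rintro ⟨X, h⟩
      refine ⟨h.extend hA, ?_⟩
      have := h.toCartData_extend hA
      change GDCart.mk _ _ = _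
      congr
  map X Y := by
    constructor
    · rintro ⟨f, hf⟩ ⟨g, hg⟩ e
      obtain rfl : f = g := congrArg Sub.Hom.hom e
      rfl
    · rintro ⟨f, hf⟩
      exact ⟨⟨f, CartData.IsMor.of_toCartData hA.squaring hf⟩, rfl⟩
  map₂ {X Y} f g := by
    constructor
    · rintro ⟨η⟩ ⟨θ⟩ e
      have e' : Sub.Hom₂.mk (S := GDCart.mor A D) (X := ⟨X.toCartData, X.toCartData_isGluing⟩)
        (Y := ⟨Y.toCartData, Y.toCartData_isGluing⟩) (f := ⟨f.hom, f.mem.toCartData⟩)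
        (g := ⟨g.hom, g.mem.toCartData⟩) η = ⟨θ⟩ := e
      have e'' := congrArg Sub.Hom₂.cell e'
      obtain rfl : η = θ := e''
      rfl
    · rintro ⟨η⟩
      exact ⟨⟨η⟩, rfl⟩

end Comparison

end GluingData

theorem theoremp {C : Type*} [Bicategory C] [Bicategory.Strict C] [Bicategory.IsLocallyGroupoid C]
    {D : Type*} [Bicategory D] [Bicategory.Strict D] {n : ℕ}
    (A : Fin n → GluingData.ArrowySub C)
    (equiv_mem : ∀ (i : Fin n) ⦃X Y : C⦄ (e : Bicategory.Equivalence X Y), (A i).mem e.hom)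
    (squaring : ∀ i j : Fin n, i ≠ j → GluingData.IsSquaring (A i) (A j))
    (squaring_meet : ∀ i j : Fin n, i ≠ j → GluingData.IsSquaring (A i) ((A i).inter (A j)))
    (cube_squaring : ∀ i j k : Fin n, i ≠ j → i ≠ k → j ≠ k →
      GluingData.IsCubeSquaring (A i) (A j) (A k))
    (meet_squaring : ∀ i j k : Fin n, i ≠ j → i ≠ k → j ≠ k →
      GluingData.IsSquaring ((A i).inter (A j)) (A k)) :
    ∃ (hobj : ∀ X : GluingData.GD A D, X.toCartData.IsGluing)
      (hmor : ∀ (X Y : GluingData.GD A D) (α : X.toFam ⟶ Y.toFam), GluingData.GD.IsMor X Y α →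
        GluingData.CartData.IsMor X.toCartData Y.toCartData α),
      GluingData.IsIsoOver (GluingData.GD.forget A D) (GluingData.GDCart.forget A D)
        (GluingData.GD.toCart hobj hmor) :=
  ⟨GluingData.GD.toCartData_isGluing, fun _ _ _ h => GluingData.GD.IsMor.toCartData h,
    GluingData.isIsoOver_toCart
      ⟨equiv_mem, squaring, squaring_meet, cube_squaring, meet_squaring⟩⟩
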